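/- **Setting.** Let $\mathbf p=(p_1,p_2,p_3)$ be a probability vector with all $p_i>0$, $|\mathbf p|=(\sum_i p_i^2)^{1/2}$, $\Omega=\{v\in\mathbb R^3:|v|=1,\ |v_i|=p_i/|\mathbf p|\}$, let $\vartheta_i$ change the sign of the $i$-th coordinate, and let $\Omega_v=\{\vartheta_1v,\vartheta_2v,\vartheta_3v\}$. For $r>0$ let $\mathcal Q_r=[-\frac r2,\frac r2]^3$, and for $w=\vartheta_kv$ let $B(v,w)=\{b\in\partial\mathcal Q_r: b_k=-\frac{v_k}{|v_k|}\frac r2\}$ be the face that a particle of velocity $v$ hits in order to leave with velocity $w$. *Collision data for the velocity $v$* are a random pair $(\beta,\vartheta_k v)$ where $k$ has probability $p_k$ and $\beta$ is uniform on $-B(v,\vartheta_kv)$. Fix $w\in\Omega$, $u\in\Omega_w$ and $\beta_0\in -B(u,w)$. *Markovian velocities.* $U$ is the jump process with $U(0^+)=u_1=w$ that jumps at times $\tau_n=\xi_1+\dots+\xi_n$, with $\xi_i$ i.i.d. $EXP(1)$, from $u_n$ to $u_{n+1}$, where $(\beta_n,u_{n+1})$ are collision data for $u_n$. *Forgetful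 process $Z$ and wind-tree exploration process $\mathscr X$.* Both start at $0$ with velocity $w$ and the single obstacle centre $\beta_0$, and both attempt fresh collisions at certain times (their attempt times, numbered from $1$; time $0$ has number $0$). Between attempts number $n-1$ and $n$ the particle flies with elastic reflections at the cubes $\mathcal Q_r+c$, where $c$ runs over all obstacle centres placed so far for $\mathscr X$, and over the centres placed in attempts $n-1$ and $n-2$ only for $Z$ ($\beta_0$ counts as placed in attempt $0$). In attempt number $n$, at the position $x$ and with data $(\beta,v')$ for the velocity just before, the cube $x+\beta+\mathcal Q_r$ is tested against the earlier trajectory: for $\mathscr X$ against its trajectory after time $0$ and up to attempt $n-1$, for $Z$ only against its trajectory after attempt $n-2$ and up to attempt $n-1$. If it meets it, nothing is placed and the velocity is unchanged; otherwise the centre $x+\beta$ is placed and the velocity becomes $v'$. In both cases $v'$ is called the attempted velocity. *Coupling.* Call two velocities of the same parity if they agree or differ in exactly two signs. For each $n\ge0$ let $\zeta_n\sim EXP(1)$ be independent of the past. On $[\tau_{2n},\tau_{2n+2})$ a process ($\mathscr X$ or $Z$) whose velocity at $\tau_{2n}^+$ has the parity of $U(\tau_{2n}^+)$ makes attempts at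 $\tau_{2n+1},\tau_{2n+2}$; otherwise it makes attempts at $\tau_{2n}+\zeta_n,\tau_{2n+1},\tau_{2n+2}$ if $\zeta_n\le\xi_{2n+1}$, and only at $\tau_{2n+2}$ if $\zeta_n>\xi_{2n+1}$. In an attempt at time $t$, $Z$ uses the data $(\beta_m,u_{m+1})$ if $t=\tau_m$ for some $m$ and its velocity at $t^-$ is $U(t^-)$, and fresh independent data otherwise; $\mathscr X$ uses $(\beta_m,u_{m+1})$ if $t=\tau_m$ and its velocity at $t^-$ is $U(t^-)$, otherwise the data of $Z$ if $Z$ makes at time $t$ an attempt with fresh data and both velocities at $t^-$ agree, and fresh independent data otherwise. *Leg.* Let $\tilde\tau_j$ be the attempt times of $Z$, $\tilde\xi_j=\tilde\tau_j-\tilde\tau_{j-1}$ ($\tilde\tau_0=0$), and let $\tilde w_{j+1}$ be the velocity attempted at $\tilde\tau_j$. Condition on $\tilde\xi_1,\tilde\xi_2>1$, and let $\gamma=\min\{i>1:\tilde\xi_{i-1},\tilde\xi_i,\tilde\xi_{i+1},\tilde\xi_{i+2}>1,\ \tilde w_{i+1}=w\}$ and $\theta=\tilde\tau_\gamma$. **Proposition.**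 For every $\mathbf p$ there is a constant $C<\infty$ such that for all $r>0$, $w\in\Omega$, $u\in\Omega_w$ and $\beta_0\in-B(u,w)$, $$\mathbf P\big(\mathscr X(t)\not\equiv Z(t):\ 0^-<t<\theta^+\ \big|\ \tilde\xi_1,\tilde\xi_2>1\big)\le C r^2 ,$$ where the event is the complement of: $\gamma<\infty$ and $\mathscr X(t)=Z(t)$ for all $t\in[0,\theta+\delta)$ for some $\delta>0$. -/

import Mathlib

open MeasureTheory ProbabilityTheory
open scoped Pointwise

namespace WindTree

/-! ### Velocities and obstacles -/

/-- Physical space. -/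
abbrev Space := EuclideanSpace ℝ (Fin 3)

/-- A probability vector on three points with positive entries. -/
structure ProbVector where
  /-- The entries. -/
  val : Fin 3 → ℝ
  pos : ∀ i, 0 < val i
  sum_eq_one : ∑ i, val i = 1

/-- The Euclidean length of the probability vector. -/
noncomputable def ProbVector.length (p : ProbVector) : ℝ := √(∑ i, p.val i ^ 2)

/-- The eight admissible velocities. -/
def velocities (p : ProbVector) : Set Space :=
  {v | ‖v‖ = 1 ∧ ∀ i, |v i| = p.val i / p.length}

/-- Change of sign of the `i`-th coordinate. -/
def signFlip (i : Fin 3) (v : Space) : Space :=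
  WithLp.toLp 2 fun j => if j = i then -v j else v j

/-- The velocities accessible from `v` in one collision. -/
def accessible (p : ProbVector) (v : Space) : Set Space :=
  {w | w ∈ velocities p ∧ ∃ i, w = signFlip i v}

/-- Two velocities are in the same parity class when they agree or differ by exactly two sign
changes. -/
def SameParity (u v : Space) : Prop :=
  v = u ∨ ∃ i j, i ≠ j ∧ v = signFlip i (signFlip j u)

/-- The closed axis-parallel cube of side `r` centred at the origin. -/
def cube (r : ℝ) : Set Space := {b | ∀ i, |b i| ≤ r / 2}

/-- The interior of that cube. -/
def openCube (r : ℝ) : Set Space := {b | ∀ i, |b i| < r / 2}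

/-- The face of the cube which a particle of velocity `v` has to hit in order to leave with the
velocity `w`. -/
def hitFace (r : ℝ) (v w : Space) : Set Space :=
  {b | b ∈ frontier (cube r) ∧ ∃ k, w = signFlip k v ∧ b k = -(v k / |v k|) * (r / 2)}

/-! ### Mechanical flight among finitely many cubes -/

/-- The times at which the straight line started at `x` with velocity `v` is inside one of the
cubes centred at the points of `S`. -/
def hits (r : ℝ) (S : Set Space) (x v : Space) : Set ℝ :=
  {t | 0 ≤ t ∧ ∃ c ∈ S, x + t • v - c ∈ openCube r}

/-- A particle at `x` with velocity `v` is about to enter the cube centred at `c`. -/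
def Enters (r : ℝ) (c x v : Space) : Prop :=
  ∃ δ > (0 : ℝ), ∀ s ∈ Set.Ioo 0 δ, x + s • v - c ∈ openCube r

open Classical in
/-- Elastic reflection at the cubes centred at the points of `S`: the sign of the `i`-th
coordinate of the velocity changes if `x` is on a face orthogonal to the `i`-th axis of a cube
which the particle is about to enter. -/
noncomputable def reflect (r : ℝ) (S : Set Space) (x v : Space) : Space :=
  WithLp.toLp 2 fun i => if ∃ c ∈ S, Enters r c x v ∧ |x i - c i| = r / 2 then -v i else v i

open Classical in
/-- Position and velocity after time `t` of a particle with initial position and velocity `q`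
which is reflected at the cubes centred at `S`, at most `n` reflections being carried out.
A reflection at the final time itself is not carried out, so that the velocity is the left
limit. -/
noncomputable def flightN (r : ℝ) (S : Set Space) : ℕ → Space × Space → ℝ → Space × Space
  | 0, q, t => (q.1 + t • q.2, q.2)
  | n + 1, q, t =>
    if (hits r S q.1 q.2).Nonempty ∧ sInf (hits r S q.1 q.2) < t then
      let τ := sInf (hits r S q.1 q.2)
      let y := q.1 + τ • q.2
      flightN r S n (y, reflect r S y q.2) (t - τ)
    else (q.1 + t • q.2, q.2)

/-- Position and velocity (left limit) at time `t` of the mechanical flight: all reflections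
before time `t` are carried out. -/
noncomputable def flight (r : ℝ) (S : Set Space) (q : Space × Space) (t : ℝ) : Space × Space :=
  flightN r S (sInf {N | ∀ n, N ≤ n → flightN r S n q t = flightN r S N q t}) q t

/-- The points visited during the time interval `(0, T]` of a mechanical flight. -/
def trace (r : ℝ) (S : Set Space) (q : Space × Space) (T : ℝ) : Set Space :=
  {y | ∃ s ∈ Set.Ioc 0 T, y = (flight r S q s).1}

/-! ### The randomness -/

/-- The data of a collision: the coordinate which changes its sign, and the relative position of
the point of impact on the face that is hit (the coordinate orthogonal to the face is unused). -/
abbrev Mark := Fin 3 × (Fin 3 → ℝ)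

/-- The new velocity of a particle of velocity `v` which collides with data `m`. -/
def newVelocity (m : Mark) (v : Space) : Space := signFlip m.1 v

/-- The position of the centre of the obstacle relative to a particle of velocity `v` which
collides with data `m`. For `m.2` uniform on `[-1/2, 1/2]³` this is uniform on the face
`-hitFace r v (newVelocity m v)`. -/
noncomputable def impact (r : ℝ) (m : Mark) (v : Space) : Space :=
  WithLp.toLp 2 fun j => if j = m.1 then v j / |v j| * (r / 2) else r * m.2 j

/-- The law of the coordinate that is flipped. -/
noncomputable def flipLaw (p : ProbVector) : Measure (Fin 3) :=
  ∑ i, ENNReal.ofReal (p.val i) • Measure.dirac i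

instance (p : ProbVector) : IsProbabilityMeasure (flipLaw p) := by
  constructor
  simp only [flipLaw, Measure.coe_finsetSum, Finset.sum_apply, Measure.smul_apply, smul_eq_mul,
    measure_univ, mul_one]
  rw [← ENNReal.ofReal_sum_of_nonneg fun i _ => (p.pos i).le, p.sum_eq_one, ENNReal.ofReal_one]

/-- The uniform law on `[-1/2, 1/2]³`. -/
noncomputable def cubeLaw : Measure (Fin 3 → ℝ) :=
  volume.restrict (Set.Icc (fun _ => -(1 / 2)) fun _ => 1 / 2)

instance : IsProbabilityMeasure cubeLaw := by
  constructor
  rw [cubeLaw, Measure.restrict_apply_univ, Real.volume_Icc_pi]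
  norm_num

/-- The law of the data of a collision. -/
noncomputable def markLaw (p : ProbVector) : Measure Mark := (flipLaw p).prod cubeLaw

instance (p : ProbVector) : IsProbabilityMeasure (markLaw p) := by
  unfold markLaw; infer_instance

instance : IsProbabilityMeasure (expMeasure 1) := isProbabilityMeasure_expMeasure one_pos

/-- The randomness used on the time interval `[τ_{2n}, τ_{2n+2})`: three clocks, and the marks
of the Markovian, of the forgetful and of the wind-tree process at the (at most three) times at
which something can happen. -/
abbrev Noise := (Fin 3 → ℝ) × (Fin 3 → Mark) × (Fin 3 → Mark) × (Fin 3 → Mark)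

/-- The clocks: `0` is the auxiliary time `ζ_n`, and `1`, `2` are the flight times `ξ_{2n+1}`,
`ξ_{2n+2}` of the Markovian process. -/
def Noise.clock (ω : Noise) : Fin 3 → ℝ := ω.1

/-- The marks of the Markovian process, at `τ_{2n+1}` (slot `1`) and `τ_{2n+2}` (slot `2`). -/
def Noise.markY (ω : Noise) : Fin 3 → Mark := ω.2.1

/-- The own marks of the forgetful process, at `τ_{2n} + ζ_n` (slot `0`), `τ_{2n+1}` (slot `1`)
and `τ_{2n+2}` (slot `2`). -/
def Noise.markZ (ω : Noise) : Fin 3 → Mark := ω.2.2.1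

/-- The own marks of the wind-tree process in the same slots. -/
def Noise.markX (ω : Noise) : Fin 3 → Mark := ω.2.2.2

/-- The law of the randomness of one block: independent standard exponential clocks and
independent marks. -/
noncomputable def blockLaw (p : ProbVector) : Measure Noise :=
  (Measure.pi fun _ => expMeasure 1).prod
    ((Measure.pi fun _ => markLaw p).prod
      ((Measure.pi fun _ => markLaw p).prod (Measure.pi fun _ => markLaw p)))

instance (p : ProbVector) : IsProbabilityMeasure (blockLaw p) := by
  unfold blockLaw; infer_instance

/-- The law of the whole randomness: independent blocks. -/
noncomputable def noiseLaw (p : ProbVector) : Measure (ℕ → Noise) :=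
  Measure.infinitePi fun _ => blockLaw p

instance (p : ProbVector) : IsProbabilityMeasure (noiseLaw p) := by
  unfold noiseLaw; infer_instance

/-! ### The two exploration processes -/

/-- The piece of a trajectory between two successive attempted fresh collisions. -/
structure Stretch where
  /-- The centres of the obstacles which are taken into account. -/
  obstacles : Set Space
  /-- The initial position and velocity. -/
  start : Space × Space
  /-- The time until the next attempt. -/
  duration : ℝ
  /-- The velocity proposed in the attempt at the end. -/
  attempted : Space

/-- The state of the forgetful process just after an attempted fresh collision. -/
structure ZState where
  /-- Position and velocity. -/
  phase : Space × Space
  /-- The centre of the obstacle of the last attempt; `none` is the point at infinity. -/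
  last : Option Space
  /-- The centre of the obstacle of the last but one attempt. -/
  prior : Option Space
  /-- The points visited between the last two attempts. -/
  lastTrace : Set Space
  /-- The past. -/
  history : List Stretch

/-- The state of the wind-tree exploration process just after an attempted fresh collision. -/
structure XState where
  /-- Position and velocity. -/
  phase : Space × Space
  /-- The centres of all obstacles placed so far. -/
  scatterers : Set Space
  /-- All points visited so far. -/
  visited : Set Space
  /-- The past. -/
  history : List Stretch

/-- The obstacles which the forgetful process remembers. -/
def ZState.obstacles (z : ZState) : Set Space := {c | z.last = some c ∨ z.prior = some c}

/-- Position and velocity of the forgetful process just before an attempt after time `T`. -/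
noncomputable def ZState.before (r : ℝ) (z : ZState) (T : ℝ) : Space × Space :=
  flight r z.obstacles z.phase T

/-- Position and velocity of the wind-tree process just before an attempt after time `T`. -/
noncomputable def XState.before (r : ℝ) (x : XState) (T : ℝ) : Space × Space :=
  flight r x.scatterers x.phase T

open Classical in
/-- The forgetful process flies for a time `T` among the last two obstacles and then attempts a
fresh collision with data `m`. The attempt fails if the new obstacle would have shadowed the
trajectory between the last two attempts. -/
noncomputable def ZState.attempt (r : ℝ) (z : ZState) (T : ℝ) (m : Mark) : ZState :=
  let q := z.before r T
  let c := q.1 + impact r m q.2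
  let w := newVelocity m q.2
  let shadowed := ∃ y ∈ z.lastTrace, y - c ∈ cube r
  { phase := (q.1, if shadowed then q.2 else w)
    last := if shadowed then none else some c
    prior := z.last
    lastTrace := trace r z.obstacles z.phase T
    history := z.history ++ [⟨z.obstacles, z.phase, T, w⟩] }

open Classical in
/-- The wind-tree process flies for a time `T` among all obstacles placed so far and then attempts
a fresh collision with data `m`. The attempt fails if the new obstacle would have shadowed the
trajectory before the last attempt. -/
noncomputable def XState.attempt (r : ℝ) (x : XState) (T : ℝ) (m : Mark) : XState :=
  let q := x.before r T
  let c := q.1 + impact r m q.2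
  let w := newVelocity m q.2
  let shadowed := ∃ y ∈ x.visited, y - c ∈ cube r
  { phase := (q.1, if shadowed then q.2 else w)
    scatterers := if shadowed then x.scatterers else insert c x.scatterers
    visited := x.visited ∪ trace r x.scatterers x.phase T
    history := x.history ++ [⟨x.scatterers, x.phase, T, w⟩] }

/-! ### The joint construction -/

open Classical in
/-- The attempts of a process on `[τ_{2n}, τ_{2n+2})`, as a list of slots together with the
times elapsed since the previous attempt. The first argument tells whether the velocity of the
process at `τ_{2n}⁺` has the parity of the velocity of the Markovian process. -/
noncomputable def schedule (aligned : Prop) (ω : Noise) : List (Fin 3 × ℝ) :=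
  if aligned then [(1, ω.clock 1), (2, ω.clock 2)]
  else if ω.clock 0 ≤ ω.clock 1 then
    [(0, ω.clock 0), (1, ω.clock 1 - ω.clock 0), (2, ω.clock 2)]
  else [(2, ω.clock 1 + ω.clock 2)]

/-- The velocity of the Markovian process just before the time of a slot, when `u` is its
velocity at `τ_{2n}⁺`. -/
def velocityY (u : Space) (ω : Noise) (slot : Fin 3) : Space :=
  if slot = 2 then newVelocity (ω.markY 1) u else u

open Classical in
/-- One attempt of the forgetful process: it uses the data of the Markovian process if the latter
has a collision at the same time and the velocities agree, and its own data otherwise. The second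
component records, for each slot with an attempt independent of the Markovian process, the
velocity just before. -/
noncomputable def stepZ (r : ℝ) (u : Space) (ω : Noise) (s : ZState × (Fin 3 → Option Space))
    (a : Fin 3 × ℝ) : ZState × (Fin 3 → Option Space) :=
  let W := (s.1.before r a.2).2
  if a.1 ≠ 0 ∧ W = velocityY u ω a.1 then (s.1.attempt r a.2 (ω.markY a.1), s.2)
  else (s.1.attempt r a.2 (ω.markZ a.1), Function.update s.2 a.1 (some W))

open Classical in
/-- One attempt of the wind-tree process: it uses the data of the Markovian process if the latter
has a collision at the same time and the velocities agree, otherwise the data of the forgetful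
process if the latter makes an attempt independent of the Markovian process at the same time and
the velocities agree, and its own data otherwise. -/
noncomputable def stepX (r : ℝ) (u : Space) (ω : Noise) (indep : Fin 3 → Option Space)
    (x : XState) (a : Fin 3 × ℝ) : XState :=
  let V := (x.before r a.2).2
  if a.1 ≠ 0 ∧ V = velocityY u ω a.1 then x.attempt r a.2 (ω.markY a.1)
  else if indep a.1 = some V then x.attempt r a.2 (ω.markZ a.1)
  else x.attempt r a.2 (ω.markX a.1)

/-- The joint state at a time `τ_{2n}⁺`. Only the velocity of the Markovian process matters for
the coupling. -/
structure State where
  /-- The velocity of the Markovian process. -/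
  velY : Space
  /-- The forgetful process. -/
  Z : ZState
  /-- The wind-tree process. -/
  X : XState

/-- The construction on `[τ_{2n}, τ_{2n+2})`. -/
noncomputable def State.next (r : ℝ) (s : State) (ω : Noise) : State :=
  let z := (schedule (SameParity s.velY s.Z.phase.2) ω).foldl (stepZ r s.velY ω)
    (s.Z, fun _ => none)
  let x := (schedule (SameParity s.velY s.X.phase.2) ω).foldl (stepX r s.velY ω z.2) s.X
  { velY := newVelocity (ω.markY 2) (newVelocity (ω.markY 1) s.velY)
    Z := z.1
    X := x }

/-- The joint state at time `0⁺`: all processes start at the origin with velocity `w`, after a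
collision with an obstacle centred at `β₀`. -/
def initialState (w β₀ : Space) : State where
  velY := w
  Z := ⟨(0, w), some β₀, none, ∅, []⟩
  X := ⟨(0, w), {β₀}, ∅, []⟩

/-- The joint state at the times `τ_{2n}⁺`. -/
noncomputable def stateSeq (r : ℝ) (w β₀ : Space) (ω : ℕ → Noise) : ℕ → State
  | 0 => initialState w β₀
  | n + 1 => (stateSeq r w β₀ ω n).next r (ω n)

/-- The `n`-th stretch (`n = 0, 1, …`) of the forgetful process. Each block contains at least one
attempt, so that it is available after `n + 1` blocks. -/
noncomputable def stretchZ (r : ℝ) (w β₀ : Space) (ω : ℕ → Noise) (n : ℕ) : Stretch :=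
  (stateSeq r w β₀ ω (n + 1)).Z.history.getD n ⟨∅, (0, 0), 0, 0⟩

/-- The `n`-th stretch (`n = 0, 1, …`) of the wind-tree process. -/
noncomputable def stretchX (r : ℝ) (w β₀ : Space) (ω : ℕ → Noise) (n : ℕ) : Stretch :=
  (stateSeq r w β₀ ω (n + 1)).X.history.getD n ⟨∅, (0, 0), 0, 0⟩

/-- The time of the `n`-th attempted fresh collision (`n = 1, 2, …`); it is `0` for `n = 0`. -/
def attemptTime (s : ℕ → Stretch) (n : ℕ) : ℝ := ∑ i ∈ Finset.range n, (s i).duration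

/-- The time between the attempts number `n - 1` and `n` (`n = 1, 2, …`). -/
def gap (s : ℕ → Stretch) (n : ℕ) : ℝ := attemptTime s n - attemptTime s (n - 1)

/-- The velocity proposed in the attempt number `n` (`n = 1, 2, …`). -/
def attemptedVelocity (s : ℕ → Stretch) (n : ℕ) : Space := (s (n - 1)).attempted

/-- The position at time `t ≥ 0` of the trajectory made of the given stretches. -/
noncomputable def path (r : ℝ) (s : ℕ → Stretch) (t : ℝ) : Space :=
  let n := sSup {n | attemptTime s n ≤ t}
  (flight r (s n).obstacles (s n).start (t - attemptTime s n)).1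

/-! ### Legs -/

/-- A leg of a trajectory with initial velocity `w` can end with the attempt number `i`: the two
flights before it and the two flights after it are longer than `1`, and the proposed velocity is
again `w`. -/
def CanEnd (w : Space) (s : ℕ → Stretch) (i : ℕ) : Prop :=
  1 < i ∧ 1 < gap s (i - 1) ∧ 1 < gap s i ∧ 1 < gap s (i + 1) ∧ 1 < gap s (i + 2) ∧
    attemptedVelocity s i = w

/-- The event that the first two flights of the forgetful process are longer than `1`, as is
required at the beginning of a leg. -/
def longStart (r : ℝ) (w β₀ : Space) : Set (ℕ → Noise) :=
  {ω | 1 < gap (stretchZ r w β₀ ω) 1 ∧ 1 < gap (stretchZ r w β₀ ω) 2}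

/-- The event that the leg of the forgetful process ends (with the attempt number `γ`, at time
`θ`), and that the wind-tree process coincides with the forgetful process on `[0, θ⁺)`, that is,
up to and immediately after the end of the leg. -/
def agreement (r : ℝ) (w β₀ : Space) : Set (ℕ → Noise) :=
  {ω | ∃ γ, IsLeast {i | CanEnd w (stretchZ r w β₀ ω) i} γ ∧
    ∃ δ > (0 : ℝ), ∀ t ∈ Set.Ico 0 (attemptTime (stretchZ r w β₀ ω) γ + δ),
      path r (stretchX r w β₀ ω) t = path r (stretchZ r w β₀ ω) t}

end WindTree

/-!
The conditional probability is at most the probability that the processes disagree during the leg,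
divided by the probability of the condition. The latter is bounded below uniformly in `r`, `w` and
`β₀`, because all processes agree at time `0` and the first two attempts of the forgetful process
are the first two jumps of the Markovian process (`longClocks_subset_longStart`). It remains to show
that disagreement has a probability of order `r ^ 2`.

**Reduction to independent gaps and marks.** A flight of the forgetful process that is long compared
to `r` leads to a state in which the next flight is free and the next attempt succeeds. After
a single short gap an attempt may fail, or the particle may bounce for a time of order `r` between
two opposite faces; afterwards everything is regular again (`exists_velocities`). Hence, before the
second short gap, the velocities are those of an autonomous process `velMachine k a b`, where `k` is
the index of the short gap and the bits `a`, `b` describe its outcome. With the same velocities such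
a process makes the same attempts with the same data (`Machine.stream_congr`), and for an autonomous
process the gaps and marks are exactly independent, the gaps being standard exponential
(`Machine.Autonomous.measurePreserving_stream`). This is where the form of the coupling matters: by
the lack of memory of the exponential law, both schedules of attempts produce independent gaps
(`lintegral_expLaw_interlaced`).

**Mismatches are returns.** The two processes agree as long as the forgetful process neither runs
into an obstacle that it has forgotten nor places an obstacle on a part of the trajectory that it
has forgotten (`NoMismatch`, `xRun_eq`). Otherwise the displacement during at least three successive
flights, the first or the last of them taken in part, is of order `r`
(`exists_return_of_mismatch`). The unknown part of the incomplete flight is eliminated by taking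
differences of coordinates, measured in units of the velocity of that flight (`discrepancy`). As one
sign changes at each attempt, there are two such differences, linear in the gaps and independent in
a triangular way (`exists_two_differences`); if one of the gaps is short, one difference remains
which involves another gap (`exists_difference`). So a mismatch, or a second short gap, implies two
approximate equations. Resampling one gap at a time shows that each of them contributes a factor of
order `r` (`gapsLaw_le_mul`).

**Summation.** With a probability bounded below, eleven successive gaps are long and the flips at
the ends of them follow a Hamiltonian cycle of the cube of velocities; then every velocity, `w` in
particular, is attempted between long flights, and the leg ends at the latest then
(`mem_agreement_of_goodWindow`). Windows that contain none of the at most two resampled gaps are not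
affected by the resampling, so that a first mismatch or second short gap at the attempt `N` carries
another factor, exponentially small in `N` (`exists_noGoodWindow_le`). It compensates for the
polynomial number of configurations (`exists_measure_compl_agreement_le`).
-/

namespace WindTree

/-! ### Mechanical flights with finitely many bounces -/

variable {r : ℝ} {S S' : Set Space}

theorem signFlip_apply (i j : Fin 3) (v : Space) :
    signFlip i v j = if j = i then -v j else v j := rfl

theorem abs_signFlip_apply (i j : Fin 3) (v : Space) : |signFlip i v j| = |v j| := by
  rw [signFlip_apply]; split_ifs <;> simp

theorem signFlip_signFlip (i : Fin 3) (v : Space) : signFlip i (signFlip i v) = v := by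
  ext j
  simp only [signFlip_apply]
  split_ifs <;> simp

theorem openCube_subset_cube : openCube r ⊆ cube r := fun _ h i => (h i).le

theorem isOpen_openCube : IsOpen (openCube r) := by
  have : openCube r = ⋂ i, {b : Space | |b i| < r / 2} := by
    ext; simp [openCube]
  rw [this]
  exact isOpen_iInter_of_finite fun i => isOpen_lt (by fun_prop) continuous_const

theorem isClosed_cube : IsClosed (cube r) := by
  have : cube r = ⋂ i, {b : Space | |b i| ≤ r / 2} := by
    ext; simp [cube]
  rw [this]
  exact isClosed_iInter fun i => isClosed_le (by fun_prop) continuous_const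

/-- The particle undergoes only finitely many reflections in its whole future, each of them after
a positive time. -/
inductive Tame (r : ℝ) (S : Set Space) : Space × Space → Prop
  | free {q : Space × Space} (h : hits r S q.1 q.2 = ∅) : Tame r S q
  | bounce {q : Space × Space} (τ : ℝ) (hτ : 0 < τ) (hne : (hits r S q.1 q.2).Nonempty)
      (hinf : sInf (hits r S q.1 q.2) = τ)
      (h : Tame r S (q.1 + τ • q.2, reflect r S (q.1 + τ • q.2) q.2)) : Tame r S q

theorem flight_eq_of_forall_ge {q : Space × Space} {t : ℝ} {y : Space × Space} {M : ℕ}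
    (h : ∀ n, M ≤ n → flightN r S n q t = y) : flight r S q t = y := by
  have hM : M ∈ {N | ∀ n, N ≤ n → flightN r S n q t = flightN r S N q t} := fun n hn => by
    rw [h n hn, h M le_rfl]
  have := Nat.sInf_mem ⟨M, hM⟩
  unfold flight
  rw [← this M (Nat.sInf_le hM), h M le_rfl]

theorem flightN_of_not_hits {q : Space × Space} {t : ℝ}
    (h : ∀ s ∈ hits r S q.1 q.2, t ≤ s) (n : ℕ) :
    flightN r S n q t = (q.1 + t • q.2, q.2) := by
  cases n with
  | zero => rfl
  | succ n =>
    rw [flightN, if_neg]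
    rintro ⟨hne, hlt⟩
    obtain ⟨s, hs, hst⟩ := exists_lt_of_csInf_lt hne hlt
    exact absurd (h s hs) (not_le.2 hst)

theorem flight_of_not_hits {q : Space × Space} {t : ℝ}
    (h : ∀ s ∈ hits r S q.1 q.2, t ≤ s) :
    flight r S q t = (q.1 + t • q.2, q.2) :=
  flight_eq_of_forall_ge (M := 0) fun n _ => flightN_of_not_hits h n

theorem bddBelow_hits (x v : Space) : BddBelow (hits r S x v) := ⟨0, fun _ h => h.1⟩

theorem flightN_succ_of_lt {q : Space × Space} {t τ : ℝ}
    (hne : (hits r S q.1 q.2).Nonempty) (hinf : sInf (hits r S q.1 q.2) = τ) (ht : τ < t) (n : ℕ) :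
    flightN r S (n + 1) q t =
      flightN r S n (q.1 + τ • q.2, reflect r S (q.1 + τ • q.2) q.2) (t - τ) := by
  rw [flightN, if_pos ⟨hne, hinf ▸ ht⟩, hinf]

theorem Tame.exists_flightN_eq {q : Space × Space} (h : Tame r S q) :
    ∃ M, ∀ n, M ≤ n → ∀ t, flightN r S n q t = flight r S q t := by
  induction h with
  | free h =>
    refine ⟨0, fun n _ t => ?_⟩
    rw [flightN_of_not_hits (by simp [h]), flight_of_not_hits (by simp [h])]
  | @bounce q τ hτ hne hinf h ih =>
    obtain ⟨M, hM⟩ := ih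
    have key : ∀ t, ∃ y, ∀ n, M + 1 ≤ n → flightN r S n q t = y := by
      intro t
      rcases le_or_gt t τ with ht | ht
      · refine ⟨_, fun n _ => flightN_of_not_hits (fun s hs => ht.trans ?_) n⟩
        rw [← hinf]
        exact csInf_le (bddBelow_hits _ _) hs
      · refine ⟨flight r S (q.1 + τ • q.2, reflect r S (q.1 + τ • q.2) q.2) (t - τ),
          fun n hn => ?_⟩
        obtain ⟨n, rfl⟩ : ∃ k, n = k + 1 := ⟨n - 1, by omega⟩
        rw [flightN_succ_of_lt hne hinf ht, hM n (by omega)]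
    refine ⟨M + 1, fun n hn t => ?_⟩
    obtain ⟨y, hy⟩ := key t
    rw [hy n hn, flight_eq_of_forall_ge hy]

theorem flight_of_bounce {q : Space × Space} {t τ : ℝ}
    (hne : (hits r S q.1 q.2).Nonempty) (hinf : sInf (hits r S q.1 q.2) = τ)
    (h : Tame r S (q.1 + τ • q.2, reflect r S (q.1 + τ • q.2) q.2)) (ht : τ < t) :
    flight r S q t = flight r S (q.1 + τ • q.2, reflect r S (q.1 + τ • q.2) q.2) (t - τ) := by
  obtain ⟨M, hM⟩ := h.exists_flightN_eq
  refine flight_eq_of_forall_ge (M := M + 1) fun n hn => ?_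
  obtain ⟨n, rfl⟩ : ∃ k, n = k + 1 := ⟨n - 1, by omega⟩
  rw [flightN_succ_of_lt hne hinf ht, hM n (by omega)]

theorem Enters.mem_cube {c x v : Space} (h : Enters r c x v) : x - c ∈ cube r := by
  obtain ⟨δ, hδ, h⟩ := h
  have hc : Filter.Tendsto (fun s : ℝ => x + s • v - c) (nhdsWithin 0 (Set.Ioi 0))
      (nhds (x - c)) := by
    have : Continuous fun s : ℝ => x + s • v - c := by fun_prop
    simpa using (this.tendsto 0).mono_left nhdsWithin_le_nhds
  refine isClosed_cube.mem_of_tendsto hc ?_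
  filter_upwards [Ioo_mem_nhdsGT hδ] with s hs
  exact openCube_subset_cube (h s hs)

/-- If a particle is inside a cube at the time `t`, it is so during a time interval after `t`. -/
theorem exists_Ioo_of_mem_openCube {c x v : Space} {t T : ℝ} (ht : t < T)
    (h : x + t • v - c ∈ openCube r) : ∃ s ∈ Set.Ioo t T, x + s • v - c ∈ openCube r := by
  have hc : Continuous fun s : ℝ => x + s • v - c := by fun_prop
  have h1 : ∀ᶠ s in nhdsWithin t (Set.Ioi t), x + s • v - c ∈ openCube r :=
    (hc.tendsto t).eventually (isOpen_openCube.mem_nhds h) |>.filter_mono nhdsWithin_le_nhds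
  obtain ⟨s, hs, hs'⟩ := (h1.and (Ioo_mem_nhdsGT ht)).exists
  exact ⟨s, hs', hs⟩

/-- Obstacles whose closed cubes are avoided by a tame flight up to time `T` can be added without
changing the flight up to that time. -/
theorem Tame.flightN_superset {q : Space × Space} (h : Tame r S q) (hS : S ⊆ S') {T : ℝ}
    (hT : ∀ s ∈ Set.Ioc 0 T, ∀ c ∈ S', c ∉ S → (flight r S q s).1 - c ∉ cube r) :
    ∀ s ≤ T, ∀ n, flightN r S' n q s = flightN r S n q s := by
  induction h generalizing T with
  | @free q h =>
    intro s hs n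
    have h0 : ∀ t ∈ hits r S q.1 q.2, s ≤ t := by simp [h]
    rw [flightN_of_not_hits h0]
    refine flightN_of_not_hits (fun t ht => ?_) n
    by_contra! hts
    obtain ⟨ht0, c, hc, htc⟩ := ht
    obtain ⟨t', ht', htc'⟩ := exists_Ioo_of_mem_openCube hts htc
    by_cases hcS : c ∈ S
    · have : t ∈ hits r S q.1 q.2 := ⟨ht0, c, hcS, htc⟩
      simp [h] at this
    · refine hT t' ⟨ht0.trans_lt ht'.1, ht'.2.le.trans hs⟩ c hc hcS ?_
      rw [flight_of_not_hits (by simp [h])]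
      exact openCube_subset_cube htc'
  | @bounce q τ hτ hne hinf h ih =>
    have hle : ∀ t ∈ hits r S q.1 q.2, τ ≤ t := fun t ht => hinf ▸ csInf_le (bddBelow_hits _ _) ht
    have hle' : ∀ s ≤ T, s ≤ τ → ∀ t ∈ hits r S' q.1 q.2, s ≤ t := by
      intro s hs hsτ t ht
      by_contra! hts
      obtain ⟨ht0, c, hc, htc⟩ := ht
      obtain ⟨t', ht', htc'⟩ := exists_Ioo_of_mem_openCube hts htc
      by_cases hcS : c ∈ S
      · have : τ ≤ t := hle t ⟨ht0, c, hcS, htc⟩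
        linarith
      · refine hT t' ⟨ht0.trans_lt ht'.1, ht'.2.le.trans hs⟩ c hc hcS ?_
        rw [flight_of_not_hits fun u hu => (ht'.2.le.trans hsτ).trans (hle u hu)]
        exact openCube_subset_cube htc'
    intro s hs n
    rcases le_or_gt s τ with hsτ | hsτ
    · rw [flightN_of_not_hits (hle' s hs hsτ), flightN_of_not_hits fun t ht => hsτ.trans (hle t ht)]
    · have hsub : hits r S q.1 q.2 ⊆ hits r S' q.1 q.2 := fun t ⟨h0, c, hc, h⟩ => ⟨h0, c, hS hc, h⟩
      have hne' := hne.mono hsub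
      have hinf' : sInf (hits r S' q.1 q.2) = τ := by
        refine le_antisymm ?_ (le_csInf hne' (hle' τ (hsτ.le.trans hs) le_rfl))
        rw [← hinf]
        exact csInf_le_csInf (bddBelow_hits _ _) hne hsub
      have hrefl : reflect r S' (q.1 + τ • q.2) q.2 = reflect r S (q.1 + τ • q.2) q.2 := by
        unfold reflect
        congr 1
        funext i
        congr 1
        refine propext ⟨fun ⟨c, hc, hE, hi⟩ => ⟨c, ?_, hE, hi⟩, fun ⟨c, hc, hE, hi⟩ =>
          ⟨c, hS hc, hE, hi⟩⟩
        by_contra hcS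
        refine hT τ ⟨hτ, hsτ.le.trans hs⟩ c hc hcS ?_
        rw [flight_of_not_hits hle]
        exact hE.mem_cube
      cases n with
      | zero => rfl
      | succ n =>
        rw [flightN_succ_of_lt hne' hinf' hsτ, flightN_succ_of_lt hne hinf hsτ, hrefl]
        refine ih (T := T - τ) (fun u hu c hc hcS => ?_) _ (by linarith) n
        have := hT (u + τ) ⟨by linarith [hu.1], by linarith [hu.2]⟩ c hc hcS
        rwa [flight_of_bounce hne hinf h (by linarith [hu.1]), add_sub_cancel_right] at this

theorem Tame.flight_superset {q : Space × Space} (h : Tame r S q) (hS : S ⊆ S') {T : ℝ}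
    (hT : ∀ s ∈ Set.Ioc 0 T, ∀ c ∈ S', c ∉ S → (flight r S q s).1 - c ∉ cube r)
    {s : ℝ} (hs : s ≤ T) : flight r S' q s = flight r S q s := by
  unfold flight
  simp only [h.flightN_superset hS hT s hs]

/-! ### Two opposite faces -/

/-- A particle which is beyond the cube in one coordinate, and does not move back in that
coordinate, never meets the cube. -/
theorem not_mem_openCube_of_behind {c x v : Space} {i : Fin 3} (hv : v i ≠ 0)
    (h : r / 2 * |v i| ≤ (x i - c i) * v i) {t : ℝ} (ht : 0 ≤ t) :
    x + t • v - c ∉ openCube r := by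
  intro hm
  have h1 := hm i
  simp only [PiLp.sub_apply, PiLp.add_apply, PiLp.smul_apply, smul_eq_mul] at h1
  have h2 : (x i + t * v i - c i) * v i ≤ |x i + t * v i - c i| * |v i| := by
    rw [← abs_mul]; exact le_abs_self _
  have h3 : |x i + t * v i - c i| * |v i| < r / 2 * |v i| :=
    mul_lt_mul_of_pos_right h1 (abs_pos.2 hv)
  nlinarith [mul_nonneg ht (sq_nonneg (v i))]

/-- The particle at `x` with velocity `v` has just left the face orthogonal to the `i`-th axis of
the cube at `c`, the opposite face of the cube at `c'` is ahead in that coordinate at the distance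
of a flight of time `τ`, and in the other coordinates the particle has entered the shadows of both
cubes. -/
structure Facing (r : ℝ) (i : Fin 3) (c c' x v : Space) (τ : ℝ) : Prop where
  behind : (x i - c i) * v i = r / 2 * |v i|
  ahead : (c' i - x i) * v i = r / 2 * |v i| + τ * v i ^ 2
  side : ∀ l ≠ i, -(r / 2 * |v l|) ≤ (x l - c l) * v l
  side' : ∀ l ≠ i, -(r / 2 * |v l|) ≤ (x l - c' l) * v l

theorem Facing.swap {i : Fin 3} {c c' x v : Space} {τ : ℝ} (hτ : 0 < τ)
    (h : Facing r i c c' x v τ) :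
    Facing r i c' c (x + τ • v) (signFlip i v) τ := by
  obtain ⟨h1, h2, h3, h4⟩ := h
  refine ⟨?_, ?_, fun l hl => ?_, fun l hl => ?_⟩
  · simp only [PiLp.add_apply, PiLp.smul_apply, smul_eq_mul, signFlip_apply, if_pos, abs_neg]
    linarith
  · simp only [PiLp.add_apply, PiLp.smul_apply, smul_eq_mul, signFlip_apply, if_pos, abs_neg]
    linarith
  · simp only [PiLp.add_apply, PiLp.smul_apply, smul_eq_mul, signFlip_apply, if_neg hl]
    nlinarith [h4 l hl, mul_nonneg hτ.le (sq_nonneg (v l))]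
  · simp only [PiLp.add_apply, PiLp.smul_apply, smul_eq_mul, signFlip_apply, if_neg hl]
    nlinarith [h3 l hl, mul_nonneg hτ.le (sq_nonneg (v l))]

theorem abs_lt_of_mul_lt {a v b : ℝ} (h1 : a * v < b * |v|) (h2 : -(b * |v|) < a * v) :
    |a| < b := by
  have : |a * v| < b * |v| := abs_lt.2 ⟨h2, h1⟩
  rw [abs_mul] at this
  exact lt_of_mul_lt_mul_right this (abs_nonneg v)

/-- Inside the cubes' common shadow the particle is reflected by the opposite face. -/
theorem Facing.hits_of_inside {i : Fin 3} {c c' x v : Space} {τ : ℝ} (hr : 0 < r) (hτ : 0 < τ)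
    (h : Facing r i c c' x v τ) (hv : ∀ l, v l ≠ 0) (hS : ∀ d, d ∈ S ↔ d = c ∨ d = c')
    (hin : ∀ l ≠ i, (x l + τ * v l - c' l) * v l < r / 2 * |v l|) :
    (hits r S x v).Nonempty ∧ sInf (hits r S x v) = τ ∧
      reflect r S (x + τ • v) v = signFlip i v := by
  have hlow : ∀ t ∈ hits r S x v, τ ≤ t := by
    rintro t ⟨ht0, d, hd, htd⟩
    rcases (hS d).1 hd with rfl | rfl
    · exact absurd htd (not_mem_openCube_of_behind (hv i) h.behind.ge ht0)
    · by_contra! hlt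
      have h1 := htd i
      simp only [PiLp.sub_apply, PiLp.add_apply, PiLp.smul_apply, smul_eq_mul] at h1
      have h2 : -((x i + t * v i - d i) * v i) ≤ |x i + t * v i - d i| * |v i| := by
        rw [← abs_mul]; exact neg_le_abs _
      have h3 : |x i + t * v i - d i| * |v i| < r / 2 * |v i| :=
        mul_lt_mul_of_pos_right h1 (abs_pos.2 (hv i))
      have h4 := h.ahead
      have h5 : 0 < (τ - t) * v i ^ 2 := mul_pos (by linarith) (by positivity [hv i])
      nlinarith
  have hent : Enters r c' (x + τ • v) v := by
    have key : ∀ l, ∃ δ > (0 : ℝ), ∀ s ∈ Set.Ioo 0 δ, |x l + τ * v l + s * v l - c' l| < r / 2 := by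
      intro l
      have hvl : 0 < v l ^ 2 := by positivity [hv l]
      have hva : 0 < |v l| := abs_pos.2 (hv l)
      by_cases hl : l = i
      · subst hl
        refine ⟨r / |v l|, by positivity, fun s hs => abs_lt_of_mul_lt (v := v l) ?_ ?_⟩
        · have : s * |v l| < r := by
            have := hs.2
            rwa [lt_div_iff₀ hva] at this
          have h5 : v l ^ 2 = |v l| * |v l| := by rw [← sq, sq_abs]
          nlinarith [h.ahead]
        · nlinarith [h.ahead, mul_pos hs.1 hvl]
      · refine ⟨(r / 2 * |v l| - (x l + τ * v l - c' l) * v l) / v l ^ 2,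
          div_pos (by linarith [hin l hl]) hvl, fun s hs => abs_lt_of_mul_lt (v := v l) ?_ ?_⟩
        · have := hs.2
          rw [lt_div_iff₀ hvl] at this
          nlinarith
        · nlinarith [h.side' l hl, mul_pos hs.1 hvl, mul_pos hτ hvl]
    choose δ hδ hδ' using key
    refine ⟨min (δ 0) (min (δ 1) (δ 2)), by simp [hδ], fun s hs l => ?_⟩
    simp only [PiLp.sub_apply, PiLp.add_apply, PiLp.smul_apply, smul_eq_mul]
    refine hδ' l s ⟨hs.1, hs.2.trans_le ?_⟩
    fin_cases l <;> simp
  have hmem : ∃ δ > (0 : ℝ), ∀ s ∈ Set.Ioo 0 δ, τ + s ∈ hits r S x v := by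
    obtain ⟨δ, hδ, hE⟩ := hent
    refine ⟨δ, hδ, fun s hs => ⟨by linarith [hs.1], c', (hS c').2 (Or.inr rfl), ?_⟩⟩
    have := hE s hs
    rwa [add_assoc, ← add_smul] at this
  obtain ⟨δ, hδ, hmem⟩ := hmem
  have hne : (hits r S x v).Nonempty := ⟨_, hmem (δ / 2) ⟨by linarith, by linarith⟩⟩
  refine ⟨hne, le_antisymm ?_ (le_csInf hne hlow), ?_⟩
  · refine le_of_forall_pos_le_add fun ε hε => ?_
    refine (csInf_le (bddBelow_hits _ _) (hmem (min (δ / 2) ε) ⟨by positivity, ?_⟩)).trans ?_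
    · exact (min_le_left _ _).trans_lt (by linarith)
    · linarith [min_le_right (δ / 2) ε]
  · have hnc : ¬ Enters r c (x + τ • v) v := by
      rintro ⟨δ, hδ, hE⟩
      have := hE (δ / 2) ⟨by linarith, by linarith⟩
      rw [add_assoc, ← add_smul] at this
      exact not_mem_openCube_of_behind (hv i) h.behind.ge (by linarith) this
    ext l
    simp only [reflect, signFlip]
    congr 1
    refine propext ⟨fun ⟨d, hd, hE, hdl⟩ => ?_, fun hl => ⟨c', (hS c').2 (Or.inr rfl), hent, ?_⟩⟩
    · rcases (hS d).1 hd with rfl | rfl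
      · exact absurd hE hnc
      · by_contra hl
        have hvl : 0 < v l ^ 2 := by positivity [hv l]
        refine hdl.not_lt (abs_lt_of_mul_lt (v := v l) ?_ ?_)
        · simpa using hin l hl
        · simp only [PiLp.add_apply, PiLp.smul_apply, smul_eq_mul]
          nlinarith [h.side' l hl, mul_pos hτ hvl]
    · subst hl
      have h4 := h.ahead
      have : ((x + τ • v) l - c' l) * v l = -(r / 2 * |v l|) := by
        simp only [PiLp.add_apply, PiLp.smul_apply, smul_eq_mul]; nlinarith
      have h5 : |(x + τ • v) l - c' l| * |v l| = r / 2 * |v l| := by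
        rw [← abs_mul, this, abs_neg, abs_of_nonneg (by positivity)]
      exact mul_right_cancel₀ (abs_pos.2 (hv l)).ne' h5

/-- When the particle is beyond the cube ahead in another coordinate by the time `τ`, it flies past
the opposite face. -/
theorem Facing.hits_of_outside {i : Fin 3} {c c' x v : Space} {τ : ℝ}
    (h : Facing r i c c' x v τ) (hv : ∀ l, v l ≠ 0) (hS : ∀ d, d ∈ S ↔ d = c ∨ d = c')
    {l : Fin 3} (hout : r / 2 * |v l| ≤ (x l + τ * v l - c' l) * v l) :
    hits r S x v = ∅ := by
  refine Set.eq_empty_of_forall_notMem ?_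
  rintro t ⟨ht0, d, hd, htd⟩
  rcases (hS d).1 hd with rfl | rfl
  · exact not_mem_openCube_of_behind (hv i) h.behind.ge ht0 htd
  · rcases le_or_gt τ t with hle | hlt
    · have := not_mem_openCube_of_behind (x := x + τ • v) (c := d) (r := r) (hv l)
        (by simpa using hout) (sub_nonneg.2 hle)
      rw [add_assoc, ← add_smul, add_sub_cancel] at this
      exact this htd
    · have h1 := htd i
      simp only [PiLp.sub_apply, PiLp.add_apply, PiLp.smul_apply, smul_eq_mul] at h1
      have h2 : -((x i + t * v i - d i) * v i) ≤ |x i + t * v i - d i| * |v i| := by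
        rw [← abs_mul]; exact neg_le_abs _
      have h3 : |x i + t * v i - d i| * |v i| < r / 2 * |v i| :=
        mul_lt_mul_of_pos_right h1 (abs_pos.2 (hv i))
      have h4 := h.ahead
      have h5 : 0 < (τ - t) * v i ^ 2 := mul_pos (by linarith) (by positivity [hv i])
      nlinarith

/-- A particle between two opposite faces bounces to and fro in one coordinate and moves uniformly
in the others, until it has left the shadow of the cubes; from then on its velocity is constant. -/
theorem Facing.tame_and_flight {i : Fin 3} (hr : 0 < r) {τ : ℝ} (hτ : 0 < τ) (n : ℕ) :
    ∀ {c c' x v : Space} {s₀ : ℝ}, Facing r i c c' x v τ → (∀ l, v l ≠ 0) →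
    (∀ d, d ∈ S ↔ d = c ∨ d = c') → 0 ≤ s₀ → s₀ ≤ n * τ →
    (∀ l ≠ i, r / 2 * |v l| ≤ (x l - c l) * v l + s₀ * v l ^ 2 ∧
      r / 2 * |v l| ≤ (x l - c' l) * v l + s₀ * v l ^ 2) →
    Tame r S (x, v) ∧ ∃ W : Space, (W = v ∨ W = signFlip i v) ∧ ∀ s, 0 ≤ s →
      (∀ l ≠ i, (flight r S (x, v) s).1 l = x l + s * v l) ∧
      |(flight r S (x, v) s).1 i - x i - s * W i| ≤ 2 * s₀ * |v i| ∧
      (s₀ < s → (flight r S (x, v) s).2 = W) := by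
  induction n with
  | zero =>
    intro c c' x v s₀ h hv hS h0 hn hex
    obtain rfl : s₀ = 0 := le_antisymm (by simpa using hn) h0
    obtain ⟨l, hl⟩ : ∃ l, l ≠ i := exists_ne i
    have hemp : hits r S x v = ∅ := by
      refine h.hits_of_outside hv hS (l := l) ?_
      nlinarith [(hex l hl).2, mul_nonneg hτ.le (sq_nonneg (v l))]
    refine ⟨.free hemp, v, Or.inl rfl, fun s hs => ?_⟩
    rw [flight_of_not_hits (by simp [hemp])]
    simp
  | succ n ih =>
    intro c c' x v s₀ h hv hS h0 hn hex
    by_cases hin : ∀ l ≠ i, (x l + τ * v l - c' l) * v l < r / 2 * |v l|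
    · -- after the reflection the two cubes have exchanged their roles, and the time `s₀` needed to
      -- leave their shadow has decreased by `τ`
      obtain ⟨hne, hinf, hrefl⟩ := h.hits_of_inside hr hτ hv hS hin
      have hs0 : τ < s₀ := by
        by_contra! hle
        obtain ⟨l, hl⟩ : ∃ l, l ≠ i := exists_ne i
        nlinarith [(hex l hl).2, hin l hl, mul_nonneg (sub_nonneg.2 hle) (sq_nonneg (v l))]
      have hsw := h.swap hτ
      obtain ⟨hT, W, hW, hfl⟩ := ih (s₀ := s₀ - τ) hsw
        (fun l => by rw [← abs_pos, abs_signFlip_apply, abs_pos]; exact hv l)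
        (fun d => by rw [hS d, or_comm]) (by linarith)
        (by push_cast at hn; linarith) (fun l hl => by
          simp only [abs_signFlip_apply]
          simp only [PiLp.add_apply, PiLp.smul_apply, smul_eq_mul, signFlip_apply, if_neg hl]
          have := hex l hl
          constructor <;> linarith)
      have hT' : Tame r S ((x, v).1 + τ • (x, v).2,
          reflect r S ((x, v).1 + τ • (x, v).2) (x, v).2) := by
        simpa [hrefl] using hT
      refine ⟨.bounce τ hτ hne hinf hT', W, ?_, fun s hs => ?_⟩
      · rwa [signFlip_signFlip, or_comm] at hW
      have hle : ∀ t ∈ hits r S x v, τ ≤ t := fun t ht => hinf ▸ csInf_le (bddBelow_hits _ _) ht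
      have hWi : |v i - W i| ≤ 2 * |v i| := by
        rw [signFlip_signFlip] at hW
        rcases hW with rfl | rfl
        · simp only [signFlip_apply, if_pos, sub_neg_eq_add]
          rw [← two_mul, abs_mul, abs_two]
        · simp
      rcases le_or_gt s τ with hsτ | hsτ
      · rw [flight_of_not_hits (q := (x, v)) fun t ht => hsτ.trans (hle t ht)]
        refine ⟨fun l hl => by simp, ?_, fun h => by linarith⟩
        simp only [PiLp.add_apply, PiLp.smul_apply, smul_eq_mul]
        rw [show x i + s * v i - x i - s * W i = s * (v i - W i) by ring, abs_mul, abs_of_nonneg hs]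
        nlinarith [abs_nonneg (v i), abs_nonneg (v i - W i)]
      · rw [flight_of_bounce (q := (x, v)) hne hinf hT' hsτ]
        simp only [hrefl]
        obtain ⟨f1, f2, f3⟩ := hfl (s - τ) (by linarith)
        refine ⟨fun l hl => ?_, ?_, fun h => f3 (by linarith)⟩
        · rw [f1 l hl]
          simp only [PiLp.add_apply, PiLp.smul_apply, smul_eq_mul, signFlip_apply, if_neg hl]
          ring
        · rw [abs_signFlip_apply] at f2
          simp only [PiLp.add_apply, PiLp.smul_apply, smul_eq_mul] at f2
          set y := (flight r S (x + τ • v, signFlip i v) (s - τ)).1 i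
          rw [show y - x i - s * W i = (y - (x i + τ * v i) - (s - τ) * W i) + τ * (v i - W i) by
            ring]
          refine (abs_add_le _ _).trans ?_
          rw [abs_mul τ, abs_of_pos hτ]
          nlinarith
    · push Not at hin
      obtain ⟨l, hl, hout⟩ := hin
      have hemp : hits r S x v = ∅ := h.hits_of_outside hv hS hout
      refine ⟨.free hemp, v, Or.inl rfl, fun s hs => ?_⟩
      rw [flight_of_not_hits (by simp [hemp])]
      simp
      positivity

/-! ### The forgetful process with at most one short gap -/

/-- The states of the forgetful process driven by a sequence of gaps and marks. -/
noncomputable def zRun (r : ℝ) (z : ZState) (g : ℕ → ℝ × Mark) : ℕ → ZState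
  | 0 => z
  | n + 1 => (zRun r z g n).attempt r (g n).1 (g n).2

variable {r m : ℝ} {q : Fin 3 → ℝ}

/-- A state of the forgetful process from which the next flight is free: the particle is leaving
the last obstacle, is beyond the last but one in some coordinate, and the last stretch of its
trajectory is behind it in some coordinate. -/
structure ZState.Clear (r : ℝ) (q : Fin 3 → ℝ) (z : ZState) : Prop where
  speed : ∀ i, |z.phase.2 i| = q i
  contact : ∀ c, z.last = some c →
    ∃ i, (z.phase.1 i - c i) * z.phase.2 i = r / 2 * |z.phase.2 i|
  near : ∀ c, z.last = some c → ∀ l, |z.phase.1 l - c l| ≤ r / 2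
  beyond : ∀ c, z.prior = some c →
    ∃ i, r / 2 * |z.phase.2 i| ≤ (z.phase.1 i - c i) * z.phase.2 i
  trace : ∃ l, ∀ y ∈ z.lastTrace, 0 ≤ (z.phase.1 l - y l) * z.phase.2 l

/-- A state of the forgetful process in which the particle is between the opposite faces,
orthogonal to the `i`-th axis, of the last two obstacles. -/
structure ZState.Bouncing (r : ℝ) (q : Fin 3 → ℝ) (i : Fin 3) (z : ZState) : Prop where
  speed : ∀ i, |z.phase.2 i| = q i
  facing : ∃ c c' τ, 0 < τ ∧ z.last = some c ∧ z.prior = some c' ∧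
    Facing r i c c' z.phase.1 z.phase.2 τ
  near : ∀ c, z.last = some c → ∀ l, |z.phase.1 l - c l| ≤ r / 2
  trace : ∀ l ≠ i, ∀ y ∈ z.lastTrace, 0 ≤ (z.phase.1 l - y l) * z.phase.2 l

theorem exists_ne_and_ne : ∀ i j : Fin 3, ∃ l, l ≠ i ∧ l ≠ j := by decide

theorem ne_zero_of_speed {v : Space} (hq : ∀ i, 0 < q i) (h : ∀ i, |v i| = q i) (i : Fin 3) :
    v i ≠ 0 := abs_pos.1 (h i ▸ hq i)

theorem ZState.Clear.hits_eq_empty {z : ZState} (hq : ∀ i, 0 < q i) (h : z.Clear r q) :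
    hits r z.obstacles z.phase.1 z.phase.2 = ∅ := by
  refine Set.eq_empty_of_forall_notMem ?_
  rintro t ⟨ht0, d, hd | hd, htd⟩
  · obtain ⟨i, hi⟩ := h.contact d hd
    exact not_mem_openCube_of_behind (ne_zero_of_speed hq h.speed i) hi.ge ht0 htd
  · obtain ⟨i, hi⟩ := h.beyond d hd
    exact not_mem_openCube_of_behind (ne_zero_of_speed hq h.speed i) hi ht0 htd

theorem ZState.Clear.flight_eq {z : ZState} (hq : ∀ i, 0 < q i) (h : z.Clear r q) (s : ℝ) :
    flight r z.obstacles z.phase s = (z.phase.1 + s • z.phase.2, z.phase.2) :=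
  flight_of_not_hits (by simp [h.hits_eq_empty hq])

theorem abs_impact_le {mk : Mark} (hr : 0 < r) (hmk : ∀ j, |mk.2 j| ≤ 1 / 2) (v : Space)
    (l : Fin 3) :
    |impact r mk v l| ≤ r / 2 := by
  simp only [impact]
  split_ifs
  · rw [abs_mul, abs_div, abs_abs, abs_of_pos (half_pos hr)]
    exact mul_le_of_le_one_left (half_pos hr).le (div_self_le_one _)
  · rw [abs_mul, abs_of_pos hr]
    have := hmk l
    nlinarith

theorem contact_impact {mk : Mark} (v x : Space) (hv : v mk.1 ≠ 0) :
    (x mk.1 - (x + impact r mk v) mk.1) * signFlip mk.1 v mk.1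
      = r / 2 * |signFlip mk.1 v mk.1| := by
  have : |v mk.1| ≠ 0 := abs_ne_zero.2 hv
  simp only [PiLp.add_apply, impact, signFlip_apply, if_pos, abs_neg]
  field_simp
  linear_combination (-r) * sq_abs (v.ofLp mk.1)

theorem ZState.attempt_of_not_shadowed {z : ZState} {T : ℝ} {mk : Mark} {x W : Space}
    (hb : z.before r T = (x, W)) (h : ¬ ∃ y ∈ z.lastTrace, y - (x + impact r mk W) ∈ cube r) :
    (z.attempt r T mk).phase = (x, signFlip mk.1 W) ∧
      (z.attempt r T mk).last = some (x + impact r mk W) := by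
  have h' : ¬ ∃ y ∈ z.lastTrace,
      y - ((z.before r T).1 + impact r mk (z.before r T).2) ∈ cube r := by rwa [hb]
  simp only [attempt, if_neg h', hb, newVelocity, and_self]

theorem ZState.attempt_of_shadowed {z : ZState} {T : ℝ} {mk : Mark} {x W : Space}
    (hb : z.before r T = (x, W)) (h : ∃ y ∈ z.lastTrace, y - (x + impact r mk W) ∈ cube r) :
    (z.attempt r T mk).phase = (x, W) ∧ (z.attempt r T mk).last = none := by
  have h' : ∃ y ∈ z.lastTrace,
      y - ((z.before r T).1 + impact r mk (z.before r T).2) ∈ cube r := by rwa [hb]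
  simp only [attempt, if_pos h', hb, and_self]

/-- After a long flight which is uniform in two suitable coordinates (possibly the same one), the
attempt is not shadowed and leads to a clear state. -/
theorem ZState.attempt_of_long {z : ZState} {T : ℝ} {mk : Mark} {x W : Space} {l l₀ : Fin 3}
    (hr : 0 < r) (hm : 0 < m) (hmq : ∀ i, m ≤ q i) (hmk : ∀ j, |mk.2 j| ≤ 1 / 2)
    (hT : r / m < T) (hspeed : ∀ i, |z.phase.2 i| = q i)
    (hb : z.before r T = (x, W)) (hW : ∀ i, |W i| = q i) (hl : l ≠ mk.1)
    (hWl : W l = z.phase.2 l)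
    (hlin : ∀ s ∈ Set.Ioc 0 T,
      (flight r z.obstacles z.phase s).1 l = z.phase.1 l + s * z.phase.2 l)
    (hlin₀ : (flight r z.obstacles z.phase T).1 l₀ = z.phase.1 l₀ + T * z.phase.2 l₀)
    (hnear : ∀ c, z.last = some c → |z.phase.1 l - c l| ≤ r / 2)
    (htr : ∀ y ∈ z.lastTrace, 0 ≤ (z.phase.1 l₀ - y l₀) * z.phase.2 l₀) :
    (z.attempt r T mk).phase = (x, signFlip mk.1 W) ∧ (z.attempt r T mk).Clear r q := by
  have hq : ∀ i, 0 < q i := fun i => hm.trans_le (hmq i)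
  have hT0 : 0 < T := (div_pos hr hm).trans hT
  have hrT : ∀ i, r < T * q i := fun i => by
    rw [div_lt_iff₀ hm] at hT
    nlinarith [hmq i]
  have hx : ∀ i, x i = (flight r z.obstacles z.phase T).1 i := fun i => by
    have : flight r z.obstacles z.phase T = (x, W) := hb
    rw [this]
  have hsh : ¬ ∃ y ∈ z.lastTrace, y - (x + impact r mk W) ∈ cube r := by
    rintro ⟨y, hy, hc⟩
    have h1 := hc l₀
    have h2 := htr y hy
    have h3 := abs_impact_le hr hmk W l₀
    simp only [PiLp.sub_apply, PiLp.add_apply] at h1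
    rw [hx, hlin₀] at h1
    have h4 : |z.phase.1 l₀ + T * z.phase.2 l₀ - y l₀| ≤ r := by
      rw [abs_le] at h1 h3 ⊢
      constructor <;> linarith
    have h5 : (z.phase.1 l₀ + T * z.phase.2 l₀ - y l₀) * z.phase.2 l₀ ≤ r * q l₀ := by
      refine (le_abs_self _).trans ?_
      rw [abs_mul, hspeed]
      exact mul_le_mul_of_nonneg_right h4 (hq _).le
    have h6 : z.phase.2 l₀ * z.phase.2 l₀ = q l₀ * q l₀ := by
      rw [← hspeed l₀, abs_mul_abs_self]
    nlinarith [hrT l₀, hq l₀]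
  obtain ⟨hph, hlast⟩ := attempt_of_not_shadowed hb hsh
  have hsl : signFlip mk.1 W l = z.phase.2 l := by rw [signFlip_apply, if_neg hl, hWl]
  have h6 : z.phase.2 l * z.phase.2 l = q l * q l := by rw [← hspeed l, abs_mul_abs_self]
  refine ⟨hph, ⟨?_, ?_, ?_, ?_, ?_⟩⟩
  · intro i; rw [hph]; simp only [abs_signFlip_apply, hW]
  · intro c hc
    rw [hlast, Option.some.injEq] at hc
    subst hc
    rw [hph]
    exact ⟨mk.1, contact_impact W x (ne_zero_of_speed hq hW _)⟩
  · intro c hc i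
    rw [hlast, Option.some.injEq] at hc
    subst hc
    rw [hph]
    simpa using abs_impact_le hr hmk W i
  · intro c hc
    refine ⟨l, ?_⟩
    rw [hph]
    simp only
    rw [hsl, hspeed, hx, hlin T ⟨hT0, le_rfl⟩]
    have h1 : |(z.phase.1 l - c l) * z.phase.2 l| ≤ r / 2 * q l := by
      rw [abs_mul, hspeed]
      exact mul_le_mul_of_nonneg_right (hnear c hc) (hq _).le
    rw [abs_le] at h1
    nlinarith [hrT l, hq l]
  · refine ⟨l, ?_⟩
    rintro y ⟨s, hs, rfl⟩
    rw [hph]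
    simp only
    rw [hsl, hx, hlin T ⟨hT0, le_rfl⟩, hlin s hs]
    nlinarith [hs.2, hq l]

theorem ZState.Clear.attempt_of_long {z : ZState} {T : ℝ} {mk : Mark} (h : z.Clear r q)
    (hr : 0 < r) (hm : 0 < m) (hmq : ∀ i, m ≤ q i) (hmk : ∀ j, |mk.2 j| ≤ 1 / 2)
    (hT : r / m < T) :
    (z.attempt r T mk).phase.2 = signFlip mk.1 z.phase.2 ∧ (z.attempt r T mk).Clear r q := by
  have hq : ∀ i, 0 < q i := fun i => hm.trans_le (hmq i)
  obtain ⟨l, hl⟩ : ∃ l, l ≠ mk.1 := exists_ne _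
  obtain ⟨l₀, hl₀⟩ := h.trace
  obtain ⟨h1, h2⟩ := ZState.attempt_of_long (l := l) (l₀ := l₀) hr hm hmq hmk hT h.speed
    (h.flight_eq hq T) h.speed hl rfl (fun s _ => by rw [h.flight_eq hq]; simp)
    (by rw [h.flight_eq hq]; simp) (fun c hc => h.near c hc l) hl₀
  exact ⟨by rw [h1], h2⟩

/-- After a short gap the attempt may be shadowed, and the particle may find itself between the
opposite faces of two obstacles. -/
theorem ZState.Clear.attempt_of_pos {z : ZState} {T : ℝ} {mk : Mark} (h : z.Clear r q)
    (hr : 0 < r) (hq : ∀ i, 0 < q i) (hmk : ∀ j, |mk.2 j| ≤ 1 / 2) (hT : 0 < T) :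
    ((z.attempt r T mk).phase.2 = z.phase.2 ∧ (z.attempt r T mk).Clear r q) ∨
      ((z.attempt r T mk).phase.2 = signFlip mk.1 z.phase.2 ∧
        ((z.attempt r T mk).Clear r q ∨ (z.attempt r T mk).Bouncing r q mk.1)) := by
  set A := z.phase.2 with hA
  set x := z.phase.1 with hx
  have hb : z.before r T = (x + T • A, A) := h.flight_eq hq T
  have hprior : (z.attempt r T mk).prior = z.last := rfl
  have htrace : (z.attempt r T mk).lastTrace = WindTree.trace r z.obstacles z.phase T := rfl
  have hlin : ∀ s l, (flight r z.obstacles z.phase s).1 l = x l + s * A l := fun s l => by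
    rw [h.flight_eq hq]; simp [hx, hA]
  by_cases hsh : ∃ y ∈ z.lastTrace, y - (x + T • A + impact r mk A) ∈ cube r
  · left
    obtain ⟨hph, hlast⟩ := attempt_of_shadowed hb hsh
    refine ⟨by rw [hph], ⟨?_, ?_, ?_, ?_, ?_⟩⟩
    · rw [hph]; exact h.speed
    · simp [hlast]
    · simp [hlast]
    · intro c hc
      rw [hprior] at hc
      obtain ⟨i, hi⟩ := h.contact c hc
      refine ⟨i, ?_⟩
      rw [hph]
      simp only [PiLp.add_apply, PiLp.smul_apply, smul_eq_mul]
      nlinarith [mul_nonneg hT.le (sq_nonneg (A i))]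
    · refine ⟨0, ?_⟩
      rw [htrace]
      rintro y ⟨s, hs, rfl⟩
      rw [hph, hlin]
      simp only [PiLp.add_apply, PiLp.smul_apply, smul_eq_mul]
      nlinarith [mul_nonneg (sub_nonneg.2 hs.2) (sq_nonneg (A 0))]
  · right
    obtain ⟨hph, hlast⟩ := attempt_of_not_shadowed hb hsh
    refine ⟨by rw [hph], ?_⟩
    have hspeed : ∀ i, |(z.attempt r T mk).phase.2 i| = q i := by
      intro i; rw [hph]; simp only [abs_signFlip_apply]; exact h.speed i
    have hnear : ∀ c, (z.attempt r T mk).last = some c →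
        ∀ l, |(z.attempt r T mk).phase.1 l - c l| ≤ r / 2 := by
      intro c hc i
      rw [hlast, Option.some.injEq] at hc
      subst hc
      rw [hph]
      simpa using abs_impact_le hr hmk A i
    have hcontact : ((x + T • A) mk.1 - (x + T • A + impact r mk A) mk.1) * signFlip mk.1 A mk.1
        = r / 2 * |signFlip mk.1 A mk.1| :=
      contact_impact _ _ (ne_zero_of_speed hq h.speed _)
    have htr : ∀ l ≠ mk.1, ∀ y ∈ (z.attempt r T mk).lastTrace,
        0 ≤ ((z.attempt r T mk).phase.1 l - y l) * (z.attempt r T mk).phase.2 l := by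
      rw [htrace]
      rintro l hl y ⟨s, hs, rfl⟩
      rw [hph, hlin]
      simp only [PiLp.add_apply, PiLp.smul_apply, smul_eq_mul, signFlip_apply, if_neg hl]
      nlinarith [mul_nonneg (sub_nonneg.2 hs.2) (sq_nonneg (A l))]
    by_cases hcl : ∀ c, (z.attempt r T mk).prior = some c →
        ∃ i, r / 2 * |(z.attempt r T mk).phase.2 i| ≤
          ((z.attempt r T mk).phase.1 i - c i) * (z.attempt r T mk).phase.2 i
    · left
      obtain ⟨l, hl⟩ : ∃ l, l ≠ mk.1 := exists_ne _
      refine ⟨hspeed, fun c hc => ⟨mk.1, ?_⟩, hnear, hcl, ⟨l, htr l hl⟩⟩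
      rw [hlast, Option.some.injEq] at hc
      subst hc
      rw [hph]
      exact hcontact
    · right
      push Not at hcl
      obtain ⟨c, hc, hlt⟩ := hcl
      obtain ⟨i, hi⟩ := h.contact c hc
      have hi' := hlt i
      rw [hph] at hi'
      simp only [PiLp.add_apply, PiLp.smul_apply, smul_eq_mul, abs_signFlip_apply] at hi'
      obtain rfl : i = mk.1 := by
        by_contra hne
        rw [signFlip_apply, if_neg hne] at hi'
        nlinarith [mul_nonneg hT.le (sq_nonneg (A i))]
      refine ⟨hspeed, ⟨_, c, T, hT, hlast, hc, ?_⟩, hnear, htr⟩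
      rw [hph]
      refine ⟨hcontact, ?_, fun l hl => ?_, fun l hl => ?_⟩
      · simp only [PiLp.add_apply, PiLp.smul_apply, smul_eq_mul, signFlip_apply, if_pos, abs_neg]
        nlinarith
      · have h1 : |((x + T • A) l - (x + T • A + impact r mk A) l) * signFlip mk.1 A l| ≤
            r / 2 * |signFlip mk.1 A l| := by
          rw [abs_mul]
          refine mul_le_mul_of_nonneg_right ?_ (abs_nonneg _)
          simpa using abs_impact_le hr hmk A l
        exact (abs_le.1 h1).1
      · have h1 : |(x l - c l) * A l| ≤ r / 2 * |A l| := by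
          rw [abs_mul]
          exact mul_le_mul_of_nonneg_right (h.near c hc l) (abs_nonneg _)
        simp only [PiLp.add_apply, PiLp.smul_apply, smul_eq_mul, signFlip_apply, if_neg hl]
        nlinarith [mul_nonneg hT.le (sq_nonneg (A l)), (abs_le.1 h1).1]

/-- A long flight out of the space between two opposite faces is uniform up to an error of the
order of the size of the obstacles, and ends in a clear state. -/
theorem ZState.Bouncing.attempt_of_long {z : ZState} {T : ℝ} {mk : Mark} {i : Fin 3}
    (h : z.Bouncing r q i) (hr : 0 < r) (hm : 0 < m) (hmq : ∀ i, m ≤ q i) (hq1 : ∀ i, q i ≤ 1)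
    (hmk : ∀ j, |mk.2 j| ≤ 1 / 2) (hT : r / m < T) :
    Tame r z.obstacles z.phase ∧ ∃ W : Space, (W = z.phase.2 ∨ W = signFlip i z.phase.2) ∧
      (z.before r T).2 = W ∧
      (∀ s ∈ Set.Icc 0 T, ∀ l,
        |(flight r z.obstacles z.phase s).1 l - z.phase.1 l - s * W l| ≤ 2 * r / m) ∧
      (z.attempt r T mk).phase.2 = signFlip mk.1 W ∧ (z.attempt r T mk).Clear r q := by
  have hq : ∀ i, 0 < q i := fun i => hm.trans_le (hmq i)
  have hT0 : 0 < T := (div_pos hr hm).trans hT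
  obtain ⟨c, c', τ, hτ, hc, hc', hf⟩ := h.facing
  have hv : ∀ l, z.phase.2 l ≠ 0 := ne_zero_of_speed hq h.speed
  have hS : ∀ d, d ∈ z.obstacles ↔ d = c ∨ d = c' := fun d => by
    simp only [ZState.obstacles, Set.mem_ofPred_eq, hc, hc', Option.some.injEq]
    constructor <;> rintro (h | h) <;> simp [h]
  -- every coordinate of the velocity is at least `m`, so that a time `r / m` suffices to cross the
  -- shadow of the cubes
  obtain ⟨n, hn⟩ := exists_nat_ge (r / m / τ)
  rw [div_le_iff₀ hτ] at hn
  have hexit : ∀ l, r * |z.phase.2 l| ≤ r / m * z.phase.2 l ^ 2 := fun l => by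
    rw [div_mul_eq_mul_div, le_div_iff₀ hm, ← sq_abs, h.speed]
    nlinarith [mul_nonneg (mul_pos hr (hq l)).le (sub_nonneg.2 (hmq l))]
  obtain ⟨hTame, W, hW, hfl⟩ := Facing.tame_and_flight (S := z.obstacles) hr hτ n hf hv hS
    (div_pos hr hm).le hn fun l hl => by
      constructor
      · linarith [hf.side l hl, hexit l]
      · linarith [hf.side' l hl, hexit l]
  have hWl : ∀ l ≠ i, W l = z.phase.2 l := fun l hl => by
    rcases hW with rfl | rfl
    · rfl
    · rw [signFlip_apply, if_neg hl]
  have hWs : ∀ l, |W l| = q l := fun l => by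
    rcases hW with rfl | rfl
    · exact h.speed l
    · rw [abs_signFlip_apply]; exact h.speed l
  have hW2 : (z.before r T).2 = W := (hfl T hT0.le).2.2 hT
  obtain ⟨l, hli, hlf⟩ : ∃ l : Fin 3, l ≠ i ∧ l ≠ mk.1 := exists_ne_and_ne i mk.1
  obtain ⟨h1, h2⟩ := ZState.attempt_of_long (l := l) (l₀ := l) hr hm hmq hmk hT h.speed
    (show z.before r T = ((z.before r T).1, W) by rw [← hW2]) hWs hlf (hWl l hli)
    (fun s hs => (hfl s hs.1.le).1 l hli) ((hfl T hT0.le).1 l hli)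
    (fun c hc => h.near c hc l) (h.trace l hli)
  refine ⟨hTame, W, hW, hW2, fun s hs j => ?_, by rw [h1], h2⟩
  by_cases hj : j = i
  · subst hj
    refine (hfl s hs.1).2.1.trans ?_
    rw [h.speed, mul_div_assoc]
    exact mul_le_of_le_one_right (by positivity) (hq1 j)
  · rw [show z.phase = (z.phase.1, z.phase.2) from rfl, (hfl s hs.1).1 j hj, hWl j hj]
    simp only [add_sub_cancel_left, sub_self, abs_zero]
    positivity

/-! ### Symbolic velocities -/

/-- The velocities before the attempts, when they change according to the flips, except that the
change at the attempt `k` is suppressed unless `b`. -/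
def velBefore (k : ℕ) (b : Bool) (w : Space) (g : ℕ → ℝ × Mark) : ℕ → Space
  | 0 => w
  | n + 1 =>
    if n = k ∧ b = false then velBefore k b w g n
    else signFlip (g n).2.1 (velBefore k b w g n)

/-- The velocities after the attempts, when those before the attempts are given by `velBefore` and
the attempt `k` fails unless `a`. -/
def velAfter (k : ℕ) (a b : Bool) (w : Space) (g : ℕ → ℝ × Mark) : ℕ → Space
  | 0 => w
  | n + 1 =>
    if n = k ∧ a = false then velBefore k b w g n
    else signFlip (g n).2.1 (velBefore k b w g n)

theorem velBefore_eq_velAfter {k : ℕ} {a b : Bool} {w : Space} {g : ℕ → ℝ × Mark} {n : ℕ}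
    (hn : n ≠ k + 1) : velBefore k b w g n = velAfter k a b w g n := by
  cases n with
  | zero => rfl
  | succ n =>
    have : n ≠ k := by omega
    simp [velBefore, velAfter, this]

theorem velBefore_succ_of_ne {k : ℕ} {b : Bool} {w : Space} {g : ℕ → ℝ × Mark} {n : ℕ}
    (hn : n ≠ k) : velBefore k b w g (n + 1) = signFlip (g n).2.1 (velBefore k b w g n) := by
  simp [velBefore, hn]

theorem abs_velBefore {k : ℕ} {b : Bool} {w : Space} {g : ℕ → ℝ × Mark} (n : ℕ) (i : Fin 3) :
    |velBefore k b w g n i| = |w i| := by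
  induction n with
  | zero => rfl
  | succ n ih => rw [velBefore]; split_ifs <;> simp [abs_signFlip_apply, ih]

/-- Description of the forgetful process up to the attempt `N` when all gaps before that attempt,
except possibly the one with number `k`, are long. -/
theorem exists_velocities {z : ZState} {w : Space} {g : ℕ → ℝ × Mark} {k N : ℕ}
    (hr : 0 < r) (hm : 0 < m) (hmq : ∀ i, m ≤ q i) (hq1 : ∀ i, q i ≤ 1)
    (hz : z.Clear r q) (hzw : z.phase.2 = w)
    (hT : ∀ n < N, 0 < (g n).1) (hmk : ∀ n < N, ∀ j, |(g n).2.2 j| ≤ 1 / 2)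
    (hlong : ∀ n < N, n ≠ k → r / m < (g n).1) :
    ∃ a b, (∀ n ≤ N, (zRun r z g n).phase.2 = velAfter k a b w g n ∧
        ∀ c, (zRun r z g n).last = some c → ∀ l, |(zRun r z g n).phase.1 l - c l| ≤ r / 2) ∧
      ∀ n < N, Tame r (zRun r z g n).obstacles (zRun r z g n).phase ∧
        ((zRun r z g n).before r (g n).1).2 = velBefore k b w g n ∧
        ∀ s ∈ Set.Icc 0 (g n).1, ∀ l,
          |(flight r (zRun r z g n).obstacles (zRun r z g n).phase s).1 l -
            (zRun r z g n).phase.1 l - s * velBefore k b w g n l|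
            ≤ if n = k + 1 then 2 * r / m else 0 := by
  classical
  have hq : ∀ i, 0 < q i := fun i => hm.trans_le (hmq i)
  set Z := zRun r z g with hZ
  set Wk := ((Z k).before r (g k).1).2 with hWk
  -- `a`: the attempt after the short gap succeeds; `b`: the velocity which it proposes is the one
  -- with which the particle leaves the space between the last two obstacles
  set a : Bool := decide ((Z (k + 1)).phase.2 = signFlip (g k).2.1 Wk) with ha
  set b : Bool := decide (((Z (k + 1)).before r (g (k + 1)).1).2 = signFlip (g k).2.1 Wk) with hb
  have hclear : ∀ n, (Z n).Clear r q → ((Z n).before r (g n).1).2 = (Z n).phase.2 := fun n h => by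
    rw [ZState.before, h.flight_eq hq]
  have hstep : ∀ n, Z (n + 1) = (Z n).attempt r (g n).1 (g n).2 := fun n => rfl
  have main : ∀ n ≤ N, (n ≠ k + 1 → (Z n).Clear r q) ∧
      (n = k + 1 → (Z n).Clear r q ∧ (Z n).phase.2 = Wk ∨
        (Z n).phase.2 = signFlip (g k).2.1 Wk ∧
          ((Z n).Clear r q ∨ (Z n).Bouncing r q (g k).2.1)) ∧
      (Z n).phase.2 = velAfter k a b w g n ∧
      (n < N → ((Z n).before r (g n).1).2 = velBefore k b w g n) := by
    intro n
    induction n with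
    | zero =>
      intro _
      refine ⟨fun _ => hz, fun h => by omega, hzw, fun _ => ?_⟩
      rw [hclear 0 hz]; exact hzw
    | succ n ih =>
      intro hn
      obtain ⟨ih1, ih2, ih3, ih4⟩ := ih (by omega)
      have ih4 := ih4 (by omega)
      -- the state after the attempt
      have hpost : (n + 1 ≠ k + 1 → (Z (n + 1)).Clear r q) ∧
          (n + 1 = k + 1 → (Z (n + 1)).Clear r q ∧ (Z (n + 1)).phase.2 = Wk ∨
            (Z (n + 1)).phase.2 = signFlip (g k).2.1 Wk ∧
              ((Z (n + 1)).Clear r q ∨ (Z (n + 1)).Bouncing r q (g k).2.1)) ∧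
          (n ≠ k → (Z (n + 1)).phase.2 =
            signFlip (g n).2.1 ((Z n).before r (g n).1).2) := by
        have hcl : (Z n).Clear r q → n ≠ k →
            (Z (n + 1)).phase.2 = signFlip (g n).2.1 ((Z n).before r (g n).1).2 ∧
              (Z (n + 1)).Clear r q := fun h hnk => by
          rw [hclear n h]
          exact h.attempt_of_long hr hm hmq (hmk n (by omega)) (hlong n (by omega) hnk)
        by_cases hnk : n = k
        · subst hnk
          refine ⟨fun h => absurd rfl h, fun _ => ?_, fun h => absurd rfl h⟩
          have h := ih1 (by omega)
          rw [hWk, hclear n h]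
          rcases h.attempt_of_pos hr hq (hmk n (by omega)) (hT n (by omega)) with h | h
          · exact Or.inl h.symm
          · exact Or.inr h
        · refine ⟨fun _ => ?_, fun h => by omega, fun _ => ?_⟩
          · by_cases hnk' : n = k + 1
            · rcases ih2 hnk' with h | ⟨h, h' | h'⟩
              · exact (hcl h.1 hnk).2
              · exact (hcl h' hnk).2
              · obtain ⟨_, W, _, _, _, _, h2⟩ := h'.attempt_of_long hr hm hmq hq1
                  (hmk n (by omega)) (hlong n (by omega) hnk)
                exact h2
            · exact (hcl (ih1 hnk') hnk).2
          · by_cases hnk' : n = k + 1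
            · rcases ih2 hnk' with h | ⟨h, h' | h'⟩
              · exact (hcl h.1 hnk).1
              · exact (hcl h' hnk).1
              · obtain ⟨_, W, _, hW, _, h2, _⟩ := h'.attempt_of_long hr hm hmq hq1
                  (hmk n (by omega)) (hlong n (by omega) hnk)
                rw [hW]; exact h2
            · exact (hcl (ih1 hnk') hnk).1
      obtain ⟨p1, p2, p3⟩ := hpost
      have hafter : (Z (n + 1)).phase.2 = velAfter k a b w g (n + 1) := by
        rw [velAfter, ← ih4]
        by_cases hnk : n = k
        · subst hnk
          by_cases haa : a = false
          · rw [if_pos ⟨rfl, haa⟩]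
            rcases p2 rfl with h | h
            · exact h.2
            · simp [ha, h.1] at haa
          · rw [if_neg (by simp [haa])]
            simpa [ha] using haa
        · rw [if_neg (by simp [hnk])]
          exact p3 hnk
      refine ⟨p1, p2, hafter, fun hn' => ?_⟩
      by_cases hnk : n = k
      · subst hnk
        have hor : ((Z (n + 1)).before r (g (n + 1)).1).2 = Wk ∨
            ((Z (n + 1)).before r (g (n + 1)).1).2 = signFlip (g n).2.1 Wk := by
          rcases p2 rfl with h | ⟨h, h' | h'⟩
          · left; rw [hclear _ h.1, h.2]
          · right; rw [hclear _ h', h]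
          · obtain ⟨_, W, hW, hW2, _⟩ := h'.attempt_of_long hr hm hmq hq1
              (hmk (n + 1) hn') (hlong (n + 1) hn' (by omega))
            rw [hW2]
            rcases hW with rfl | rfl
            · right; exact h
            · left; rw [h, signFlip_signFlip]
        rw [velBefore, ← ih4]
        by_cases hbb : b = false
        · rw [if_pos ⟨rfl, hbb⟩]
          rcases hor with h | h
          · exact h
          · simp [hb, h] at hbb
        · rw [if_neg (by simp [hbb])]
          simpa [hb] using hbb
      · rw [velBefore_eq_velAfter (a := a) (by omega), ← hafter]
        exact hclear _ (p1 (by omega))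
  refine ⟨a, b, fun n hn => ⟨(main n hn).2.2.1, ?_⟩, fun n hn => ?_⟩
  · by_cases hnk : n = k + 1
    · rcases (main n hn).2.1 hnk with h | ⟨_, h | h⟩
      · exact h.1.near
      · exact h.near
      · exact h.near
    · exact ((main n hn).1 hnk).near
  · obtain ⟨h1, h2, h3, h4⟩ := main n hn.le
    have h4 := h4 hn
    have hcl : (Z n).Clear r q → Tame r (Z n).obstacles (Z n).phase ∧
        ((Z n).before r (g n).1).2 = velBefore k b w g n ∧
        ∀ s ∈ Set.Icc 0 (g n).1, ∀ l, |(flight r (Z n).obstacles (Z n).phase s).1 l -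
            (Z n).phase.1 l - s * velBefore k b w g n l| ≤ if n = k + 1 then 2 * r / m else 0 := by
      intro h
      refine ⟨.free (h.hits_eq_empty hq), h4, fun s hs l => ?_⟩
      rw [← h4, hclear n h, h.flight_eq hq]
      simp only [PiLp.add_apply, PiLp.smul_apply, smul_eq_mul, add_sub_cancel_left, sub_self,
        abs_zero]
      split_ifs
      · positivity
      · exact le_rfl
    by_cases hnk : n = k + 1
    · rcases h2 hnk with h | ⟨_, h | h⟩
      · exact hcl h.1
      · exact hcl h
      · obtain ⟨hTame, W, _, hW2, hfl, _⟩ := h.attempt_of_long hr hm hmq hq1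
          (hmk n hn) (hlong n hn (by omega))
        refine ⟨hTame, h4, ?_⟩
        rw [← h4, hW2, if_pos hnk]
        exact hfl
    · exact hcl (h1 hnk)

/-! ### Processes driven by the blocks of randomness -/

/-- A process which reacts to attempts: its velocity after the last attempt, its velocity just
before an attempt after a given time, and its reaction to an attempt. -/
structure Machine (σ : Type*) where
  /-- The velocity after the last attempt. -/
  after : σ → Space
  /-- The velocity just before an attempt after the given time. -/
  before : σ → ℝ → Space
  /-- The state after an attempt after the given time and with the given data. -/
  attempt : σ → ℝ → Mark → σ

namespace Machine

variable {σ σ' : Type*} (M : Machine σ) (M' : Machine σ')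

open Classical in
/-- The mark used in an attempt: the one of the Markovian process if the latter has a collision at
the same time and the velocities agree, and the own one otherwise. -/
noncomputable def mark (u : Space) (ω : Noise) (s : σ) (a : Fin 3 × ℝ) : Mark :=
  if a.1 ≠ 0 ∧ M.before s a.2 = velocityY u ω a.1 then ω.markY a.1 else ω.markZ a.1

theorem mark_of_pos {u : Space} {ω : Noise} {s : σ} {a : Fin 3 × ℝ}
    (h : a.1 ≠ 0 ∧ M.before s a.2 = velocityY u ω a.1) : M.mark u ω s a = ω.markY a.1 := if_pos h

theorem mark_of_neg {u : Space} {ω : Noise} {s : σ} {a : Fin 3 × ℝ}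
    (h : ¬(a.1 ≠ 0 ∧ M.before s a.2 = velocityY u ω a.1)) : M.mark u ω s a = ω.markZ a.1 :=
  if_neg h

/-- The gaps and marks of the attempts in a list of slots. -/
noncomputable def feed (u : Space) (ω : Noise) : List (Fin 3 × ℝ) → σ → List (ℝ × Mark)
  | [], _ => []
  | a :: l, s => (a.2, M.mark u ω s a) :: feed u ω l (M.attempt s a.2 (M.mark u ω s a))

/-- The gaps and marks of the attempts in one block. -/
noncomputable def block (s : σ × Space) (ω : Noise) : List (ℝ × Mark) :=
  M.feed s.2 ω (schedule (SameParity s.2 (M.after s.1)) ω) s.1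

/-- The states along a sequence of gaps and marks. -/
def run (s : σ) (g : ℕ → ℝ × Mark) : ℕ → σ
  | 0 => s
  | n + 1 => M.attempt (run s g n) (g n).1 (g n).2

/-- The states of the process and of the Markovian velocity after a block. -/
noncomputable def next (s : σ × Space) (ω : Noise) : σ × Space :=
  ((M.block s ω).foldl (fun s d => M.attempt s d.1 d.2) s.1,
    newVelocity (ω.markY 2) (newVelocity (ω.markY 1) s.2))

/-- The states at the beginnings of the blocks. -/
noncomputable def blockState (s : σ × Space) (ω : ℕ → Noise) : ℕ → σ × Space
  | 0 => s
  | b + 1 => M.next (blockState s ω b) (ω b)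

/-- The gaps and marks of all attempts in the first blocks. -/
noncomputable def hist (s : σ × Space) (ω : ℕ → Noise) : ℕ → List (ℝ × Mark)
  | 0 => []
  | b + 1 => hist s ω b ++ M.block (M.blockState s ω b) (ω b)

/-- The sequence of the gaps and marks of all attempts. Each block contains at least one
attempt. -/
noncomputable def stream (s : σ × Space) (ω : ℕ → Noise) (i : ℕ) : ℝ × Mark :=
  (M.hist s ω (i + 1)).getD i (0, 0, 0)

theorem length_feed (u : Space) (ω : Noise) (l : List (Fin 3 × ℝ)) (s : σ) :
    (M.feed u ω l s).length = l.length := by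
  induction l generalizing s with
  | nil => rfl
  | cons a l ih => simp [feed, ih]

theorem length_schedule_pos (P : Prop) (ω : Noise) : 0 < (schedule P ω).length := by
  unfold schedule; split_ifs <;> simp

theorem length_block (s : σ × Space) (ω : Noise) : (M.block s ω).length =
    (schedule (SameParity s.2 (M.after s.1)) ω).length := length_feed ..

theorem length_block_pos (s : σ × Space) (ω : Noise) : 0 < (M.block s ω).length := by
  rw [length_block]; exact length_schedule_pos _ _

theorem le_length_hist (s : σ × Space) (ω : ℕ → Noise) (b : ℕ) : b ≤ (M.hist s ω b).length := by
  induction b with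
  | zero => simp
  | succ b ih =>
    rw [hist, List.length_append]
    have := M.length_block_pos (M.blockState s ω b) (ω b)
    omega

theorem hist_prefix (s : σ × Space) (ω : ℕ → Noise) {b b' : ℕ} (h : b ≤ b') :
    M.hist s ω b <+: M.hist s ω b' := by
  induction h with
  | refl => exact List.prefix_rfl
  | step h ih => exact ih.trans (List.prefix_append _ _)

theorem hist_getElem? (s : σ × Space) (ω : ℕ → Noise) {b i : ℕ} (h : i < (M.hist s ω b).length) :
    (M.hist s ω b)[i]? = some (M.stream s ω i) := by
  have h' : i < (M.hist s ω (i + 1)).length := M.le_length_hist s ω (i + 1)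
  have key : (M.hist s ω b)[i]? = (M.hist s ω (i + 1))[i]? := by
    rcases le_total b (i + 1) with hb | hb
    · obtain ⟨t, ht⟩ := M.hist_prefix s ω hb
      rw [← ht, List.getElem?_append_left h]
    · obtain ⟨t, ht⟩ := M.hist_prefix s ω hb
      rw [← ht, List.getElem?_append_left h']
  rw [key, stream, List.getD_eq_getElem?_getD, List.getElem?_eq_getElem h']
  rfl

theorem blockState_succ_left (s : σ × Space) (ω : ℕ → Noise) (b : ℕ) :
    M.blockState s ω (b + 1) = M.blockState (M.next s (ω 0)) (fun n => ω (n + 1)) b := by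
  induction b with
  | zero => rfl
  | succ b ih => rw [blockState, ih]; rfl

theorem hist_succ_left (s : σ × Space) (ω : ℕ → Noise) (b : ℕ) :
    M.hist s ω (b + 1) =
      M.block s (ω 0) ++ M.hist (M.next s (ω 0)) (fun n => ω (n + 1)) b := by
  induction b with
  | zero => simp [hist, blockState]
  | succ b ih => rw [hist, ih, blockState_succ_left, hist, List.append_assoc]

theorem block_getElem? (s : σ × Space) (ω : ℕ → Noise) {i : ℕ}
    (h : i < (M.block s (ω 0)).length) : (M.block s (ω 0))[i]? = some (M.stream s ω i) := by
  have h1 : M.hist s ω 1 = M.block s (ω 0) := by simp [hist, blockState]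
  rw [← h1] at h ⊢
  exact M.hist_getElem? s ω h

theorem stream_length_add (s : σ × Space) (ω : ℕ → Noise) (i : ℕ) :
    M.stream s ω ((M.block s (ω 0)).length + i) =
      M.stream (M.next s (ω 0)) (fun n => ω (n + 1)) i := by
  have h1 : i < (M.hist (M.next s (ω 0)) (fun n => ω (n + 1)) (i + 1)).length :=
    M.le_length_hist _ _ (i + 1)
  have h2 := M.hist_getElem? s ω (b := i + 2) (i := (M.block s (ω 0)).length + i)
    (by rw [hist_succ_left, List.length_append]; omega)
  rw [hist_succ_left, List.getElem?_append_right (by omega), add_tsub_cancel_left,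
    M.hist_getElem? _ _ h1] at h2
  exact (Option.some.inj h2).symm

theorem run_succ_left (s : σ) (g : ℕ → ℝ × Mark) (n : ℕ) :
    M.run s g (n + 1) = M.run (M.attempt s (g 0).1 (g 0).2) (fun n => g (n + 1)) n := by
  induction n with
  | zero => rfl
  | succ n ih => rw [run, ih]; rfl

theorem run_congr (s : σ) {g g' : ℕ → ℝ × Mark} {n : ℕ} (h : ∀ i < n, g i = g' i) :
    M.run s g n = M.run s g' n := by
  induction n with
  | zero => rfl
  | succ n ih => rw [run, run, ih fun i hi => h i (by omega), h n (by omega)]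

theorem run_add (s : σ) (g : ℕ → ℝ × Mark) (m n : ℕ) :
    M.run s g (m + n) = M.run (M.run s g m) (fun i => g (m + i)) n := by
  induction n with
  | zero => rfl
  | succ n ih => rw [← add_assoc, run, ih]; rfl

theorem foldl_eq_run (L : List (ℝ × Mark)) (s : σ) (g : ℕ → ℝ × Mark)
    (h : ∀ i < L.length, L[i]? = some (g i)) :
    L.foldl (fun s d => M.attempt s d.1 d.2) s = M.run s g L.length := by
  induction L generalizing s g with
  | nil => rfl
  | cons d L ih =>
    have h0 : d = g 0 := by simpa using h 0 (by simp)
    rw [List.foldl_cons, List.length_cons, run_succ_left, ← h0]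
    exact ih _ _ fun i hi => by simpa using h (i + 1) (by simpa using hi)

theorem next_fst (s : σ × Space) (ω : ℕ → Noise) :
    (M.next s (ω 0)).1 = M.run s.1 (M.stream s ω) (M.block s (ω 0)).length :=
  M.foldl_eq_run _ _ _ fun _ hi => M.block_getElem? s ω hi

theorem blockState_fst (s : σ × Space) (ω : ℕ → Noise) (b : ℕ) :
    (M.blockState s ω b).1 = M.run s.1 (M.stream s ω) (M.hist s ω b).length := by
  induction b generalizing s ω with
  | zero => rfl
  | succ b ih =>
    rw [blockState_succ_left, ih, hist_succ_left, List.length_append, run_add, ← next_fst]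
    exact M.run_congr _ fun i _ => (M.stream_length_add s ω i).symm

theorem feed_getElem?_fst (u : Space) (ω : Noise) (l : List (Fin 3 × ℝ)) (s : σ) (n : ℕ) :
    (M.feed u ω l s)[n]?.map Prod.fst = l[n]?.map Prod.snd := by
  induction l generalizing s n with
  | nil => simp [feed]
  | cons a l ih =>
    cases n with
    | zero => simp [feed]
    | succ n => simpa [feed] using ih _ n

/-- A mark depends on the process through its velocity just before the attempt only. -/
theorem feed_congr (u : Space) (ω : Noise) (N : ℕ) (l : List (Fin 3 × ℝ)) (s : σ) (s' : σ')
    (g : ℕ → ℝ × Mark) (hg : ∀ n < l.length, (M.feed u ω l s)[n]? = some (g n))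
    (h : ∀ n < N, n < l.length →
      M.before (M.run s g n) (g n).1 = M'.before (M'.run s' g n) (g n).1) :
    ∀ n < N, n < l.length → (M'.feed u ω l s')[n]? = some (g n) := by
  induction l generalizing s s' g N with
  | nil => simp
  | cons a l ih =>
    intro n hn hnl
    obtain ⟨N, rfl⟩ : ∃ k, N = k + 1 := ⟨N - 1, by omega⟩
    have h0 : (a.2, M.mark u ω s a) = g 0 := by simpa [feed] using hg 0 (by simp)
    have hm : M'.mark u ω s' a = M.mark u ω s a := by
      have := h 0 (by omega) (by simp)
      rw [← h0] at this
      simp only [run] at this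
      simp only [mark, this]
    cases n with
    | zero => simp [feed, hm, h0]
    | succ n =>
      simp only [feed, hm, List.getElem?_cons_succ]
      refine ih N (M.attempt s a.2 (M.mark u ω s a)) _ (fun i => g (i + 1)) (fun i hi => ?_)
        (fun i hi hil => ?_) n (by omega) (by simpa using hnl)
      · simpa [feed] using hg (i + 1) (by simpa using hi)
      · have := h (i + 1) (by omega) (by simpa using hil)
        rwa [run_succ_left, run_succ_left, ← h0] at this

/-- Two processes which have the same velocities along the attempts of the first one use the same
gaps and marks. -/
theorem stream_congr (N : ℕ) : ∀ (s : σ) (s' : σ') (u : Space) (ω : ℕ → Noise),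
    (∀ n ≤ N, M.after (M.run s (M.stream (s, u) ω) n) =
      M'.after (M'.run s' (M.stream (s, u) ω) n)) →
    (∀ n < N, M.before (M.run s (M.stream (s, u) ω) n) (M.stream (s, u) ω n).1 =
      M'.before (M'.run s' (M.stream (s, u) ω) n) (M.stream (s, u) ω n).1) →
    (∀ n < N, M'.stream (s', u) ω n = M.stream (s, u) ω n) ∧
      (M'.stream (s', u) ω N).1 = (M.stream (s, u) ω N).1 := by
  induction N using Nat.strong_induction_on with
  | _ N ih =>
  intro s s' u ω ha hb
  set g := M.stream (s, u) ω with hg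
  set P := SameParity u (M.after s) with hP
  have hP' : SameParity u (M'.after s') = P := by
    have := ha 0 (Nat.zero_le _)
    simp only [run] at this
    rw [hP, this]
  set l := schedule P (ω 0) with hl
  have hblock : M.block (s, u) (ω 0) = M.feed u (ω 0) l s := rfl
  have hblock' : M'.block (s', u) (ω 0) = M'.feed u (ω 0) l s' := by
    simp only [block, hP', hl]
  have hlen : (M.block (s, u) (ω 0)).length = l.length := by rw [hblock, length_feed]
  have hlen' : (M'.block (s', u) (ω 0)).length = l.length := by rw [hblock', length_feed]
  have hgl : ∀ n < l.length, (M.feed u (ω 0) l s)[n]? = some (g n) := fun n hn => by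
    rw [← hblock]; exact M.block_getElem? (s, u) ω (by rwa [hlen])
  have hgl' : ∀ n < l.length, (M'.feed u (ω 0) l s')[n]? = some (M'.stream (s', u) ω n) :=
    fun n hn => by rw [← hblock']; exact M'.block_getElem? (s', u) ω (by rwa [hlen'])
  have hfst : ∀ n < l.length, (M'.stream (s', u) ω n).1 = (g n).1 := fun n hn => by
    have h1 := M.feed_getElem?_fst u (ω 0) l s n
    have h2 := M'.feed_getElem?_fst u (ω 0) l s' n
    rw [hgl n hn] at h1
    rw [hgl' n hn, ← h1] at h2
    simpa using h2
  have hlt : ∀ n < N, n < l.length → M'.stream (s', u) ω n = g n := fun n hn hnl => by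
    have := feed_congr M M' u (ω 0) N l s s' g hgl (fun n hn _ => hb n hn) n hn hnl
    rw [hgl' n hnl] at this
    exact Option.some.inj this
  rcases lt_or_ge N l.length with hN | hN
  · exact ⟨fun n hn => hlt n hn (by omega), hfst N hN⟩
  · have hlpos : 0 < l.length := length_schedule_pos _ _
    have hs : (M.next (s, u) (ω 0)).1 = M.run s g l.length := by rw [next_fst, hlen]
    have hs' : (M'.next (s', u) (ω 0)).1 = M'.run s' g l.length := by
      rw [next_fst, hlen']
      exact M'.run_congr _ fun i hi => hlt i (by omega) hi
    have hu : (M'.next (s', u) (ω 0)).2 = (M.next (s, u) (ω 0)).2 := rfl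
    set t := M.next (s, u) (ω 0) with ht
    set t' := M'.next (s', u) (ω 0) with ht'
    have hsh : M.stream (t.1, t.2) (fun n => ω (n + 1)) = fun i => g (l.length + i) := by
      funext i
      rw [hg, ← hlen, M.stream_length_add]
    have hsh' : ∀ i, M'.stream (t'.1, t'.2) (fun n => ω (n + 1)) i =
        M'.stream (s', u) ω (l.length + i) := fun i => by
      rw [← hlen', M'.stream_length_add]
    obtain ⟨h1, h2⟩ := ih (N - l.length) (by omega) t.1 t'.1 t.2 (fun n => ω (n + 1))
      (fun n hn => by
        rw [hsh, hs, hs', ← run_add, ← run_add]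
        exact ha _ (by omega))
      (fun n hn => by
        rw [hsh, hs, hs', ← run_add, ← run_add]
        exact hb _ (by omega))
    rw [← hu] at h1 h2
    rw [hu, hsh, ← hu, hsh'] at h2
    refine ⟨fun n hn => ?_, ?_⟩
    · rcases lt_or_ge n l.length with hnl | hnl
      · exact hlt n hn hnl
      · have := h1 (n - l.length) (by omega)
        rw [hsh', hu, hsh] at this
        simpa [Nat.add_sub_cancel' hnl] using this
    · simpa [Nat.add_sub_cancel' hN] using h2

end Machine

/-- The forgetful process as a machine. -/
noncomputable def zMachine (r : ℝ) : Machine ZState where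
  after z := z.phase.2
  before z T := (z.before r T).2
  attempt z T m := z.attempt r T m

theorem zMachine_run (r : ℝ) (z : ZState) (g : ℕ → ℝ × Mark) (n : ℕ) :
    (zMachine r).run z g n = zRun r z g n := by
  induction n with
  | zero => rfl
  | succ n ih => rw [Machine.run, ih]; rfl

/-- The process of velocities alone, where the change of velocity at the attempt `k` is suppressed
unless `b`, and that attempt fails unless `a`. A state consists of the number of attempts made so
far and of the velocities after the last and before the next attempt. -/
def velMachine (k : ℕ) (a b : Bool) : Machine (ℕ × Space × Space) where
  after s := s.2.1
  before s _ := s.2.2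
  attempt s _ m :=
    (s.1 + 1, if s.1 = k ∧ a = false then s.2.2 else signFlip m.1 s.2.2,
      if s.1 = k ∧ b = false then s.2.2 else signFlip m.1 s.2.2)

theorem velMachine_run (k : ℕ) (a b : Bool) (w : Space) (g : ℕ → ℝ × Mark) (n : ℕ) :
    (velMachine k a b).run (0, w, w) g n = (n, velAfter k a b w g n, velBefore k b w g n) := by
  induction n with
  | zero => rfl
  | succ n ih => rw [Machine.run, ih]; rfl

theorem stepZ_foldl_fst (r : ℝ) (u : Space) (ω : Noise) (l : List (Fin 3 × ℝ))
    (s : ZState × (Fin 3 → Option Space)) :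
    (l.foldl (stepZ r u ω) s).1 =
      ((zMachine r).feed u ω l s.1).foldl (fun s d => (zMachine r).attempt s d.1 d.2) s.1 := by
  induction l generalizing s with
  | nil => rfl
  | cons a l ih =>
    rw [List.foldl_cons, ih, Machine.feed, List.foldl_cons]
    have : (stepZ r u ω s a).1 =
        (zMachine r).attempt s.1 a.2 ((zMachine r).mark u ω s.1 a) := by
      by_cases h : a.1 ≠ 0 ∧ (s.1.before r a.2).2 = velocityY u ω a.1
      · rw [(zMachine r).mark_of_pos h]
        simp only [stepZ, if_pos h]
        rfl
      · rw [(zMachine r).mark_of_neg h]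
        simp only [stepZ, if_neg h]
        rfl
    simp only [this]

/-- The initial state of the forgetful process. -/
def initialZ (w β₀ : Space) : ZState := (initialState w β₀).Z

theorem stateSeq_eq_blockState (r : ℝ) (w β₀ : Space) (ω : ℕ → Noise) (n : ℕ) :
    ((stateSeq r w β₀ ω n).Z, (stateSeq r w β₀ ω n).velY) =
      (zMachine r).blockState (initialZ w β₀, w) ω n := by
  induction n with
  | zero => rfl
  | succ n ih =>
    rw [Machine.blockState, ← ih, stateSeq, State.next, Machine.next]
    simp only [stepZ_foldl_fst]
    rfl

/-! ### Agreement of the two exploration processes -/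

/-- The states of the wind-tree process driven by a sequence of gaps and marks. -/
noncomputable def xRun (r : ℝ) (x : XState) (g : ℕ → ℝ × Mark) : ℕ → XState
  | 0 => x
  | n + 1 => (xRun r x g n).attempt r (g n).1 (g n).2

/-- The initial state of the wind-tree process. -/
def initialX (w β₀ : Space) : XState := (initialState w β₀).X

variable {r : ℝ} {w β₀ : Space}

/-- The forgetful process driven by `g` does nothing during the stretch `n` and the attempt at its
end which the wind-tree process could not do because of what the former has forgotten: the
particle avoids the obstacles older than the last two, and a new obstacle in the position given by
the attempt is disjoint from the trajectory before the last stretch. -/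
structure NoMismatch (r : ℝ) (z : ZState) (g : ℕ → ℝ × Mark) (n : ℕ) : Prop where
  avoid : ∀ j, j + 2 ≤ n → ∀ c, (zRun r z g j).last = some c → ∀ s ∈ Set.Ioc 0 (g n).1,
    (flight r (zRun r z g n).obstacles (zRun r z g n).phase s).1 - c ∉ cube r
  unshadowed : ∀ j, j + 2 ≤ n →
    ∀ y ∈ trace r (zRun r z g j).obstacles (zRun r z g j).phase (g j).1,
      y - (((zRun r z g n).before r (g n).1).1 +
        impact r (g n).2 ((zRun r z g n).before r (g n).1).2) ∉ cube r

theorem XState.attempt_of_not_shadowed {x : XState} {T : ℝ} {mk : Mark}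
    (h : ¬ ∃ y ∈ x.visited, y - ((x.before r T).1 + impact r mk (x.before r T).2) ∈ cube r) :
    (x.attempt r T mk).phase = ((x.before r T).1, signFlip mk.1 (x.before r T).2) ∧
      (x.attempt r T mk).scatterers =
        insert ((x.before r T).1 + impact r mk (x.before r T).2) x.scatterers := by
  simp only [attempt, if_neg h, newVelocity, and_self]

theorem XState.attempt_of_shadowed {x : XState} {T : ℝ} {mk : Mark}
    (h : ∃ y ∈ x.visited, y - ((x.before r T).1 + impact r mk (x.before r T).2) ∈ cube r) :
    (x.attempt r T mk).phase = x.before r T ∧ (x.attempt r T mk).scatterers = x.scatterers := by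
  simp only [attempt, if_pos h, and_self]

/-- The additional obstacles of the wind-tree process do not affect a flight without mismatch. -/
theorem flight_xRun_aux {g : ℕ → ℝ × Mark} {n : ℕ} {x : XState}
    (hx : x.phase = (zRun r (initialZ w β₀) g n).phase)
    (hS : x.scatterers = {c | ∃ j ≤ n, (zRun r (initialZ w β₀) g j).last = some c})
    (ht : Tame r (zRun r (initialZ w β₀) g n).obstacles (zRun r (initialZ w β₀) g n).phase)
    (hm : NoMismatch r (initialZ w β₀) g n) {s : ℝ} (hs : s ≤ (g n).1) :
    flight r x.scatterers x.phase s =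
      flight r (zRun r (initialZ w β₀) g n).obstacles (zRun r (initialZ w β₀) g n).phase s := by
  have hprior : ∀ j c, (zRun r (initialZ w β₀) g j).prior = some c →
      ∃ i, j = i + 1 ∧ (zRun r (initialZ w β₀) g i).last = some c := by
    intro j c h
    cases j with
    | zero => simp [zRun, initialZ, initialState] at h
    | succ j => exact ⟨j, rfl, h⟩
  rw [hx]
  refine ht.flight_superset ?_ (T := (g n).1) (fun s hs c hc hc' => ?_) hs
  · rintro c (hc | hc)
    · rw [hS]; exact ⟨n, le_rfl, hc⟩
    · obtain ⟨i, rfl, hi⟩ := hprior n c hc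
      rw [hS]; exact ⟨i, by omega, hi⟩
  · rw [hS] at hc
    obtain ⟨j, hj, hjc⟩ := hc
    refine hm.avoid j ?_ c hjc s hs
    by_contra hlt
    refine hc' ?_
    rcases (show j = n ∨ n = j + 1 by omega) with rfl | rfl
    · exact Or.inl hjc
    · exact Or.inr hjc

/-- Without mismatch the wind-tree process has the phase of the forgetful process, and its obstacles
and visited points are those which the latter has placed and visited in the whole past. -/
theorem xRun_eq {g : ℕ → ℝ × Mark} {N : ℕ}
    (ht : ∀ n < N, Tame r (zRun r (initialZ w β₀) g n).obstacles (zRun r (initialZ w β₀) g n).phase)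
    (hm : ∀ n < N, NoMismatch r (initialZ w β₀) g n) :
    ∀ n ≤ N, (xRun r (initialX w β₀) g n).phase = (zRun r (initialZ w β₀) g n).phase ∧
      (xRun r (initialX w β₀) g n).scatterers =
        {c | ∃ j ≤ n, (zRun r (initialZ w β₀) g j).last = some c} ∧
      (xRun r (initialX w β₀) g n).visited = {y | ∃ j < n, y ∈ trace r
        (zRun r (initialZ w β₀) g j).obstacles (zRun r (initialZ w β₀) g j).phase (g j).1} := by
  set Z := zRun r (initialZ w β₀) g with hZ
  set X := xRun r (initialX w β₀) g with hX
  intro n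
  induction n with
  | zero =>
    intro _
    refine ⟨rfl, ?_, ?_⟩
    · ext c
      simp [hX, hZ, xRun, zRun, initialX, initialZ, initialState, eq_comm]
    · ext c
      simp [hX, xRun, initialX, initialState]
  | succ n ih =>
    intro hn
    obtain ⟨ih1, ih2, ih3⟩ := ih (by omega)
    have hfl : ∀ s ≤ (g n).1, flight r (X n).scatterers (X n).phase s =
        flight r (Z n).obstacles (Z n).phase s := fun s hs =>
      flight_xRun_aux ih1 ih2 (ht n (by omega)) (hm n (by omega)) hs
    have hb : (X n).before r (g n).1 = (Z n).before r (g n).1 := hfl _ le_rfl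
    have hsh : (∃ y ∈ (X n).visited, y - (((X n).before r (g n).1).1 +
          impact r (g n).2 ((X n).before r (g n).1).2) ∈ cube r) ↔
        ∃ y ∈ (Z n).lastTrace, y - (((Z n).before r (g n).1).1 +
          impact r (g n).2 ((Z n).before r (g n).1).2) ∈ cube r := by
      rw [hb, ih3]
      cases n with
      | zero => simp [hZ, zRun, initialZ, initialState]
      | succ n =>
        constructor
        · rintro ⟨y, ⟨j, hj, hy⟩, hyc⟩
          refine ⟨y, ?_, hyc⟩
          rcases (show j = n ∨ j + 2 ≤ n + 1 by omega) with rfl | hj'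
          · exact hy
          · exact absurd hyc ((hm (n + 1) (by omega)).unshadowed j hj' y hy)
        · rintro ⟨y, hy, hyc⟩
          exact ⟨y, ⟨n, by omega, hy⟩, hyc⟩
    have hvis : (X (n + 1)).visited = {y | ∃ j < n + 1, y ∈ trace r (Z j).obstacles
        (Z j).phase (g j).1} := by
      have h1 : (X (n + 1)).visited =
        (X n).visited ∪ trace r (X n).scatterers (X n).phase (g n).1 := rfl
      have h2 : trace r (X n).scatterers (X n).phase (g n).1 =
          trace r (Z n).obstacles (Z n).phase (g n).1 := by
        ext y
        constructor
        · rintro ⟨s, hs, rfl⟩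
          exact ⟨s, hs, by rw [hfl s hs.2]⟩
        · rintro ⟨s, hs, rfl⟩
          exact ⟨s, hs, by rw [hfl s hs.2]⟩
      rw [h1, h2, ih3]
      ext y
      simp only [Set.mem_union, Set.mem_ofPred_eq, Nat.lt_succ_iff_lt_or_eq]
      constructor
      · rintro (⟨j, hj, h⟩ | h)
        · exact ⟨j, Or.inl hj, h⟩
        · exact ⟨n, Or.inr rfl, h⟩
      · rintro ⟨j, hj | rfl, h⟩
        · exact Or.inl ⟨j, hj, h⟩
        · exact Or.inr h
    have hXs : X (n + 1) = (X n).attempt r (g n).1 (g n).2 := rfl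
    have hZs : Z (n + 1) = (Z n).attempt r (g n).1 (g n).2 := rfl
    by_cases hs : ∃ y ∈ (Z n).lastTrace, y - (((Z n).before r (g n).1).1 +
          impact r (g n).2 ((Z n).before r (g n).1).2) ∈ cube r
    · obtain ⟨x1, x2⟩ := XState.attempt_of_shadowed (hsh.2 hs)
      obtain ⟨z1, z2⟩ := ZState.attempt_of_shadowed (x := ((Z n).before r (g n).1).1)
        (W := ((Z n).before r (g n).1).2) rfl hs
      refine ⟨by rw [hXs, x1, hZs, z1, hb], ?_, hvis⟩
      rw [hXs, x2, ih2]
      ext c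
      simp only [Set.mem_ofPred_eq]
      refine ⟨fun ⟨j, hj, h⟩ => ⟨j, by omega, h⟩, fun ⟨j, hj, h⟩ => ?_⟩
      rcases (show j ≤ n ∨ j = n + 1 by omega) with hj | rfl
      · exact ⟨j, hj, h⟩
      · rw [hZs, z2] at h; simp at h
    · obtain ⟨x1, x2⟩ := XState.attempt_of_not_shadowed (mt hsh.1 hs)
      obtain ⟨z1, z2⟩ := ZState.attempt_of_not_shadowed (x := ((Z n).before r (g n).1).1)
        (W := ((Z n).before r (g n).1).2) rfl hs
      refine ⟨by rw [hXs, x1, hZs, z1, hb], ?_, hvis⟩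
      rw [hXs, x2, ih2, hb]
      ext c
      simp only [Set.mem_ofPred_eq, Set.mem_insert_iff]
      constructor
      · rintro (rfl | ⟨j, hj, h⟩)
        · exact ⟨n + 1, le_rfl, z2⟩
        · exact ⟨j, by omega, h⟩
      · rintro ⟨j, hj, h⟩
        rcases (show j ≤ n ∨ j = n + 1 by omega) with hj | rfl
        · exact Or.inr ⟨j, hj, h⟩
        · rw [hZs, z2, Option.some.injEq] at h
          exact Or.inl h.symm

/-! ### The data used by the wind-tree process -/

/-- In the slots of the list in which the forgetful process uses its own data, its velocity is
recorded. -/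
def Recorded (r : ℝ) (u : Space) (ω : Noise) (indep : Fin 3 → Option Space) :
    List (Fin 3 × ℝ) → ZState → Prop
  | [], _ => True
  | a :: l, z =>
    (¬(a.1 ≠ 0 ∧ (z.before r a.2).2 = velocityY u ω a.1) →
      indep a.1 = some (z.before r a.2).2) ∧
    Recorded r u ω indep l (z.attempt r a.2 ((zMachine r).mark u ω z a))

theorem stepZ_foldl_snd_of_not_mem (u : Space) (ω : Noise) (l : List (Fin 3 × ℝ))
    (s : ZState × (Fin 3 → Option Space)) (i : Fin 3) (hi : i ∉ l.map Prod.fst) :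
    (l.foldl (stepZ r u ω) s).2 i = s.2 i := by
  induction l generalizing s with
  | nil => rfl
  | cons a l ih =>
    simp only [List.map_cons, List.mem_cons, not_or] at hi
    rw [List.foldl_cons, ih _ hi.2, stepZ]
    split_ifs
    · rfl
    · exact Function.update_of_ne hi.1 _ _

theorem recorded_foldl (u : Space) (ω : Noise) (l : List (Fin 3 × ℝ))
    (s : ZState × (Fin 3 → Option Space)) (hl : (l.map Prod.fst).Nodup) :
    Recorded r u ω (l.foldl (stepZ r u ω) s).2 l s.1 := by
  induction l generalizing s with
  | nil => trivial
  | cons a l ih =>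
    simp only [List.map_cons, List.nodup_cons] at hl
    rw [List.foldl_cons, Recorded]
    constructor
    · intro h
      rw [stepZ_foldl_snd_of_not_mem _ _ _ _ _ hl.1]
      simp only [stepZ, if_neg h, Function.update_self]
    · have := ih (stepZ r u ω s a) hl.2
      by_cases h : a.1 ≠ 0 ∧ (s.1.before r a.2).2 = velocityY u ω a.1
      · rw [(zMachine r).mark_of_pos h]
        simpa only [stepZ, if_pos h] using this
      · rw [(zMachine r).mark_of_neg h]
        simpa only [stepZ, if_neg h] using this

theorem stepX_history (u : Space) (ω : Noise) (indep : Fin 3 → Option Space) (x : XState)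
    (a : Fin 3 × ℝ) : ∃ st : Stretch, st.duration = a.2 ∧
      (stepX r u ω indep x a).history = x.history ++ [st] := by
  unfold stepX
  dsimp only
  split_ifs <;> exact ⟨_, rfl, rfl⟩

theorem stepX_foldl_history (u : Space) (ω : Noise) (indep : Fin 3 → Option Space)
    (l : List (Fin 3 × ℝ)) (x : XState) :
    x.history <+: (l.foldl (stepX r u ω indep) x).history := by
  induction l generalizing x with
  | nil => exact List.prefix_rfl
  | cons a l ih =>
    obtain ⟨st, _, h⟩ := stepX_history (r := r) u ω indep x a
    exact (h ▸ List.prefix_append _ _ : x.history <+: (stepX r u ω indep x a).history).trans (ih _)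

/-- As long as the wind-tree process agrees with the forgetful process it uses the same data. -/
theorem stepX_foldl {g : ℕ → ℝ × Mark} {N : ℕ}
    (hX : ∀ n < N, (xRun r (initialX w β₀) g n).before r (g n).1 =
      (zRun r (initialZ w β₀) g n).before r (g n).1)
    (u : Space) (ω : Noise) (indep : Fin 3 → Option Space) (l : List (Fin 3 × ℝ)) (n : ℕ)
    (hn : n ≤ N) (hl : Recorded r u ω indep l (zRun r (initialZ w β₀) g n))
    (hg : ∀ i < l.length,
      ((zMachine r).feed u ω l (zRun r (initialZ w β₀) g n))[i]? = some (g (n + i))) :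
    (n + l.length ≤ N →
      l.foldl (stepX r u ω indep) (xRun r (initialX w β₀) g n) =
        xRun r (initialX w β₀) g (n + l.length)) ∧
    (xRun r (initialX w β₀) g (min (n + l.length) N)).history <+:
      (l.foldl (stepX r u ω indep) (xRun r (initialX w β₀) g n)).history := by
  induction l generalizing n with
  | nil =>
    refine ⟨fun _ => rfl, ?_⟩
    simp [min_eq_left hn]
  | cons a l ih =>
    rcases hn.lt_or_eq with hlt | rfl
    · have h0 : (a.2, (zMachine r).mark u ω (zRun r (initialZ w β₀) g n) a) = g n := by
        simpa [Machine.feed] using hg 0 (by simp)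
      have ha : a.2 = (g n).1 := by rw [← h0]
      have hmk : (zMachine r).mark u ω (zRun r (initialZ w β₀) g n) a = (g n).2 := by rw [← h0]
      have hstep : stepX r u ω indep (xRun r (initialX w β₀) g n) a =
          xRun r (initialX w β₀) g (n + 1) := by
        have hv : ((xRun r (initialX w β₀) g n).before r a.2).2 =
          ((zRun r (initialZ w β₀) g n).before r a.2).2 := by rw [ha, hX n hlt]
        rw [xRun, ← ha, ← hmk]
        by_cases h : a.1 ≠ 0 ∧ ((zRun r (initialZ w β₀) g n).before r a.2).2 = velocityY u ω a.1
        · rw [(zMachine r).mark_of_pos h]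
          simp only [stepX]
          rw [if_pos (by rwa [hv])]
        · rw [(zMachine r).mark_of_neg h]
          simp only [stepX]
          rw [if_neg (by rwa [hv]), if_pos (by rw [hv]; exact hl.1 h)]
      have hz : (zRun r (initialZ w β₀) g n).attempt r a.2
          ((zMachine r).mark u ω (zRun r (initialZ w β₀) g n) a) =
            zRun r (initialZ w β₀) g (n + 1) := by rw [hmk, ha, zRun]
      have hl2 := hl.2
      rw [hz] at hl2
      have := ih (n + 1) hlt hl2 fun i hi => by
        have := hg (i + 1) (by simpa using hi)
        rw [Machine.feed, List.getElem?_cons_succ] at this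
        rw [add_assoc, add_comm 1 i, ← this, ← hz]
        rfl
      rw [List.foldl_cons, hstep, List.length_cons, ← add_assoc, add_right_comm]
      exact this
    · refine ⟨fun h => by simp at h, ?_⟩
      rw [min_eq_right (by omega)]
      exact stepX_foldl_history ..

theorem nodup_schedule (P : Prop) (ω : Noise) : ((schedule P ω).map Prod.fst).Nodup := by
  unfold schedule; split_ifs <;> simp

/-- The gaps and marks used by the forgetful process. -/
noncomputable def zStream (r : ℝ) (w β₀ : Space) (ω : ℕ → Noise) : ℕ → ℝ × Mark :=
  (zMachine r).stream (initialZ w β₀, w) ω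

theorem stateSeq_Z (ω : ℕ → Noise) (b : ℕ) : (stateSeq r w β₀ ω b).Z =
    zRun r (initialZ w β₀) (zStream r w β₀ ω)
      ((zMachine r).hist (initialZ w β₀, w) ω b).length := by
  rw [← zMachine_run, zStream,
    ← (zMachine r).blockState_fst (initialZ w β₀, w), ← stateSeq_eq_blockState]

/-- Blocks that end before a mismatch leave the wind-tree process in the states of `xRun`. Of a
block that extends beyond the attempt `N` only the history up to that attempt is described. -/
theorem stateSeq_X {ω : ℕ → Noise} {N : ℕ}
    (ht : ∀ n < N, Tame r (zRun r (initialZ w β₀) (zStream r w β₀ ω) n).obstacles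
      (zRun r (initialZ w β₀) (zStream r w β₀ ω) n).phase)
    (hm : ∀ n < N, NoMismatch r (initialZ w β₀) (zStream r w β₀ ω) n) (b : ℕ) :
    (((zMachine r).hist (initialZ w β₀, w) ω b).length ≤ N →
      (stateSeq r w β₀ ω b).X = xRun r (initialX w β₀) (zStream r w β₀ ω)
        ((zMachine r).hist (initialZ w β₀, w) ω b).length) ∧
    (xRun r (initialX w β₀) (zStream r w β₀ ω)
        (min ((zMachine r).hist (initialZ w β₀, w) ω b).length N)).history <+:
      (stateSeq r w β₀ ω b).X.history := by
  set g := zStream r w β₀ ω with hg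
  set len := fun b => ((zMachine r).hist (initialZ w β₀, w) ω b).length with hlen
  have hxz := xRun_eq ht hm
  have hX : ∀ n < N, (xRun r (initialX w β₀) g n).before r (g n).1 =
      (zRun r (initialZ w β₀) g n).before r (g n).1 := fun n hn =>
    flight_xRun_aux (hxz n hn.le).1 (hxz n hn.le).2.1 (ht n hn) (hm n hn) le_rfl
  induction b with
  | zero => exact ⟨fun _ => rfl, by simp [Machine.hist, xRun, initialX, initialState]⟩
  | succ b ih =>
    set s := stateSeq r w β₀ ω b with hs
    have hZ : s.Z = zRun r (initialZ w β₀) g (len b) := stateSeq_Z ω b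
    have hbs := stateSeq_eq_blockState r w β₀ ω b
    rw [← hs] at hbs
    set l := schedule (SameParity s.velY s.Z.phase.2) (ω b) with hl
    have hblock : (zMachine r).block ((zMachine r).blockState (initialZ w β₀, w) ω b) (ω b) =
        (zMachine r).feed s.velY (ω b) l s.Z := by
      rw [← hbs]; rfl
    have hlen1 : len (b + 1) = len b + l.length := by
      simp only [hlen, Machine.hist, List.length_append, hblock, Machine.length_feed]
    have hsX : (stateSeq r w β₀ ω (b + 1)).X =
        (schedule (SameParity s.velY s.X.phase.2) (ω b)).foldl
          (stepX r s.velY (ω b) (l.foldl (stepZ r s.velY (ω b)) (s.Z, fun _ => none)).2) s.X := rfl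
    change (len (b + 1) ≤ N → _ = xRun r _ g (len (b + 1))) ∧
      (xRun r _ g (min (len (b + 1)) N)).history <+: _
    rw [hsX]
    rcases le_or_gt (len b) N with hle | hgt
    · have hx : s.X = xRun r (initialX w β₀) g (len b) := ih.1 hle
      have hph : s.X.phase.2 = s.Z.phase.2 := by rw [hx, hZ, (hxz _ hle).1]
      have hfeed : ∀ i < l.length, ((zMachine r).feed s.velY (ω b) l
          (zRun r (initialZ w β₀) g (len b)))[i]? = some (g (len b + i)) := by
        intro i hi
        rw [← hZ, ← hblock, hg, zStream, ← (zMachine r).hist_getElem? _ ω (b := b + 1) (by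
            change _ < len (b + 1); rw [hlen1]; omega), Machine.hist,
          List.getElem?_append_right (by simp [hlen]), add_tsub_cancel_left]
      have := stepX_foldl hX s.velY (ω b) (l := l) (n := len b) (hn := hle)
        (indep := (l.foldl (stepZ r s.velY (ω b)) (s.Z, fun _ => none)).2)
        (by
          rw [← hZ]
          exact recorded_foldl s.velY (ω b) l (s.Z, fun _ => none) (nodup_schedule _ _))
        hfeed
      rw [hph, hx, hlen1]
      exact this
    · refine ⟨fun h => by omega, ?_⟩
      have h1 : min (len (b + 1)) N = min (len b) N := by omega
      rw [h1]
      exact ih.2.trans (stepX_foldl_history ..)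

/-! ### The stretches -/

theorem zRun_history (g : ℕ → ℝ × Mark) (n : ℕ) :
    (zRun r (initialZ w β₀) g n).history = (List.range n).map fun i =>
      ⟨(zRun r (initialZ w β₀) g i).obstacles, (zRun r (initialZ w β₀) g i).phase, (g i).1,
        newVelocity (g i).2 ((zRun r (initialZ w β₀) g i).before r (g i).1).2⟩ := by
  induction n with
  | zero => rfl
  | succ n ih => rw [List.range_succ, List.map_append, ← ih]; rfl

theorem xRun_history (g : ℕ → ℝ × Mark) (n : ℕ) :
    (xRun r (initialX w β₀) g n).history = (List.range n).map fun i =>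
      ⟨(xRun r (initialX w β₀) g i).scatterers, (xRun r (initialX w β₀) g i).phase, (g i).1,
        newVelocity (g i).2 ((xRun r (initialX w β₀) g i).before r (g i).1).2⟩ := by
  induction n with
  | zero => rfl
  | succ n ih => rw [List.range_succ, List.map_append, ← ih]; rfl

theorem stretchZ_eq (ω : ℕ → Noise) (n : ℕ) : stretchZ r w β₀ ω n =
    ⟨(zRun r (initialZ w β₀) (zStream r w β₀ ω) n).obstacles,
      (zRun r (initialZ w β₀) (zStream r w β₀ ω) n).phase, (zStream r w β₀ ω n).1,
      newVelocity (zStream r w β₀ ω n).2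
        ((zRun r (initialZ w β₀) (zStream r w β₀ ω) n).before r (zStream r w β₀ ω n).1).2⟩ := by
  have h := (zMachine r).le_length_hist (initialZ w β₀, w) ω (n + 1)
  rw [stretchZ, stateSeq_Z, zRun_history, List.getD_eq_getElem?_getD, List.getElem?_map,
    List.getElem?_range h]
  rfl

theorem stretchX_eq {ω : ℕ → Noise} {N : ℕ}
    (ht : ∀ n < N, Tame r (zRun r (initialZ w β₀) (zStream r w β₀ ω) n).obstacles
      (zRun r (initialZ w β₀) (zStream r w β₀ ω) n).phase)
    (hm : ∀ n < N, NoMismatch r (initialZ w β₀) (zStream r w β₀ ω) n) {n : ℕ} (hn : n < N) :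
    (stretchX r w β₀ ω n).duration = (stretchZ r w β₀ ω n).duration ∧
    ∀ s ≤ (stretchZ r w β₀ ω n).duration,
      flight r (stretchX r w β₀ ω n).obstacles (stretchX r w β₀ ω n).start s =
        flight r (stretchZ r w β₀ ω n).obstacles (stretchZ r w β₀ ω n).start s := by
  have h := (zMachine r).le_length_hist (initialZ w β₀, w) ω (n + 1)
  have hxz := xRun_eq ht hm n hn.le
  obtain ⟨t, hpre⟩ := (stateSeq_X ht hm (n + 1)).2
  have hX : stretchX r w β₀ ω n = ⟨(xRun r (initialX w β₀) (zStream r w β₀ ω) n).scatterers,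
      (xRun r (initialX w β₀) (zStream r w β₀ ω) n).phase, (zStream r w β₀ ω n).1,
      newVelocity (zStream r w β₀ ω n).2
        ((xRun r (initialX w β₀) (zStream r w β₀ ω) n).before r (zStream r w β₀ ω n).1).2⟩ := by
    have hlt : n < min ((zMachine r).hist (initialZ w β₀, w) ω (n + 1)).length N :=
      lt_min h hn
    rw [stretchX, ← hpre, xRun_history, List.getD_eq_getElem?_getD,
      List.getElem?_append_left (by simpa using hlt), List.getElem?_map, List.getElem?_range hlt]
    rfl
  rw [hX, stretchZ_eq]
  exact ⟨rfl, fun s hs => flight_xRun_aux hxz.1 hxz.2.1 (ht n hn) (hm n hn) hs⟩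

theorem schedule_nonneg (P : Prop) {ω : Noise} (hω : ∀ i, 0 ≤ ω.clock i) :
    ∀ a ∈ schedule P ω, 0 ≤ a.2 := by
  unfold schedule
  split_ifs with h1 h2
  · simp [hω]
  · simp [hω, h2]
  · simp [add_nonneg (hω 1) (hω 2)]

theorem stepX_foldl_history_nonneg (u : Space) (ω : Noise) (indep : Fin 3 → Option Space)
    (l : List (Fin 3 × ℝ)) (hl : ∀ a ∈ l, 0 ≤ a.2) (x : XState)
    (hx : ∀ st ∈ x.history, 0 ≤ st.duration) :
    ∀ st ∈ (l.foldl (stepX r u ω indep) x).history, 0 ≤ st.duration := by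
  induction l generalizing x with
  | nil => exact hx
  | cons a l ih =>
    simp only [List.mem_cons, forall_eq_or_imp] at hl
    refine ih hl.2 _ ?_
    obtain ⟨st, h1, h2⟩ := stepX_history (r := r) u ω indep x a
    rw [h2]
    intro st' hst'
    rcases List.mem_append.1 hst' with h | h
    · exact hx _ h
    · rw [List.mem_singleton.1 h, h1]; exact hl.1

theorem stretchX_duration_nonneg {ω : ℕ → Noise} (hω : ∀ b i, 0 ≤ (ω b).clock i) (n : ℕ) :
    0 ≤ (stretchX r w β₀ ω n).duration := by
  have key : ∀ b, ∀ st ∈ (stateSeq r w β₀ ω b).X.history, 0 ≤ st.duration := by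
    intro b
    induction b with
    | zero => simp [stateSeq, initialState]
    | succ b ih =>
      exact stepX_foldl_history_nonneg _ _ _ _ (schedule_nonneg _ (hω b)) _ ih
  rw [stretchX, List.getD_eq_getElem?_getD]
  cases h : (stateSeq r w β₀ ω (n + 1)).X.history[n]? with
  | none => simp
  | some st => exact key _ _ (List.mem_of_getElem? h)

theorem zStream_fst_nonneg {ω : ℕ → Noise} (hω : ∀ b i, 0 ≤ (ω b).clock i) (n : ℕ) :
    0 ≤ (zStream r w β₀ ω n).1 := by
  have key : ∀ b, ∀ d ∈ (zMachine r).hist (initialZ w β₀, w) ω b, 0 ≤ d.1 := by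
    intro b
    induction b with
    | zero => simp [Machine.hist]
    | succ b ih =>
      intro d hd
      rcases List.mem_append.1 hd with h | h
      · exact ih d h
      · obtain ⟨i, hi⟩ := List.mem_iff_getElem?.1 h
        have := (zMachine r).feed_getElem?_fst _ _ _ _ _ ▸ congrArg (Option.map Prod.fst) hi
        obtain ⟨a, ha, had⟩ := Option.map_eq_some_iff.1 this
        rw [← had]
        exact schedule_nonneg _ (hω b) a (List.mem_of_getElem? ha)
  exact key _ _ (List.mem_of_getElem? ((zMachine r).hist_getElem? _ ω
    ((zMachine r).le_length_hist _ ω (n + 1))))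

theorem attemptTime_mono {s : ℕ → Stretch} (hs : ∀ n, 0 ≤ (s n).duration) :
    Monotone (attemptTime s) := by
  refine monotone_nat_of_le_succ fun n => ?_
  rw [attemptTime, attemptTime, Finset.sum_range_succ]
  linarith [hs n]

/-- Two trajectories whose stretches before the attempt `N` agree coincide up to that attempt. -/
theorem path_congr {s s' : ℕ → Stretch} {N : ℕ} (hs : ∀ n, 0 ≤ (s n).duration)
    (hs' : ∀ n, 0 ≤ (s' n).duration) (hd : ∀ n < N, (s' n).duration = (s n).duration)
    (hf : ∀ n < N, ∀ t ≤ (s n).duration,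
      flight r (s' n).obstacles (s' n).start t = flight r (s n).obstacles (s n).start t)
    {t : ℝ} (ht0 : 0 ≤ t) (ht : t < attemptTime s N) : path r s' t = path r s t := by
  have hat : ∀ n ≤ N, attemptTime s' n = attemptTime s n := fun n hn =>
    Finset.sum_congr rfl fun i hi => hd i ((Finset.mem_range.1 hi).trans_le hn)
  have hset : {n | attemptTime s' n ≤ t} = {n | attemptTime s n ≤ t} := by
    ext n
    rcases le_total n N with hn | hn
    · simp [hat n hn]
    · have h1 := attemptTime_mono hs hn
      have h2 := attemptTime_mono hs' hn
      rw [hat N le_rfl] at h2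
      simp only [Set.mem_ofPred_eq]
      constructor <;> intro h <;> linarith
  have hbdd : ∀ n ∈ {n | attemptTime s n ≤ t}, n < N := fun n hn => by
    by_contra! h
    have := attemptTime_mono hs h
    have : attemptTime s n ≤ t := hn
    linarith
  have hne : {n | attemptTime s n ≤ t}.Nonempty := ⟨0, by simpa [attemptTime] using ht0⟩
  have hba : BddAbove {n | attemptTime s n ≤ t} := ⟨N, fun n hn => (hbdd n hn).le⟩
  have hmem := Nat.sSup_mem hne hba
  unfold path
  rw [hset]
  set n := sSup {n | attemptTime s n ≤ t} with hn
  have hnN := hbdd n hmem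
  have hlt : t < attemptTime s (n + 1) := by
    by_contra! h
    have := le_csSup hba (show n + 1 ∈ {n | attemptTime s n ≤ t} from h)
    omega
  dsimp only
  rw [hat n hnN.le, hf n hnN]
  rw [attemptTime, Finset.sum_range_succ, ← attemptTime] at hlt
  linarith

theorem gap_succ (s : ℕ → Stretch) (n : ℕ) : gap s (n + 1) = (s n).duration := by
  rw [gap, add_tsub_cancel_right, attemptTime, Finset.sum_range_succ, ← attemptTime,
    add_sub_cancel_left]

/-- If the leg can end before a mismatch occurs, the two processes agree during the leg. -/
theorem mem_agreement {ω : ℕ → Noise} {N n : ℕ} (hω : ∀ b i, 0 ≤ (ω b).clock i)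
    (ht : ∀ n < N, Tame r (zRun r (initialZ w β₀) (zStream r w β₀ ω) n).obstacles
      (zRun r (initialZ w β₀) (zStream r w β₀ ω) n).phase)
    (hm : ∀ n < N, NoMismatch r (initialZ w β₀) (zStream r w β₀ ω) n)
    (hn : n + 3 ≤ N) (hgap : ∀ i < 4, 1 < (zStream r w β₀ ω (n + i)).1)
    (hw : newVelocity (zStream r w β₀ ω (n + 1)).2
      ((zRun r (initialZ w β₀) (zStream r w β₀ ω) (n + 1)).before r
        (zStream r w β₀ ω (n + 1)).1).2 = w) :
    ω ∈ agreement r w β₀ := by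
  classical
  have hdur : ∀ i, (stretchZ r w β₀ ω i).duration = (zStream r w β₀ ω i).1 := fun i => by
    rw [stretchZ_eq]
  have hcan : CanEnd w (stretchZ r w β₀ ω) (n + 2) := by
    refine ⟨by omega, ?_, ?_, ?_, ?_, ?_⟩
    · rw [show n + 2 - 1 = n + 1 by omega, gap_succ, hdur]; exact hgap 0 (by omega)
    · rw [gap_succ, hdur]; exact hgap 1 (by omega)
    · rw [gap_succ, hdur]; exact hgap 2 (by omega)
    · rw [gap_succ, hdur]; exact hgap 3 (by omega)
    · rw [attemptedVelocity, show n + 2 - 1 = n + 1 by omega, stretchZ_eq]; exact hw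
  have hex : ∃ i, CanEnd w (stretchZ r w β₀ ω) i := ⟨_, hcan⟩
  set γ := Nat.find hex with hγ
  have hγn : γ ≤ n + 2 := Nat.find_min' hex hcan
  have hγc : CanEnd w (stretchZ r w β₀ ω) γ := Nat.find_spec hex
  refine ⟨γ, ⟨hγc, fun i hi => Nat.find_min' hex hi⟩, 1, one_pos, fun t htI => ?_⟩
  have hlast : 1 < (stretchZ r w β₀ ω γ).duration := by
    rw [← gap_succ]; exact hγc.2.2.2.1
  have hnn : ∀ i, 0 ≤ (stretchZ r w β₀ ω i).duration := fun i => by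
    rw [hdur]; exact zStream_fst_nonneg hω i
  refine path_congr (N := γ + 1) hnn (fun i => stretchX_duration_nonneg hω i)
    (fun i hi => (stretchX_eq ht hm (by omega)).1)
    (fun i hi => (stretchX_eq ht hm (by omega)).2) htI.1 ?_
  rw [attemptTime, Finset.sum_range_succ, ← attemptTime]
  linarith [htI.2]

open scoped ENNReal

/-! ### Product measures -/

section Product

variable {ι : Type*} {X : ι → Type*} [∀ i, MeasurableSpace (X i)] (μ : (i : ι) → Measure (X i))
  [∀ i, IsProbabilityMeasure (μ i)]

/-- Replacing one coordinate by an independent copy does not change a product measure. -/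
theorem measurePreserving_update [DecidableEq ι] (i₀ : ι) :
    MeasurePreserving (fun p : ((i : ι) → X i) × X i₀ => Function.update p.1 i₀ p.2)
      ((Measure.infinitePi μ).prod (μ i₀)) (Measure.infinitePi μ) := by
  have hmeas : Measurable fun p : ((i : ι) → X i) × X i₀ => Function.update p.1 i₀ p.2 :=
    measurable_update'.comp measurable_id
  refine ⟨hmeas, Measure.eq_infinitePi μ fun s t ht => ?_⟩
  rw [Measure.map_apply hmeas (.pi s.countable_toSet fun i _ => ht i)]
  have : (fun p : ((i : ι) → X i) × X i₀ => Function.update p.1 i₀ p.2) ⁻¹' (s : Set ι).pi t =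
      ((s.erase i₀ : Finset ι) : Set ι).pi t ×ˢ (if i₀ ∈ s then t i₀ else Set.univ) := by
    ext ⟨x, y⟩
    simp only [Set.mem_preimage, Set.mem_pi, Finset.mem_coe, Set.mem_prod, Finset.mem_erase]
    constructor
    · intro h
      refine ⟨fun i hi => by simpa [hi.1] using h i hi.2, ?_⟩
      split_ifs with h0
      · simpa using h i₀ h0
      · trivial
    · rintro ⟨h1, h2⟩ i hi
      by_cases h : i = i₀
      · subst h
        rw [if_pos hi] at h2
        simpa using h2
      · simpa [h] using h1 i ⟨h, hi⟩
  rw [this, Measure.prod_prod, Measure.infinitePi_pi _ fun i _ => ht i]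
  split_ifs with h0
  · rw [← Finset.mul_prod_erase s _ h0, mul_comm]
  · rw [measure_univ, mul_one, Finset.erase_eq_of_notMem h0]

theorem measurePreserving_update_pi [Fintype ι] [DecidableEq ι] (i₀ : ι) :
    MeasurePreserving (fun p : ((i : ι) → X i) × X i₀ => Function.update p.1 i₀ p.2)
      ((Measure.pi μ).prod (μ i₀)) (Measure.pi μ) := by
  rw [← Measure.infinitePi_eq_pi]
  exact measurePreserving_update μ i₀

end Product

/-- Prepending an independent coordinate to a sequence of independent coordinates. -/
theorem measurePreserving_cons {X : Type*} [MeasurableSpace X] (μ : Measure X)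
    [IsProbabilityMeasure μ] :
    MeasurePreserving (fun (p : X × (ℕ → X)) (n : ℕ) => Nat.casesOn n p.1 p.2)
      (μ.prod (Measure.infinitePi fun _ => μ)) (Measure.infinitePi fun _ => μ) := by
  have h1 := (measurePreserving_update (fun _ : ℕ => μ) 0)
  have hshift : MeasurePreserving (fun (ω : ℕ → X) n => ω (n + 1))
      (Measure.infinitePi fun _ => μ) (Measure.infinitePi fun _ => μ) :=
    ⟨by fun_prop, Measure.map_infinitePi_infinitePi_of_inj (P := fun _ : ℕ => μ)
      (f := fun n : ℕ => n + 1) (add_left_injective 1)⟩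
  have hmeas : Measurable fun (p : X × (ℕ → X)) (n : ℕ) => (Nat.casesOn n p.1 p.2 : X) := by
    refine measurable_pi_lambda _ fun n => ?_
    cases n with
    | zero => exact measurable_fst
    | succ n => exact (measurable_pi_apply n).comp measurable_snd
  refine ⟨hmeas, ?_⟩
  have h2 := (MeasurePreserving.id μ).prod hshift
  have h3 : MeasurePreserving (Prod.swap : (ℕ → X) × X → X × (ℕ → X))
      ((Measure.infinitePi fun _ => μ).prod μ) (μ.prod (Measure.infinitePi fun _ => μ)) :=
    Measure.measurePreserving_swap
  have h4 := h2.comp h3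
  rw [← h4.map_eq, Measure.map_map hmeas h4.measurable]
  convert! h1.map_eq using 2
  funext p n
  cases n <;> simp [Function.update]

/-! ### The exponential law -/

/-- The standard exponential law. -/
noncomputable abbrev expLaw : Measure ℝ := expMeasure 1

theorem expLaw_eq : expLaw = volume.withDensity (exponentialPDF 1) := rfl

theorem measurable_exponentialPDF : Measurable (exponentialPDF 1) :=
  (measurable_exponentialPDFReal 1).ennreal_ofReal

theorem exponentialPDF_le_one (x : ℝ) : exponentialPDF 1 x ≤ 1 := by
  rw [exponentialPDF_eq, ENNReal.ofReal_le_one]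
  split_ifs with h
  · simpa using h
  · exact zero_le_one

theorem expLaw_le_volume (s : Set ℝ) : expLaw s ≤ volume s := by
  have : expLaw ≤ volume := by
    rw [expLaw_eq]
    refine (withDensity_mono (g := 1) (.of_forall exponentialPDF_le_one)).trans ?_
    rw [withDensity_one]
  exact this s

theorem expLaw_Iic_zero : expLaw (Set.Iic 0) = 0 := by
  rw [expLaw_eq, withDensity_apply _ measurableSet_Iic, setLIntegral_congr Iio_ae_eq_Iic.symm,
    lintegral_exponentialPDF_of_nonpos le_rfl]

theorem ae_expLaw_pos : ∀ᵐ t ∂expLaw, 0 < t := by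
  rw [ae_iff]
  simp only [not_lt]
  exact expLaw_Iic_zero

theorem expLaw_Iic_le (c : ℝ) : expLaw (Set.Iic c) ≤ ENNReal.ofReal c := by
  calc expLaw (Set.Iic c) ≤ expLaw (Set.Iic 0 ∪ Set.Ioc 0 c) :=
        measure_mono fun x hx => by
          rcases le_or_gt x 0 with h | h
          · exact Or.inl h
          · exact Or.inr ⟨h, hx⟩
    _ ≤ expLaw (Set.Iic 0) + expLaw (Set.Ioc 0 c) := measure_union_le _ _
    _ ≤ 0 + volume (Set.Ioc 0 c) := add_le_add expLaw_Iic_zero.le (expLaw_le_volume _)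
    _ = ENNReal.ofReal c := by rw [zero_add, Real.volume_Ioc, sub_zero]

theorem expLaw_abs_le {α β κ : ℝ} (hα : 1 ≤ |α|) :
    expLaw {t | |α * t + β| ≤ κ} ≤ ENNReal.ofReal (2 * κ) := by
  have hα0 : α ≠ 0 := by
    rintro rfl
    norm_num at hα
  refine (measure_mono (t := Set.Icc (-(β / α) - κ) (-(β / α) + κ)) fun t ht => ?_).trans ?_
  · have h1 : |t + β / α| ≤ κ := by
      have : α * t + β = α * (t + β / α) := by field_simp
      have ht : |α * t + β| ≤ κ := ht
      rw [this, abs_mul] at ht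
      nlinarith [abs_nonneg (t + β / α)]
    rw [abs_le] at h1
    constructor <;> linarith
  · refine (expLaw_le_volume _).trans ?_
    rw [Real.volume_Icc]
    exact ENNReal.ofReal_le_ofReal (by linarith)

/-- The lack of memory of the exponential law. -/
theorem lintegral_expLaw_sub {f : ℝ → ℝ≥0∞} (hf : Measurable f) {t : ℝ} (ht : 0 ≤ t) :
    ∫⁻ s, (Set.Ici t).indicator (fun s => f (s - t)) s ∂expLaw
      = ENNReal.ofReal (Real.exp (-t)) * ∫⁻ s, f s ∂expLaw := by
  have hm : Measurable ((Set.Ici t).indicator fun s => f (s - t)) :=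
    (hf.comp (measurable_id.sub_const t)).indicator measurableSet_Ici
  rw [expLaw_eq, lintegral_withDensity_eq_lintegral_mul _ measurable_exponentialPDF hm,
    lintegral_withDensity_eq_lintegral_mul _ measurable_exponentialPDF hf,
    ← lintegral_const_mul _ (measurable_exponentialPDF.mul hf),
    ← lintegral_add_right_eq_self _ t]
  refine lintegral_congr fun s => ?_
  simp only [Pi.mul_apply]
  rcases lt_or_ge s 0 with hs | hs
  · rw [exponentialPDF_of_neg hs, Set.indicator_of_notMem (by simpa using hs)]
    simp
  · rw [exponentialPDF_of_nonneg hs, exponentialPDF_of_nonneg (by linarith),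
      Set.indicator_of_mem (by simpa using hs), add_sub_cancel_right, ← mul_assoc,
      ← ENNReal.ofReal_mul (Real.exp_nonneg _), one_mul, one_mul, one_mul, one_mul, ← Real.exp_add,
      neg_add, add_comm]

theorem expLaw_Ici {t : ℝ} (ht : 0 ≤ t) :
    expLaw (Set.Ici t) = ENNReal.ofReal (Real.exp (-t)) := by
  have := lintegral_expLaw_sub (f := 1) measurable_one ht
  simp only [Pi.one_apply, lintegral_one, measure_univ, mul_one] at this
  rw [← this]
  exact (lintegral_indicator_one measurableSet_Ici).symm

theorem expLaw_singleton (t : ℝ) : expLaw {t} = 0 :=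
  le_antisymm ((expLaw_le_volume _).trans (by simp)) bot_le

theorem expLaw_Iic_add_Ici (t : ℝ) : expLaw (Set.Iic t) + expLaw (Set.Ici t) = 1 := by
  rw [← Set.Ioi_union_left, measure_union (by simp) (measurableSet_singleton t),
    expLaw_singleton, add_zero, ← measure_union (by
      rw [Set.disjoint_left]; intro x hx; simpa using hx) measurableSet_Ioi,
    Set.Iic_union_Ioi, measure_univ]

/-- The gaps of a process which attempts at the time `ζ` and the times `ξ₁`, `ξ₁ + ξ₂` if
`ζ ≤ ξ₁`, and only at the time `ξ₁ + ξ₂` otherwise, are independent exponential times. -/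
theorem lintegral_expLaw_interlaced {f₀ f₁ f₂ : ℝ → ℝ≥0∞} (h₀ : Measurable f₀)
    (h₁ : Measurable f₁) (h₂ : Measurable f₂) :
    ∫⁻ s, ∫⁻ t, ∫⁻ u, (if s ≤ t then f₀ s * f₁ (t - s) * f₂ u
        else f₀ (t + u) * (∫⁻ x, f₁ x ∂expLaw) * ∫⁻ x, f₂ x ∂expLaw)
        ∂expLaw ∂expLaw ∂expLaw
      = (∫⁻ x, f₀ x ∂expLaw) * (∫⁻ x, f₁ x ∂expLaw) * ∫⁻ x, f₂ x ∂expLaw := by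
  set F₁ := ∫⁻ x, f₁ x ∂expLaw with hF₁
  set F₂ := ∫⁻ x, f₂ x ∂expLaw with hF₂
  have hm2 : Measurable fun p : ℝ × ℝ => ∫⁻ u, f₀ (p.2 + u) ∂expLaw :=
    Measurable.lintegral_prod_right' (f := fun p : (ℝ × ℝ) × ℝ => f₀ (p.1.2 + p.2))
      (h₀.comp (by fun_prop))
  have hm2' : Measurable fun t : ℝ => ∫⁻ u, f₀ (t + u) ∂expLaw :=
    Measurable.lintegral_prod_right' (f := fun p : ℝ × ℝ => f₀ (p.1 + p.2)) (h₀.comp (by fun_prop))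
  -- the inner integral over `u`
  have e1 : ∀ s t, ∫⁻ u, (if s ≤ t then f₀ s * f₁ (t - s) * f₂ u
        else f₀ (t + u) * F₁ * F₂) ∂expLaw =
      (f₀ s * F₂) * (Set.Ici s).indicator (fun t => f₁ (t - s)) t +
        (if s ≤ t then 0 else (∫⁻ u, f₀ (t + u) ∂expLaw)) * (F₁ * F₂) := by
    intro s t
    by_cases hst : s ≤ t
    · simp only [if_pos hst, Set.indicator_of_mem (show t ∈ Set.Ici s from hst), zero_mul, add_zero]
      rw [lintegral_const_mul _ h₂, ← hF₂]
      ring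
    · simp only [if_neg hst, Set.indicator_of_notMem (show t ∉ Set.Ici s from hst), mul_zero,
        zero_add, mul_assoc]
      have hm : Measurable fun u => f₀ (t + u) := h₀.comp (measurable_const_add t)
      rw [lintegral_mul_const _ hm]
  simp only [e1]
  have hmA : Measurable fun p : ℝ × ℝ =>
      (Set.Ici p.1).indicator (fun t => f₁ (t - p.1)) p.2 := by
    have : (fun p : ℝ × ℝ => (Set.Ici p.1).indicator (fun t => f₁ (t - p.1)) p.2) =
        {p : ℝ × ℝ | p.1 ≤ p.2}.indicator fun p => f₁ (p.2 - p.1) := by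
      ext p
      simp only [Set.indicator, Set.mem_Ici, Set.mem_ofPred_eq]
    rw [this]
    exact (h₁.comp (by fun_prop)).indicator (measurableSet_le measurable_fst measurable_snd)
  have hmB : Measurable fun p : ℝ × ℝ =>
      (if p.1 ≤ p.2 then 0 else (∫⁻ u, f₀ (p.2 + u) ∂expLaw)) :=
    Measurable.ite (measurableSet_le measurable_fst measurable_snd) measurable_const hm2
  have hmAs : ∀ s : ℝ, Measurable fun t : ℝ => (Set.Ici s).indicator (fun t => f₁ (t - s)) t :=
    fun s => hmA.comp measurable_prodMk_left
  have hmBs : ∀ s : ℝ, Measurable fun t : ℝ =>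
      (if s ≤ t then 0 else (∫⁻ u, f₀ (t + u) ∂expLaw)) := fun s =>
    hmB.comp (measurable_prodMk_left (x := s))
  have e2 : ∀ s, ∫⁻ t, ((f₀ s * F₂) * (Set.Ici s).indicator (fun t => f₁ (t - s)) t +
        (if s ≤ t then 0 else (∫⁻ u, f₀ (t + u) ∂expLaw)) * (F₁ * F₂)) ∂expLaw =
      (f₀ s * F₂) * ∫⁻ t, (Set.Ici s).indicator (fun t => f₁ (t - s)) t ∂expLaw +
        (∫⁻ t, (if s ≤ t then 0 else (∫⁻ u, f₀ (t + u) ∂expLaw)) ∂expLaw) * (F₁ * F₂) := by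
    intro s
    rw [lintegral_add_left ((hmAs s).const_mul _), lintegral_const_mul _ (hmAs s),
      lintegral_mul_const _ (hmBs s)]
  simp only [e2]
  have hmA' : Measurable fun s : ℝ =>
      ∫⁻ t, (Set.Ici s).indicator (fun t => f₁ (t - s)) t ∂expLaw := hmA.lintegral_prod_right'
  have hmB' : Measurable fun s : ℝ =>
      ∫⁻ t, (if s ≤ t then 0 else (∫⁻ u, f₀ (t + u) ∂expLaw)) ∂expLaw := hmB.lintegral_prod_right'
  have hmC : Measurable fun s : ℝ =>
      f₀ s * F₂ * ∫⁻ t, (Set.Ici s).indicator (fun t => f₁ (t - s)) t ∂expLaw :=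
    (h₀.mul_const _).mul hmA'
  rw [lintegral_add_left hmC, lintegral_mul_const _ hmB']
  -- the first summand
  have e3 : ∫⁻ s, f₀ s * F₂ * ∫⁻ t, (Set.Ici s).indicator (fun t => f₁ (t - s)) t ∂expLaw ∂expLaw =
      (∫⁻ s, f₀ s * expLaw (Set.Ici s) ∂expLaw) * (F₁ * F₂) := by
    have hmI : Measurable fun s : ℝ => expLaw (Set.Ici s) := by
      have : Antitone fun s : ℝ => expLaw (Set.Ici s) := fun a b h =>
        measure_mono (Set.Ici_subset_Ici.2 h)
      exact this.measurable
    have hmX : Measurable fun s => f₀ s * expLaw (Set.Ici s) := h₀.mul hmI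
    rw [← lintegral_mul_const _ hmX]
    refine lintegral_congr_ae ?_
    filter_upwards [ae_expLaw_pos] with s hs
    rw [lintegral_expLaw_sub h₁ hs.le, expLaw_Ici hs.le]
    ring
  -- the second summand
  have e4 : ∫⁻ s, ∫⁻ t, (if s ≤ t then 0 else (∫⁻ u, f₀ (t + u) ∂expLaw)) ∂expLaw ∂expLaw =
      ∫⁻ s, f₀ s * expLaw (Set.Iic s) ∂expLaw := by
    rw [lintegral_lintegral_swap hmB.aemeasurable]
    have e5 : ∀ t : ℝ, ∫⁻ s, (if s ≤ t then 0 else (∫⁻ u, f₀ (t + u) ∂expLaw)) ∂expLaw =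
        expLaw (Set.Ioi t) * ∫⁻ u, f₀ (t + u) ∂expLaw := by
      intro t
      have : (fun s => if s ≤ t then 0 else (∫⁻ u, f₀ (t + u) ∂expLaw)) =
          (Set.Ioi t).indicator fun _ => ∫⁻ u, f₀ (t + u) ∂expLaw := by
        ext s
        simp only [Set.indicator, Set.mem_Ioi]
        by_cases h : s ≤ t
        · rw [if_pos h, if_neg h.not_gt]
        · rw [if_neg h, if_pos (not_le.1 h)]
      rw [this, lintegral_indicator_const measurableSet_Ioi, mul_comm]
    simp only [e5]
    have e6 : ∫⁻ t, expLaw (Set.Ioi t) * ∫⁻ u, f₀ (t + u) ∂expLaw ∂expLaw =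
        ∫⁻ t, ∫⁻ s, (Set.Ici t).indicator f₀ s ∂expLaw ∂expLaw := by
      refine lintegral_congr_ae ?_
      filter_upwards [ae_expLaw_pos] with t ht
      have h := lintegral_expLaw_sub (f := fun u => f₀ (t + u))
        (h₀.comp (measurable_const_add t)) ht.le
      simp only [add_sub_cancel] at h
      have h7 : expLaw (Set.Ioi t) = expLaw (Set.Ici t) := by
        rw [← Set.Ioi_union_left, measure_union (by simp) (measurableSet_singleton t),
          expLaw_singleton, add_zero]
      rw [h, h7, expLaw_Ici ht.le]
    rw [e6, lintegral_lintegral_swap]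
    · refine lintegral_congr fun s => ?_
      have : (fun t => (Set.Ici t).indicator f₀ s) = (Set.Iic s).indicator fun _ => f₀ s := by
        ext t
        simp only [Set.indicator, Set.mem_Ici, Set.mem_Iic]
      rw [this, lintegral_indicator_const measurableSet_Iic]
    · have : (Function.uncurry fun t s => (Set.Ici t).indicator f₀ s) =
          {p : ℝ × ℝ | p.1 ≤ p.2}.indicator fun p => f₀ p.2 := by
        ext p
        simp only [Function.uncurry, Set.indicator, Set.mem_Ici, Set.mem_ofPred_eq]
      rw [this]
      exact ((h₀.comp measurable_snd).indicator
        (measurableSet_le measurable_fst measurable_snd)).aemeasurable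
  have hmJ : Measurable fun s : ℝ => expLaw (Set.Ici s) := by
    have : Antitone fun s : ℝ => expLaw (Set.Ici s) := fun a b h =>
      measure_mono (Set.Ici_subset_Ici.2 h)
    exact this.measurable
  have hmY : Measurable fun s => f₀ s * expLaw (Set.Ici s) := h₀.mul hmJ
  rw [e3, e4, ← add_mul, ← lintegral_add_left hmY, mul_assoc]
  congr 2
  funext s
  rw [← mul_add, add_comm, expLaw_Iic_add_Ici, mul_one]

/-! ### Measurability of an autonomous process -/

@[fun_prop]
theorem Noise.measurable_clock (i : Fin 3) : Measurable fun η : Noise => η.clock i :=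
  (measurable_pi_apply i).comp measurable_fst

@[fun_prop]
theorem Noise.measurable_markY (i : Fin 3) : Measurable fun η : Noise => η.markY i :=
  (measurable_pi_apply i).comp (measurable_fst.comp measurable_snd)

@[fun_prop]
theorem Noise.measurable_markZ (i : Fin 3) : Measurable fun η : Noise => η.markZ i :=
  (measurable_pi_apply i).comp (measurable_fst.comp (measurable_snd.comp measurable_snd))

/-- A family of measurable functions may be evaluated along a measurable parameter with finitely
many values. -/
theorem measurable_of_finite_parameter {κ α X : Type*} [Countable κ] [MeasurableSpace κ]
    [MeasurableSingletonClass κ] [MeasurableSpace α] [MeasurableSpace X] {f : κ → α → X}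
    (hf : ∀ c, Measurable (f c)) {k : α → κ} (hk : Measurable k) :
    Measurable fun a => f (k a) a :=
  (measurable_from_prod_countable_left (f := fun x : α × κ => f x.2 x.1) hf).comp
    (measurable_id.prodMk hk)

namespace Machine

variable {σ : Type*} (M : Machine σ)

/-- A machine is autonomous if its velocities depend neither on the gaps between the attempts nor
on the positions of the obstacles. -/
structure Autonomous : Prop where
  before_eq : ∀ s T T', M.before s T = M.before s T'
  attempt_eq : ∀ s T T' m m', m.1 = m'.1 → M.attempt s T m = M.attempt s T' m'

variable {M}

theorem Autonomous.measurable_mark (hM : M.Autonomous) (u : Space) (s : σ)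
    (a : Fin 3 × (Noise → ℝ)) :
    Measurable fun η => M.mark u η s (a.1, a.2 η) := by
  have : (fun η => M.mark u η s (a.1, a.2 η)) = fun η =>
      (fun (c : Fin 3) (η : Noise) => open Classical in
        if a.1 ≠ 0 ∧ M.before s 0 = (if a.1 = 2 then signFlip c u else u) then η.markY a.1
        else η.markZ a.1) (η.markY 1).1 η := by
    funext η
    simp only [mark, velocityY, newVelocity, hM.before_eq s _ 0]
  rw [this]
  refine measurable_of_finite_parameter (f := fun (c : Fin 3) (η : Noise) => open Classical in
        if a.1 ≠ 0 ∧ M.before s 0 = (if a.1 = 2 then signFlip c u else u) then η.markY a.1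
        else η.markZ a.1) (fun c => ?_) (measurable_fst.comp (Noise.measurable_markY 1))
  split_ifs <;> fun_prop

theorem Autonomous.attempt_eq_zero (hM : M.Autonomous) (s : σ) (T : ℝ) (m : Mark) :
    M.attempt s T m = M.attempt s 0 (m.1, 0) := hM.attempt_eq s _ _ _ _ rfl

theorem Autonomous.measurable_feed (hM : M.Autonomous) (u : Space) (L : List (Fin 3 × (Noise → ℝ)))
    (hL : ∀ a ∈ L, Measurable a.2) (d : ℝ × Mark) (s : σ) (i : ℕ) :
    Measurable fun η => (M.feed u η (L.map fun a => (a.1, a.2 η)) s).getD i d := by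
  induction L generalizing s i with
  | nil => simp [feed]
  | cons a L ih =>
    have hm := hM.measurable_mark u s a
    cases i with
    | zero =>
      simpa [feed] using (hL a (by simp)).prodMk hm
    | succ i =>
      simp only [List.map_cons, feed, List.getD_cons_succ]
      simp only [hM.attempt_eq_zero s (a.2 _)]
      exact measurable_of_finite_parameter
        (f := fun c η => (M.feed u η (L.map fun a => (a.1, a.2 η))
          (M.attempt s 0 (c, 0))).getD i d)
        (fun c => ih (fun a ha => hL a (by simp [ha])) _ i) (measurable_fst.comp hm)

/-- The state after some attempts takes only countably many values, so that no measurable structure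
on the states is required. -/
theorem Autonomous.measurable_comp_foldl (hM : M.Autonomous) {α X : Type*} [MeasurableSpace α]
    [MeasurableSpace X] {π : α → Noise} (hπ : Measurable π) {G : σ → α → X}
    (hG : ∀ s, Measurable (G s)) (u : Space)
    (L : List (Fin 3 × (Noise → ℝ))) (s : σ) :
    Measurable fun a => G ((M.feed u (π a) (L.map fun b => (b.1, b.2 (π a))) s).foldl
      (fun s d => M.attempt s d.1 d.2) s) a := by
  induction L generalizing s with
  | nil => exact hG s
  | cons b L ih =>
    simp only [List.map_cons, feed, List.foldl_cons]
    simp only [hM.attempt_eq_zero s (b.2 _)]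
    exact measurable_of_finite_parameter
      (f := fun c a => G ((M.feed u (π a) (L.map fun b => (b.1, b.2 (π a)))
          (M.attempt s 0 (c, 0))).foldl
            (fun s d => M.attempt s d.1 d.2) (M.attempt s 0 (c, 0))) a)
      (fun c => ih _) (measurable_fst.comp ((hM.measurable_mark u s b).comp hπ))

theorem schedule_eq (P : Prop) (η : Noise) : open Classical in schedule P η =
    (if P then [(1, fun η : Noise => η.clock 1), (2, fun η => η.clock 2)]
    else if η.clock 0 ≤ η.clock 1 then [(0, fun η => η.clock 0),
      (1, fun η => η.clock 1 - η.clock 0), (2, fun η => η.clock 2)]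
    else [(2, fun η => η.clock 1 + η.clock 2)]).map fun a => (a.1, a.2 η) := by
  unfold schedule
  split_ifs <;> simp

theorem measurableSet_clock_le : MeasurableSet {η : Noise | η.clock 0 ≤ η.clock 1} :=
  measurableSet_le (by fun_prop) (by fun_prop)

theorem measurable_length_block (M : Machine σ) (s : σ × Space) :
    Measurable fun η => (M.block s η).length := by
  classical
  simp only [length_block, schedule_eq, List.length_map]
  by_cases hP : SameParity s.2 (M.after s.1)
  · simp only [hP, if_true]
    exact measurable_const
  · simp only [hP, if_false, apply_ite List.length]
    exact Measurable.ite measurableSet_clock_le measurable_const measurable_const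

theorem Autonomous.measurable_block (hM : M.Autonomous) (s : σ × Space) (d : ℝ × Mark) (i : ℕ) :
    Measurable fun η => (M.block s η).getD i d := by
  classical
  simp only [block, schedule_eq]
  by_cases hP : SameParity s.2 (M.after s.1)
  · simp only [hP, if_true]
    refine hM.measurable_feed s.2 _ ?_ d s.1 i
    simp only [List.mem_cons, List.not_mem_nil, or_false]
    rintro a (rfl | rfl) <;> fun_prop
  · simp only [hP, if_false]
    have : (fun η : Noise => (M.feed s.2 η ((if η.clock 0 ≤ η.clock 1 then
        [((0 : Fin 3), fun η : Noise => η.clock 0), (1, fun η => η.clock 1 - η.clock 0),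
          (2, fun η => η.clock 2)]
        else [(2, fun η => η.clock 1 + η.clock 2)]).map fun a => (a.1, a.2 η)) s.1).getD i d) =
      fun η => if η.clock 0 ≤ η.clock 1 then
        (M.feed s.2 η ([((0 : Fin 3), fun η : Noise => η.clock 0),
          (1, fun η => η.clock 1 - η.clock 0),
          (2, fun η => η.clock 2)].map fun a => (a.1, a.2 η)) s.1).getD i d
        else (M.feed s.2 η ([((2 : Fin 3), fun η : Noise => η.clock 1 + η.clock 2)].map
          fun a => (a.1, a.2 η)) s.1).getD i d := by
      funext η
      split_ifs <;> rfl
    rw [this]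
    refine Measurable.ite (measurableSet_clock_le) (hM.measurable_feed s.2 _ ?_ d s.1 i)
      (hM.measurable_feed s.2 _ ?_ d s.1 i)
    · simp only [List.mem_cons, List.not_mem_nil, or_false]
      rintro a (rfl | rfl | rfl) <;> fun_prop
    · simp only [List.mem_cons, List.not_mem_nil, or_false]
      rintro a rfl
      fun_prop

theorem Autonomous.measurable_comp_next (hM : M.Autonomous) {α X : Type*} [MeasurableSpace α]
    [MeasurableSpace X] {π : α → Noise} (hπ : Measurable π) {G : σ × Space → α → X}
    (hG : ∀ s, Measurable (G s)) (s : σ × Space) : Measurable fun a => G (M.next s (π a)) a := by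
  classical
  have hG' : ∀ s', Measurable fun a => G (s', newVelocity ((π a).markY 2)
      (newVelocity ((π a).markY 1) s.2)) a := fun s' => by
    refine measurable_of_finite_parameter
      (f := fun (c : Fin 3 × Fin 3) a => G (s', signFlip c.1 (signFlip c.2 s.2)) a)
      (k := fun a => (((π a).markY 2).1, ((π a).markY 1).1)) (fun c => hG _) ?_
    exact (measurable_fst.comp ((Noise.measurable_markY 2).comp hπ)).prodMk
      (measurable_fst.comp ((Noise.measurable_markY 1).comp hπ))
  have key := fun L => hM.measurable_comp_foldl hπ hG' s.2 L s.1
  simp only [next, block, schedule_eq]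
  by_cases hP : SameParity s.2 (M.after s.1)
  · simp only [hP, if_true]
    exact key _
  · simp only [hP, if_false]
    have h := @Measurable.ite _ _ _ _ _ _ _ (Classical.decPred _)
      (hπ measurableSet_clock_le)
      (key [((0 : Fin 3), fun η : Noise => η.clock 0), (1, fun η => η.clock 1 - η.clock 0),
          (2, fun η => η.clock 2)]) (key [(2, fun η => η.clock 1 + η.clock 2)])
    convert! h using 2 with a
    by_cases h : (π a).clock 0 ≤ (π a).clock 1 <;> simp [h]

theorem Autonomous.measurable_stream_apply (hM : M.Autonomous) (s : σ × Space) (i : ℕ) :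
    Measurable fun ω => M.stream s ω i := by
  classical
  induction i using Nat.strong_induction_on generalizing s with
  | _ i ih =>
  have h0 : Measurable fun ω : ℕ → Noise => ω 0 := measurable_pi_apply 0
  have hsh : Measurable fun (ω : ℕ → Noise) n => ω (n + 1) := by fun_prop
  have hlen := (M.measurable_length_block s).comp h0
  have hnext : Measurable fun ω : ℕ → Noise => (fun (L : ℕ) (ω : ℕ → Noise) =>
      if 0 < L ∧ L ≤ i then M.stream (M.next s (ω 0)) (fun n => ω (n + 1)) (i - L)
      else (M.block s (ω 0)).getD i (0, 0, 0)) (M.block s (ω 0)).length ω := by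
    refine measurable_of_finite_parameter (f := fun (L : ℕ) (ω : ℕ → Noise) =>
      if 0 < L ∧ L ≤ i then M.stream (M.next s (ω 0)) (fun n => ω (n + 1)) (i - L)
      else (M.block s (ω 0)).getD i (0, 0, 0)) (fun L => ?_) hlen
    split_ifs with h
    · exact hM.measurable_comp_next h0
        (G := fun s' ω => M.stream s' (fun n => ω (n + 1)) (i - L))
        (fun s' => (ih (i - L) (by omega) s').comp hsh) s
    · exact (hM.measurable_block s (0, 0, 0) i).comp h0
  convert! hnext using 2 with ω
  have hpos := M.length_block_pos s (ω 0)
  simp only [hpos, true_and]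
  split_ifs with h
  · rw [← M.stream_length_add, Nat.add_sub_cancel' h]
  · rw [List.getD_eq_getElem?_getD, M.block_getElem? s ω (not_le.1 h)]
    rfl

end Machine

/-! ### Choices between independent copies -/

section Product

variable {ι : Type*} [Fintype ι] [DecidableEq ι] {X : Type*} [MeasurableSpace X]
  (μ : Measure X) [IsProbabilityMeasure μ]

theorem lintegral_pi_update {f : (ι → X) → ℝ≥0∞} (hf : Measurable f) (i : ι) :
    ∫⁻ x, f x ∂(Measure.pi fun _ => μ) =
      ∫⁻ x, ∫⁻ y, f (Function.update x i y) ∂μ ∂(Measure.pi fun _ => μ) := by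
  have h := measurePreserving_update_pi (fun _ : ι => μ) i
  rw [← h.lintegral_comp hf,
    lintegral_prod (fun p => f (Function.update p.1 i p.2)) (hf.comp h.measurable).aemeasurable]

theorem lintegral_pi_mul_indicator {f : (ι → X) → ℝ≥0∞} (hf : Measurable f) {i : ι}
    (hi : ∀ x y, f (Function.update x i y) = f x) {B : Set X} (hB : MeasurableSet B) :
    ∫⁻ x, f x * B.indicator 1 (x i) ∂(Measure.pi fun _ => μ) =
      (∫⁻ x, f x ∂(Measure.pi fun _ => μ)) * μ B := by
  have hB' : Measurable (B.indicator (1 : X → ℝ≥0∞)) := measurable_one.indicator hB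
  rw [lintegral_pi_update μ (f := fun x => f x * B.indicator 1 (x i))
    (hf.mul (hB'.comp (measurable_pi_apply i))) i]
  simp only [hi, Function.update_self]
  rw [← lintegral_mul_const _ hf]
  refine lintegral_congr fun x => ?_
  rw [lintegral_const_mul _ hB', lintegral_indicator_one hB]

theorem lintegral_pi_three {f : ℝ → ℝ → ℝ → ℝ≥0∞}
    (hf : Measurable fun p : ℝ × ℝ × ℝ => f p.1 p.2.1 p.2.2) (μ : Measure ℝ)
    [IsProbabilityMeasure μ] :
    ∫⁻ x : Fin 3 → ℝ, f (x 0) (x 1) (x 2) ∂(Measure.pi fun _ => μ) =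
      ∫⁻ s, ∫⁻ t, ∫⁻ u, f s t u ∂μ ∂μ ∂μ := by
  have h2 : Measurable fun p : ℝ × ℝ => ∫⁻ u, f p.1 p.2 u ∂μ :=
    Measurable.lintegral_prod_right' (f := fun p : (ℝ × ℝ) × ℝ => f p.1.1 p.1.2 p.2)
      (hf.comp (by fun_prop : Measurable fun p : (ℝ × ℝ) × ℝ => (p.1.1, p.1.2, p.2)))
  have h1 : Measurable fun s : ℝ => ∫⁻ t, ∫⁻ u, f s t u ∂μ ∂μ :=
    Measurable.lintegral_prod_right' (f := fun p : ℝ × ℝ => ∫⁻ u, f p.1 p.2 u ∂μ) h2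
  rw [lintegral_pi_update μ (f := fun x : Fin 3 → ℝ => f (x 0) (x 1) (x 2))
    (hf.comp (by fun_prop : Measurable fun x : Fin 3 → ℝ => (x 0, x 1, x 2))) 2]
  simp only [Function.update_self, Function.update_of_ne (show (0 : Fin 3) ≠ 2 by decide),
    Function.update_of_ne (show (1 : Fin 3) ≠ 2 by decide)]
  rw [lintegral_pi_update μ (f := fun x : Fin 3 → ℝ => ∫⁻ u, f (x 0) (x 1) u ∂μ)
    (h2.comp (by fun_prop : Measurable fun x : Fin 3 → ℝ => (x 0, x 1))) 1]
  simp only [Function.update_self, Function.update_of_ne (show (0 : Fin 3) ≠ 1 by decide)]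
  rw [lintegral_pi_update μ (f := fun x : Fin 3 → ℝ => ∫⁻ t, ∫⁻ u, f (x 0) t u ∂μ ∂μ)
    (h1.comp (measurable_pi_apply 0)) 0]
  simp only [Function.update_self, lintegral_const, measure_univ, mul_one]

/-- Of two independent families one entry with a common index is chosen, according to the other
entries. The chosen entry is independent of the other entries, and has the common law. -/
theorem lintegral_prod_mul_indicator_ite {f : (ι → X) × (ι → X) → ℝ≥0∞} (hf : Measurable f)
    {D : Set ((ι → X) × (ι → X))} (hD : MeasurableSet D) [DecidablePred (· ∈ D)] {i : ι}
    (hi : ∀ x, ∀ y : X × X, f (Function.update x.1 i y.1, Function.update x.2 i y.2) = f x)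
    (hDi : ∀ x, ∀ y : X × X, (Function.update x.1 i y.1, Function.update x.2 i y.2) ∈ D ↔ x ∈ D)
    {B : Set X} (hB : MeasurableSet B) :
    ∫⁻ x, f x * B.indicator 1 (if x ∈ D then x.1 i else x.2 i)
        ∂((Measure.pi fun _ => μ).prod (Measure.pi fun _ => μ)) =
      (∫⁻ x, f x ∂((Measure.pi fun _ => μ).prod (Measure.pi fun _ => μ))) * μ B := by
  set P : Measure (ι → X) := Measure.pi fun _ => μ
  have hB' : Measurable (B.indicator (1 : X → ℝ≥0∞)) := measurable_one.indicator hB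
  have hfst : ∀ F : (ι → X) × (ι → X) → ℝ≥0∞, Measurable F →
      (∀ x, ∀ y : X × X, F (Function.update x.1 i y.1, Function.update x.2 i y.2) = F x) →
      ∫⁻ x, F x * B.indicator 1 (x.1 i) ∂(P.prod P) = (∫⁻ x, F x ∂(P.prod P)) * μ B := by
    intro F hF hFi
    have hFB : Measurable fun x : (ι → X) × (ι → X) =>
        F x * B.indicator (1 : X → ℝ≥0∞) (x.1 i) :=
      hF.mul (hB'.comp ((measurable_pi_apply i).comp measurable_fst))
    rw [lintegral_prod _ hF.aemeasurable, lintegral_prod _ hFB.aemeasurable,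
      ← lintegral_pi_mul_indicator μ hF.lintegral_prod_right' (i := i) (fun x y => ?_) hB]
    · refine lintegral_congr fun y => ?_
      have hFy : Measurable fun z => F (y, z) := hF.comp measurable_prodMk_left
      exact lintegral_mul_const (B.indicator (1 : X → ℝ≥0∞) (y i)) hFy
    · refine lintegral_congr fun z => ?_
      have := hFi (x, z) (y, z i)
      simpa using this
  have hsnd : ∀ F : (ι → X) × (ι → X) → ℝ≥0∞, Measurable F →
      (∀ x, ∀ y : X × X, F (Function.update x.1 i y.1, Function.update x.2 i y.2) = F x) →
      ∫⁻ x, F x * B.indicator 1 (x.2 i) ∂(P.prod P) = (∫⁻ x, F x ∂(P.prod P)) * μ B := by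
    intro F hF hFi
    have hFB : Measurable fun x : (ι → X) × (ι → X) =>
        F x * B.indicator (1 : X → ℝ≥0∞) (x.2 i) :=
      hF.mul (hB'.comp ((measurable_pi_apply i).comp measurable_snd))
    rw [lintegral_prod _ hF.aemeasurable, lintegral_prod _ hFB.aemeasurable,
      ← lintegral_mul_const _ hF.lintegral_prod_right']
    refine lintegral_congr fun y => ?_
    refine lintegral_pi_mul_indicator μ (hF.comp measurable_prodMk_left) (fun x z => ?_) hB
    have := hFi (y, x) (y i, z)
    simpa using this
  have h1 := hfst (D.indicator f) (hf.indicator hD) (fun x y => by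
    by_cases hx : x ∈ D <;> simp [hx, hDi x y, hi])
  have h2 := hsnd (Dᶜ.indicator f) (hf.indicator hD.compl) (fun x y => by
    by_cases hx : x ∈ D <;> simp [hx, hDi x y, hi])
  have e : ∀ x, f x * B.indicator 1 (if x ∈ D then x.1 i else x.2 i) =
      D.indicator f x * B.indicator 1 (x.1 i) + Dᶜ.indicator f x * B.indicator 1 (x.2 i) := by
    intro x
    by_cases hx : x ∈ D <;> simp [hx]
  simp only [e]
  have hm : Measurable fun x : (ι → X) × (ι → X) =>
      D.indicator f x * B.indicator (1 : X → ℝ≥0∞) (x.1 i) :=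
    (hf.indicator hD).mul (hB'.comp ((measurable_pi_apply i).comp measurable_fst))
  rw [lintegral_add_left hm, h1, h2, ← add_mul,
    ← lintegral_add_left (hf.indicator hD)]
  congr 2
  funext x
  exact Set.indicator_self_add_compl_apply D f x

end Product

/-! ### The law of the gaps and marks of an autonomous process -/

namespace Machine

variable {σ : Type*} {M : Machine σ}

theorem feed_congr_noise (u : Space) {η η' : Noise} (l : List (Fin 3 × ℝ)) (s : σ)
    (h : ∀ a ∈ l, η.markY a.1 = η'.markY a.1 ∧ η.markZ a.1 = η'.markZ a.1 ∧
      velocityY u η a.1 = velocityY u η' a.1) : M.feed u η l s = M.feed u η' l s := by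
  induction l generalizing s with
  | nil => rfl
  | cons a l ih =>
    obtain ⟨h1, h2, h3⟩ := h a (by simp)
    have : M.mark u η s a = M.mark u η' s a := by simp only [mark, h1, h2, h3]
    rw [feed, feed, this, ih _ fun b hb => h b (by simp [hb])]

theorem feed_concat (u : Space) (η : Noise) (l : List (Fin 3 × ℝ)) (a : Fin 3 × ℝ) (s : σ) :
    M.feed u η (l ++ [a]) s = M.feed u η l s ++ [(a.2, M.mark u η
      ((M.feed u η l s).foldl (fun s d => M.attempt s d.1 d.2) s) a)] := by
  induction l generalizing s with
  | nil => rfl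
  | cons b l ih => simp [feed, ih]

theorem Autonomous.measurable_feed_marks (hM : M.Autonomous) (u : Space) (c : Fin 3 → ℝ)
    (x : Fin 3 → Mark) (s : σ) (d : ℝ × Mark) (l : List (Fin 3 × ℝ)) (i : ℕ) :
    Measurable fun y : (Fin 3 → Mark) × (Fin 3 → Mark) =>
      (M.feed u (c, y.1, y.2, x) l s).getD i d := by
  have hπ : Measurable fun y : (Fin 3 → Mark) × (Fin 3 → Mark) => ((c, y.1, y.2, x) : Noise) := by
    fun_prop
  have h2 := (hM.measurable_feed u
    (l.map fun a => ((a.1, fun _ => a.2) : Fin 3 × (Noise → ℝ))) (by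
      simp only [List.mem_map]
      rintro _ ⟨b, -, rfl⟩
      exact measurable_const) d s i).comp hπ
  convert! h2 using 2 with y
  simp [List.map_map, Function.comp_def]

/-- For given clocks the marks used in increasing slots are independent and have a common law:
whether the mark of the Markovian process or the own mark is used in a slot is decided by the marks
in the earlier slots. -/
theorem Autonomous.lintegral_feed (hM : M.Autonomous) (μ : Measure Mark) [IsProbabilityMeasure μ]
    (u : Space) (c : Fin 3 → ℝ) (x : Fin 3 → Mark) (s : σ) {B : ℕ → Set Mark}
    (hB : ∀ i, MeasurableSet (B i)) (d : ℝ × Mark) (l : List (Fin 3 × ℝ))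
    (hl : l.Pairwise fun a b => a.1 < b.1) :
    ∫⁻ y : (Fin 3 → Mark) × (Fin 3 → Mark), ∏ i ∈ Finset.range l.length, (B i).indicator 1
        ((M.feed u (c, y.1, y.2, x) l s).getD i d).2
          ∂((Measure.pi fun _ => μ).prod (Measure.pi fun _ => μ)) =
      ∏ i ∈ Finset.range l.length, μ (B i) := by
  classical
  have hπ : Measurable fun y : (Fin 3 → Mark) × (Fin 3 → Mark) => ((c, y.1, y.2, x) : Noise) := by
    fun_prop
  induction l using List.reverseRecOn with
  | nil => simp
  | append_singleton l a ih =>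
    have hla : ∀ b ∈ l, b.1 < a.1 := fun b hb => by
      rw [List.pairwise_append] at hl
      exact hl.2.2 b hb a (by simp)
    have hl' : l.Pairwise fun a b => a.1 < b.1 := by
      rw [List.pairwise_append] at hl
      exact hl.1
    have hlen : (l ++ [a]).length = l.length + 1 := by simp
    rw [hlen, Finset.prod_range_succ, ← ih hl']
    set f : (Fin 3 → Mark) × (Fin 3 → Mark) → ℝ≥0∞ := fun y =>
      ∏ i ∈ Finset.range l.length, (B i).indicator 1
        ((M.feed u (c, y.1, y.2, x) l s).getD i d).2 with hf
    set D : Set ((Fin 3 → Mark) × (Fin 3 → Mark)) := {y | a.1 ≠ 0 ∧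
      M.before ((M.feed u (c, y.1, y.2, x) l s).foldl (fun s d => M.attempt s d.1 d.2) s) 0 =
        velocityY u (c, y.1, y.2, x) a.1} with hDdef
    have hupd : ∀ y z : (Fin 3 → Mark) × (Fin 3 → Mark), ∀ v : Mark × Mark,
        M.feed u (c, Function.update y.1 a.1 v.1, Function.update y.2 a.1 v.2, x) l s =
          M.feed u (c, y.1, y.2, x) l s := fun y z v => by
      refine feed_congr_noise u l s fun b hb => ?_
      have hb := hla b hb
      refine ⟨Function.update_of_ne hb.ne _ _, Function.update_of_ne hb.ne _ _, ?_⟩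
      have : b.1 ≠ 2 := by
        rintro h
        rw [h] at hb
        revert hb
        generalize a.1 = t
        decide +revert
      simp [velocityY, this]
    have hL : (fun y : (Fin 3 → Mark) × (Fin 3 → Mark) => M.feed u (c, y.1, y.2, x) l s) =
        fun y => M.feed u (c, y.1, y.2, x)
          ((l.map fun a => ((a.1, fun _ => a.2) : Fin 3 × (Noise → ℝ))).map
            fun b => (b.1, b.2 (c, y.1, y.2, x))) s := by
      funext y
      simp [List.map_map, Function.comp_def]
    have hfm : Measurable f := by
      refine Finset.measurable_prod _ fun i _ => ?_
      have h1 := hM.measurable_feed_marks u c x s d l i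
      have hBi : Measurable ((B i).indicator (1 : Mark → ℝ≥0∞)) := measurable_one.indicator (hB i)
      exact hBi.comp (measurable_snd.comp h1)
    have hDm : MeasurableSet D := by
      have h1 : Measurable fun y => y ∈ D := by
        have h2 := hM.measurable_comp_foldl (X := Prop) hπ (G := fun s' y => a.1 ≠ 0 ∧
          M.before s' 0 = velocityY u (c, y.1, y.2, x) a.1) (fun s' => by
            have : (fun y : (Fin 3 → Mark) × (Fin 3 → Mark) => a.1 ≠ 0 ∧
              M.before s' 0 = velocityY u (c, y.1, y.2, x) a.1) = fun y =>
                (fun (k : Fin 3) (_ : (Fin 3 → Mark) × (Fin 3 → Mark)) => a.1 ≠ 0 ∧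
                  M.before s' 0 = if a.1 = 2 then signFlip k u else u) (y.1 1).1 y := rfl
            rw [this]
            exact measurable_of_finite_parameter (f := (fun (k : Fin 3)
              (_ : (Fin 3 → Mark) × (Fin 3 → Mark)) => a.1 ≠ 0 ∧
                  M.before s' 0 = if a.1 = 2 then signFlip k u else u))
              (fun k => measurable_const) (by fun_prop)) u
            (l.map fun a => ((a.1, fun _ => a.2) : Fin 3 × (Noise → ℝ))) s
        convert! h2 using 2 with y
        rw [← congrFun hL y]
        rfl
      exact measurableSet_setOfPred.2 h1
    -- the slot of the last attempt plays no role before it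
    rw [← lintegral_prod_mul_indicator_ite μ hfm hDm (i := a.1) (fun y v => ?_) (fun y v => ?_)
      (hB l.length)]
    · refine lintegral_congr fun y => ?_
      rw [Finset.prod_range_succ, feed_concat]
      have hln : (M.feed u (c, y.1, y.2, x) l s).length = l.length := M.length_feed ..
      congr 1
      · refine Finset.prod_congr rfl fun i hi => ?_
        rw [List.getD_append _ _ _ _ (by rw [hln]; exact Finset.mem_range.1 hi)]
      · rw [List.getD_append_right _ _ _ _ (by rw [hln]), hln, Nat.sub_self]
        simp only [List.getD_cons_zero, mark, hM.before_eq _ a.2 0]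
        rfl
    · simp only [hf]
      refine Finset.prod_congr rfl fun i _ => ?_
      rw [hupd y y v]
    · simp only [hDdef, Set.mem_ofPred_eq]
      rw [hupd y y v]
      have : velocityY u (c, Function.update y.1 a.1 v.1, Function.update y.2 a.1 v.2, x) a.1 =
          velocityY u (c, y.1, y.2, x) a.1 := by
        unfold velocityY
        split_ifs with h
        · rw [h]
          simp only [Noise.markY]
          rw [Function.update_of_ne (by decide)]
        · rfl
      rw [this]

end Machine

/-- The law of a gap and of the data of the attempt at its end. -/
noncomputable abbrev gapLaw (p : ProbVector) : Measure (ℝ × Mark) := expLaw.prod (markLaw p)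

namespace Machine

variable {σ : Type*} {M : Machine σ}

/-- Expectations that concern one block are expectations with respect to the clocks alone. -/
theorem Autonomous.lintegral_block (hM : M.Autonomous) (p : ProbVector) (s : σ × Space)
    {A : ℕ → Set (ℝ × Mark)} (hA : ∀ i, MeasurableSet (A i)) (K : ℕ → ℝ≥0∞) (d : ℝ × Mark)
    (y₀ : (Fin 3 → Mark) × (Fin 3 → Mark) × (Fin 3 → Mark)) : open Classical in
    ∫⁻ η, (if ∀ i < (M.block s η).length, (M.block s η).getD i d ∈ A i
        then K (M.block s η).length else 0) ∂blockLaw p =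
      ∫⁻ c, (∏ i ∈ Finset.range (schedule (SameParity s.2 (M.after s.1)) (c, y₀)).length,
        markLaw p {m | (((schedule (SameParity s.2 (M.after s.1)) (c, y₀)).getD i (0, 0)).2, m)
          ∈ A i}) * K (schedule (SameParity s.2 (M.after s.1)) (c, y₀)).length
        ∂(Measure.pi fun _ => expLaw) := by
  classical
  set P := SameParity s.2 (M.after s.1) with hP
  have hmeas : Measurable fun η => (if ∀ i < (M.block s η).length, (M.block s η).getD i d ∈ A i
        then K (M.block s η).length else 0) := by
    refine measurable_of_finite_parameter (f := fun (L : ℕ) (η : Noise) =>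
      if ∀ i < L, (M.block s η).getD i d ∈ A i then K L else 0) (fun L => ?_)
      (M.measurable_length_block s)
    refine Measurable.ite ?_ measurable_const measurable_const
    simp only [Set.ofPred_forall]
    exact .iInter fun i => .iInter fun _ => hM.measurable_block s d i (hA i)
  rw [blockLaw, lintegral_prod _ hmeas.aemeasurable]
  refine lintegral_congr fun c => ?_
  set l := schedule P (c, y₀) with hl
  have hlen : ∀ y, (M.block s (c, y)).length = l.length := fun y => M.length_block s (c, y)
  set g : (Fin 3 → Mark) × (Fin 3 → Mark) → ℝ≥0∞ := fun y => ∏ i ∈ Finset.range l.length,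
    {m | ((l.getD i (0, 0)).2, m) ∈ A i}.indicator 1
        ((M.feed s.2 (c, y.1, y.2, fun _ => (0, 0)) l s.1).getD i d).2 with hg
  have hBm : ∀ i, MeasurableSet {m | ((l.getD i (0, 0)).2, m) ∈ A i} := fun i =>
    (hA i).preimage measurable_prodMk_left
  have hgm : Measurable g := by
    refine Finset.measurable_prod _ fun i _ => ?_
    have hBi : Measurable ({m | ((l.getD i (0, 0)).2, m) ∈ A i}.indicator (1 : Mark → ℝ≥0∞)) :=
      measurable_one.indicator (hBm i)
    exact hBi.comp (measurable_snd.comp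
      (hM.measurable_feed_marks s.2 c (fun _ => (0, 0)) s.1 d l i))
  have e : ∀ y : (Fin 3 → Mark) × (Fin 3 → Mark) × (Fin 3 → Mark),
      (if ∀ i < (M.block s (c, y)).length, (M.block s (c, y)).getD i d ∈ A i
        then K (M.block s (c, y)).length else 0) = g (Prod.map id Prod.fst y) * K l.length := by
    intro y
    have hblock : M.block s (c, y) = M.feed s.2 (c, y.1, y.2.1, fun _ => (0, 0)) l s.1 :=
      feed_congr_noise _ _ _ fun a _ => ⟨rfl, rfl, rfl⟩
    have hin : ∀ i < l.length, ((M.block s (c, y)).getD i d ∈ A i ↔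
        ((M.feed s.2 (c, y.1, y.2.1, fun _ => (0, 0)) l s.1).getD i d).2 ∈
          {m | ((l.getD i (0, 0)).2, m) ∈ A i}) := by
      intro i hi
      rw [hblock, Set.mem_ofPred_eq]
      have h1 := M.feed_getElem?_fst s.2 (c, y.1, y.2.1, fun _ => (0, 0)) l s.1 i
      have hi' : i < (M.feed s.2 (c, y.1, y.2.1, fun _ => (0, 0)) l s.1).length := by
        rwa [M.length_feed]
      have h2 : ((M.feed s.2 (c, y.1, y.2.1, fun _ => (0, 0)) l s.1).getD i d).1 =
          (l.getD i (0, 0)).2 := by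
        rw [List.getD_eq_getElem _ _ hi', List.getD_eq_getElem _ _ hi]
        rw [List.getElem?_eq_getElem hi', List.getElem?_eq_getElem hi] at h1
        simpa using h1
      rw [← h2]
    rw [hlen]
    split_ifs with h
    · have : g (Prod.map id Prod.fst y) = 1 := by
        refine Finset.prod_eq_one fun i hi => ?_
        have hi := Finset.mem_range.1 hi
        exact Set.indicator_of_mem ((hin i hi).1 (h i hi)) _
      rw [this, one_mul]
    · push Not at h
      obtain ⟨i, hi, hi'⟩ := h
      have : g (Prod.map id Prod.fst y) = 0 := by
        refine Finset.prod_eq_zero (Finset.mem_range.2 hi) ?_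
        exact Set.indicator_of_notMem (fun h => hi' ((hin i hi).2 h)) _
      rw [this, zero_mul]
  simp only [e]
  have hproj : MeasurePreserving (Prod.map id Prod.fst :
      (Fin 3 → Mark) × (Fin 3 → Mark) × (Fin 3 → Mark) → (Fin 3 → Mark) × (Fin 3 → Mark))
      ((Measure.pi fun _ => markLaw p).prod
        ((Measure.pi fun _ => markLaw p).prod (Measure.pi fun _ => markLaw p)))
      ((Measure.pi fun _ => markLaw p).prod (Measure.pi fun _ => markLaw p)) :=
    (MeasurePreserving.id _).prod measurePreserving_fst
  rw [hproj.lintegral_comp (f := fun y => g y * K l.length) (hgm.mul_const _),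
    lintegral_mul_const _ hgm]
  congr 1
  refine hM.lintegral_feed (markLaw p) s.2 c _ s.1 hBm d l ?_
  rw [hl]
  unfold schedule
  split_ifs <;> simp

/-- In a block the gaps and marks are independent with the law `gapLaw`. The length of the block is
random; the gaps and marks which it lacks to the number of `n + 3` are replaced by fresh ones. -/
theorem Autonomous.lintegral_block_eq_prod (hM : M.Autonomous) (p : ProbVector) (s : σ × Space)
    {A : ℕ → Set (ℝ × Mark)} (hA : ∀ i, MeasurableSet (A i)) (n : ℕ) (d : ℝ × Mark) :
    open Classical in
    ∫⁻ η, (if ∀ i < (M.block s η).length, (M.block s η).getD i d ∈ A i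
        then ∏ i ∈ Finset.range (n + 3 - (M.block s η).length),
          gapLaw p (A ((M.block s η).length + i)) else 0) ∂blockLaw p =
      ∏ i ∈ Finset.range (n + 3), gapLaw p (A i) := by
  classical
  set f : ℕ → ℝ → ℝ≥0∞ := fun i t => markLaw p {m | (t, m) ∈ A i} with hf
  have hfm : ∀ i, Measurable (f i) := fun i => measurable_measure_prodMk_left (hA i)
  have hfi : ∀ i, ∫⁻ t, f i t ∂expLaw = gapLaw p (A i) := fun i =>
    (Measure.prod_apply (hA i)).symm
  set a : ℕ → ℝ≥0∞ := fun i => gapLaw p (A i) with ha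
  rw [hM.lintegral_block p s hA (fun L => ∏ i ∈ Finset.range (n + 3 - L), a (L + i)) d
    (fun _ => (0, 0), fun _ => (0, 0), fun _ => (0, 0))]
  set P := SameParity s.2 (M.after s.1) with hP
  have e3 : ∏ i ∈ Finset.range (n + 3), a i =
      a 0 * a 1 * a 2 * ∏ i ∈ Finset.range n, a (3 + i) := by
    rw [add_comm n 3, Finset.prod_range_add]
    simp [Finset.prod_range_succ]
  have e2 : ∏ i ∈ Finset.range (n + 1), a (2 + i) =
      a 2 * ∏ i ∈ Finset.range n, a (3 + i) := by
    rw [add_comm n 1, Finset.prod_range_add]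
    simp [← add_assoc]
  have e1 : ∏ i ∈ Finset.range (n + 2), a (1 + i) =
      a 1 * a 2 * ∏ i ∈ Finset.range n, a (3 + i) := by
    rw [add_comm n 2, Finset.prod_range_add]
    simp [Finset.prod_range_succ, ← add_assoc]
  by_cases h : P
  · rw [e3]
    simp only [schedule, h, if_true, List.length_cons, List.length_nil, zero_add, Nat.reduceAdd,
      Finset.prod_range_succ, Finset.prod_range_zero, one_mul, List.getD_cons_zero,
      List.getD_cons_succ, Noise.clock]
    rw [show n + 3 - 2 = n + 1 by omega, e2]
    rw [lintegral_pi_three (f := fun _ t u => f 0 t * f 1 u *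
      (a 2 * ∏ i ∈ Finset.range n, a (3 + i))) (by fun_prop)]
    simp only [mul_assoc]
    have : ∀ t, ∫⁻ u, f 0 t * (f 1 u * (a 2 * ∏ i ∈ Finset.range n, a (3 + i))) ∂expLaw =
        f 0 t * (a 1 * (a 2 * ∏ i ∈ Finset.range n, a (3 + i))) := by
      intro t
      rw [lintegral_const_mul _ ((hfm 1).mul_const _), lintegral_mul_const _ (hfm 1), hfi]
    simp only [this, lintegral_const, measure_univ, mul_one]
    rw [lintegral_mul_const _ (hfm 0), hfi]
  · have hinter := lintegral_expLaw_interlaced (hfm 0) (hfm 1) (hfm 2)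
    simp only [hfi] at hinter
    have hjoint : Measurable fun q : ℝ × ℝ × ℝ => (if q.1 ≤ q.2.1 then
        f 0 q.1 * f 1 (q.2.1 - q.1) * f 2 q.2.2 else f 0 (q.2.1 + q.2.2) * a 1 * a 2) := by
      refine Measurable.ite (measurableSet_le (by fun_prop) (by fun_prop)) ?_ ?_
      · fun_prop
      · fun_prop
    have hjoint' : Measurable fun x : Fin 3 → ℝ => (if x 0 ≤ x 1 then
        f 0 (x 0) * f 1 (x 1 - x 0) * f 2 (x 2) else f 0 (x 1 + x 2) * a 1 * a 2) :=
      hjoint.comp (by fun_prop : Measurable fun x : Fin 3 → ℝ => (x 0, x 1, x 2))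
    rw [e3, ← hinter, ← lintegral_pi_three hjoint expLaw, ← lintegral_mul_const _ hjoint']
    refine lintegral_congr fun c => ?_
    by_cases hc : c 0 ≤ c 1
    · have hs : schedule P (c, fun _ => (0, 0), fun _ => (0, 0), fun _ => (0, 0)) =
          [(0, c 0), (1, c 1 - c 0), (2, c 2)] := by
        simp [schedule, h, Noise.clock, hc]
      rw [hs, if_pos hc]
      simp only [List.length_cons, List.length_nil, zero_add, Nat.reduceAdd,
        Finset.prod_range_succ, Finset.prod_range_zero, one_mul, List.getD_cons_zero,
        List.getD_cons_succ, Nat.add_sub_cancel]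
      rfl
    · have hs : schedule P (c, fun _ => (0, 0), fun _ => (0, 0), fun _ => (0, 0)) =
          [(2, c 1 + c 2)] := by
        simp [schedule, h, Noise.clock, hc]
      rw [hs, if_neg hc]
      simp only [List.length_cons, List.length_nil, zero_add, Finset.prod_range_one,
        List.getD_cons_zero]
      rw [show n + 3 - 1 = n + 2 by omega, e1]
      simp only [mul_assoc]
      rfl

/-- The finite dimensional laws of the sequence of gaps and marks. Each block contains one attempt
at least, so that the blocks can be integrated out one after the other. -/
theorem Autonomous.measure_stream_mem (hM : M.Autonomous) (p : ProbVector) (n : ℕ) :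
    ∀ (s : σ × Space) (A : ℕ → Set (ℝ × Mark)), (∀ i, MeasurableSet (A i)) →
      (∀ i, n ≤ i → A i = Set.univ) → ∀ N, n ≤ N →
      noiseLaw p {ω | ∀ i, M.stream s ω i ∈ A i} = ∏ i ∈ Finset.range N, gapLaw p (A i) := by
  classical
  induction n using Nat.strong_induction_on with
  | _ n ih =>
  intro s A hA hAn N hN
  have hN' : ∏ i ∈ Finset.range N, gapLaw p (A i) = ∏ i ∈ Finset.range (n + 3), gapLaw p (A i) := by
    have : ∀ N, n ≤ N → ∏ i ∈ Finset.range N, gapLaw p (A i) =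
        ∏ i ∈ Finset.range n, gapLaw p (A i) := by
      intro N hN
      refine (Finset.prod_subset (Finset.range_subset_range.2 hN) fun i _ hi => ?_).symm
      rw [hAn i (by simpa using hi), measure_univ]
    rw [this N hN, this (n + 3) (by omega)]
  rcases Nat.eq_zero_or_pos n with rfl | hn
  · have h1 : ∀ i, A i = Set.univ := fun i => hAn i (Nat.zero_le i)
    simp [h1]
  rw [hN', ← hM.lintegral_block_eq_prod p s hA n (0, 0, 0)]
  have hE : MeasurableSet {ω | ∀ i, M.stream s ω i ∈ A i} := by
    rw [Set.ofPred_forall]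
    exact .iInter fun i => hM.measurable_stream_apply s i (hA i)
  have hcons := measurePreserving_cons (blockLaw p)
  rw [noiseLaw, ← hcons.measure_preimage hE.nullMeasurableSet,
    Measure.prod_apply (hcons.measurable hE)]
  refine lintegral_congr fun η => ?_
  have hpos := M.length_block_pos s η
  set L := (M.block s η).length with hL
  have hset : Prod.mk η ⁻¹' ((fun (q : Noise × (ℕ → Noise)) (n : ℕ) =>
      (Nat.casesOn n q.1 q.2 : Noise)) ⁻¹' {ω | ∀ i, M.stream s ω i ∈ A i}) =
      if ∀ i < L, (M.block s η).getD i (0, 0, 0) ∈ A i then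
        {ω | ∀ i, M.stream (M.next s η) ω i ∈ A (L + i)} else ∅ := by
    ext ω
    set ω' : ℕ → Noise := fun n => Nat.casesOn n η ω with hω'
    have h1 : ∀ i < L, (M.block s η).getD i (0, 0, 0) = M.stream s ω' i := fun i hi => by
      have h4 : (M.block s η)[i]? = some (M.stream s ω' i) := M.block_getElem? s ω' hi
      rw [List.getD_eq_getElem?_getD, h4]
      rfl
    have h2 : ∀ i, M.stream s ω' (L + i) = M.stream (M.next s η) ω i := fun i =>
      M.stream_length_add s ω' i
    have h3 : ω ∈ Prod.mk η ⁻¹' ((fun (q : Noise × (ℕ → Noise)) (n : ℕ) =>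
      (Nat.casesOn n q.1 q.2 : Noise)) ⁻¹' {ω | ∀ i, M.stream s ω i ∈ A i}) ↔
        ∀ i, M.stream s ω' i ∈ A i := Iff.rfl
    rw [h3]
    split_ifs with hb
    · constructor
      · intro h i
        rw [← h2]
        exact h _
      · intro h i
        rcases lt_or_ge i L with hi | hi
        · rw [← h1 i hi]
          exact hb i hi
        · rw [← Nat.add_sub_cancel' hi, h2]
          exact h _
    · refine ⟨fun h => hb fun i hi => ?_, fun h => h.elim⟩
      rw [h1 i hi]
      exact h i
  rw [hset]
  split_ifs with hb
  · exact ih (n - L) (by omega) (M.next s η) (fun i => A (L + i)) (fun i => hA _)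
      (fun i hi => hAn _ (by omega)) (n + 3 - L) (by omega)
  · simp

/-- Along an autonomous process the gaps are independent standard exponential times, and they are
independent of the marks, which are independent and have the law of the data of a collision. -/
theorem Autonomous.measurePreserving_stream (hM : M.Autonomous) (p : ProbVector) (s : σ × Space) :
    MeasurePreserving (M.stream s) (noiseLaw p) (Measure.infinitePi fun _ => gapLaw p) := by
  classical
  have hm : Measurable (M.stream s) :=
    measurable_pi_lambda _ fun i => hM.measurable_stream_apply s i
  refine ⟨hm, Measure.eq_infinitePi _ fun t A hA => ?_⟩
  rw [Measure.map_apply hm (.pi t.countable_toSet fun i _ => hA i)]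
  set A' : ℕ → Set (ℝ × Mark) := fun i => if i ∈ t then A i else Set.univ with hA'
  have hA'm : ∀ i, MeasurableSet (A' i) := fun i => by
    simp only [hA']
    split_ifs
    · exact hA i
    · exact .univ
  have hsub : t ⊆ Finset.range (t.sup id + 1) := fun i hi => by
    rw [Finset.mem_range, Nat.lt_succ_iff]
    exact Finset.le_sup (f := id) hi
  have h := hM.measure_stream_mem p (t.sup id + 1) s A' hA'm (fun i hi => by
    simp only [hA']
    rw [if_neg fun h => ?_]
    have := Finset.mem_range.1 (hsub h)
    omega) _ le_rfl
  rw [← Finset.prod_subset hsub fun i _ hi => by simp [hA', hi]] at h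
  have hAt : ∏ i ∈ t, gapLaw p (A' i) = ∏ i ∈ t, gapLaw p (A i) :=
    Finset.prod_congr rfl fun i hi => by simp only [hA', if_pos hi]
  rw [hAt] at h
  rw [← h]
  congr 1
  ext ω
  simp only [Set.mem_preimage, Set.mem_pi, Finset.mem_coe, Set.mem_ofPred_eq, hA']
  refine forall_congr' fun i => ?_
  split_ifs with hi <;> simp [hi]

end Machine

theorem autonomous_velMachine (k : ℕ) (a b : Bool) : (velMachine k a b).Autonomous where
  before_eq _ _ _ := rfl
  attempt_eq s T T' m m' h := by simp only [velMachine, h]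

/-! ### Sequences of independent gaps and marks -/

/-- The law of a sequence of independent gaps and marks. -/
noncomputable abbrev gapsLaw (p : ProbVector) : Measure (ℕ → ℝ × Mark) :=
  Measure.infinitePi fun _ => gapLaw p

/-- The sequence `g` with the gap `a` replaced by `t`. -/
def setGap (g : ℕ → ℝ × Mark) (a : ℕ) (t : ℝ) : ℕ → ℝ × Mark := Function.update g a (t, (g a).2)

theorem setGap_of_ne {g : ℕ → ℝ × Mark} {a n : ℕ} (t : ℝ) (h : n ≠ a) : setGap g a t n = g n :=
  Function.update_of_ne h _ _

theorem setGap_self (g : ℕ → ℝ × Mark) (a : ℕ) (t : ℝ) : setGap g a t a = (t, (g a).2) :=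
  Function.update_self _ _ _

theorem setGap_snd (g : ℕ → ℝ × Mark) (a n : ℕ) (t : ℝ) : (setGap g a t n).2 = (g n).2 := by
  by_cases h : n = a
  · rw [h, setGap_self]
  · rw [setGap_of_ne t h]

/-- If an event `S` implies an event `S'` which does not depend on the gap `a`, and has conditional
probability at most `δ` given everything but this gap, then it is at least by a factor `δ` less
likely than `S'`. -/
theorem gapsLaw_le_mul (p : ProbVector) {S S' : Set (ℕ → ℝ × Mark)} (hS : MeasurableSet S)
    (hS' : MeasurableSet S') (hSS' : S ⊆ S') {a : ℕ}
    (hinv : ∀ g t, setGap g a t ∈ S' ↔ g ∈ S') {δ : ℝ≥0∞}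
    (hδ : ∀ g ∈ S', expLaw {t | setGap g a t ∈ S} ≤ δ) : gapsLaw p S ≤ δ * gapsLaw p S' := by
  have hΨ := measurePreserving_update (fun _ : ℕ => gapLaw p) a
  have hint : ∀ S : Set (ℕ → ℝ × Mark), MeasurableSet S → gapsLaw p S =
      ∫⁻ g, ∫⁻ m, expLaw {t | Function.update g a (t, m) ∈ S} ∂markLaw p ∂gapsLaw p := by
    intro S hS
    rw [← hΨ.measure_preimage hS.nullMeasurableSet, Measure.prod_apply (hΨ.measurable hS)]
    refine lintegral_congr fun g => ?_
    have hSg : MeasurableSet {y : ℝ × Mark | Function.update g a y ∈ S} :=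
      hS.preimage (hΨ.measurable.comp measurable_prodMk_left)
    exact Measure.prod_apply_symm hSg
  rw [hint S hS, hint S' hS', ← lintegral_const_mul _ ?_]
  · refine lintegral_mono fun g => ?_
    rw [← lintegral_const_mul _ ?_]
    · refine lintegral_mono fun m => ?_
      set g₀ : ℕ → ℝ × Mark := Function.update g a (0, m) with hg₀
      have e : ∀ t, Function.update g a (t, m) = setGap g₀ a t := fun t => by
        simp [setGap, hg₀]
      simp only [e, hinv]
      by_cases h : g₀ ∈ S'
      · simpa [h] using hδ g₀ h
      · have : {t | setGap g₀ a t ∈ S} = ∅ := by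
          ext t
          simp only [Set.mem_ofPred_eq, Set.mem_empty_iff_false, iff_false]
          exact fun ht => h ((hinv g₀ t).1 (hSS' ht))
        simp [this]
    · exact measurable_measure_prodMk_right
        (hS'.preimage (hΨ.measurable.comp measurable_prodMk_left))
  · have h2 : MeasurableSet {x : ((ℕ → ℝ × Mark) × Mark) × ℝ |
        Function.update x.1.1 a (x.2, x.1.2) ∈ S'} :=
      hS'.preimage (hΨ.measurable.comp (by fun_prop :
        Measurable fun x : ((ℕ → ℝ × Mark) × Mark) × ℝ => (x.1.1, (x.2, x.1.2))))
    exact Measurable.lintegral_prod_right' (f := fun x : (ℕ → ℝ × Mark) × Mark =>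
      expLaw {t | Function.update x.1 a (t, x.2) ∈ S'}) (measurable_measure_prodMk_left h2)

/-! ### Good windows -/

/-- The directions of a Hamiltonian cycle of eight steps along the edges of a cube, which is
preceded by one and followed by two arbitrary steps. -/
def grayCode : Fin 11 → Fin 3 := ![0, 0, 1, 0, 2, 0, 1, 0, 2, 0, 0]

/-- All gaps in the window number `q` of length `11` are longer than `1`, and the flips are those
of `grayCode`, so that every velocity is attempted during the eight central steps, with one long
flight more before and two after it. -/
def GoodWindow (q : ℕ) (g : ℕ → ℝ × Mark) : Prop :=
  ∀ j : Fin 11, 1 < (g (11 * q + j)).1 ∧ (g (11 * q + j)).2.1 = grayCode j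

/-- None of the windows in `[0, N)` is good, except perhaps for those which contain one of two
given indices. -/
def noGoodWindow (N a b : ℕ) : Set (ℕ → ℝ × Mark) :=
  {g | ∀ q, 11 * q + 11 ≤ N → a / 11 ≠ q → b / 11 ≠ q → ¬GoodWindow q g}

theorem measurableSet_goodWindow (q : ℕ) : MeasurableSet {g | GoodWindow q g} := by
  unfold GoodWindow
  rw [Set.ofPred_forall]
  refine .iInter fun j => ?_
  have h1 : Measurable fun g : ℕ → ℝ × Mark => (g (11 * q + j)).1 := by fun_prop
  have h2 : Measurable fun g : ℕ → ℝ × Mark => (g (11 * q + j)).2.1 := by fun_prop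
  exact (measurableSet_lt measurable_const h1).inter (h2 (measurableSet_singleton (grayCode j)))

theorem measurableSet_noGoodWindow (N a b : ℕ) : MeasurableSet (noGoodWindow N a b) := by
  unfold noGoodWindow
  simp only [Set.ofPred_forall]
  exact .iInter fun q => .iInter fun _ => .iInter fun _ => .iInter fun _ =>
    (measurableSet_goodWindow q).compl

theorem setGap_mem_noGoodWindow {N a b c : ℕ} (hc : c = a ∨ c = b) (g : ℕ → ℝ × Mark) (t : ℝ) :
    setGap g c t ∈ noGoodWindow N a b ↔ g ∈ noGoodWindow N a b := by
  refine forall_congr' fun q => forall_congr' fun _ => forall_congr' fun ha =>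
    forall_congr' fun hb => not_congr ?_
  refine forall_congr' fun j => ?_
  rw [setGap_of_ne]
  have := j.2
  rintro h
  rcases hc with rfl | rfl
  · apply ha; omega
  · apply hb; omega

theorem flipLaw_singleton (p : ProbVector) (i : Fin 3) :
    flipLaw p {i} = ENNReal.ofReal (p.val i) := by
  simp only [flipLaw, Measure.coe_finsetSum, Finset.sum_apply, Measure.smul_apply, smul_eq_mul]
  rw [Finset.sum_eq_single i]
  · simp
  · intro j _ hj
    simp [hj]
  · simp

theorem gapLaw_long_flip (p : ProbVector) (i : Fin 3) :
    0 < gapLaw p {d | 1 < d.1 ∧ d.2.1 = i} := by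
  have : {d : ℝ × Mark | 1 < d.1 ∧ d.2.1 = i} = Set.Ioi 1 ×ˢ ({i} ×ˢ Set.univ) := by
    ext ⟨t, j, x⟩
    simp
  rw [this, Measure.prod_prod, markLaw, Measure.prod_prod, flipLaw_singleton, measure_univ, mul_one]
  have h1 : expLaw (Set.Ioi 1) = ENNReal.ofReal (Real.exp (-1)) := by
    rw [← expLaw_Ici zero_le_one, ← Set.Ioi_union_left, measure_union (by simp)
      (measurableSet_singleton _), expLaw_singleton, add_zero]
  rw [h1]
  exact ENNReal.mul_pos (by simpa using Real.exp_pos _) (by simpa using p.pos i)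

theorem exists_forall_not_goodWindow_le (p : ProbVector) : ∃ ρ : ℝ, 0 < ρ ∧ ρ < 1 ∧
    ∀ I : Finset ℕ, gapsLaw p {g | ∀ q ∈ I, ¬GoodWindow q g} ≤ ENNReal.ofReal ρ ^ I.card := by
  classical
  set B : Set (Fin 11 → ℝ × Mark) := {f | ∀ j, 1 < (f j).1 ∧ (f j).2.1 = grayCode j} with hB
  have hset : ∀ i : Fin 3, MeasurableSet {d : ℝ × Mark | 1 < d.1 ∧ d.2.1 = i} := fun i =>
    (measurableSet_lt measurable_const measurable_fst).inter
      ((measurable_fst.comp measurable_snd) (measurableSet_singleton i))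
  have hBpi : B = Set.pi (Finset.univ : Finset (Fin 11))
      fun j => {d : ℝ × Mark | 1 < d.1 ∧ d.2.1 = grayCode j} := by
    ext f
    simp [hB]
  have hBm : MeasurableSet B := by
    rw [hBpi]
    exact .pi (Finset.countable_toSet _) fun j _ => hset _
  set Q : Measure (Fin 11 → ℝ × Mark) := Measure.infinitePi fun _ => gapLaw p with hQ
  have hQB : 0 < Q B := by
    rw [hBpi, hQ, Measure.infinitePi_pi _ fun j _ => hset _]
    exact CanonicallyOrderedAdd.prod_pos.2 fun j _ => gapLaw_long_flip p _
  have hQBc : Q Bᶜ < 1 := by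
    rw [prob_compl_eq_one_sub hBm]
    exact ENNReal.sub_lt_self ENNReal.one_ne_top one_ne_zero hQB.ne'
  have hinj : Function.Injective fun x : ℕ × Fin 11 => 11 * x.1 + (x.2 : ℕ) := by
    rintro ⟨q, j⟩ ⟨q', j'⟩ h
    have h1 := j.2
    have h2 := j'.2
    simp only at h
    ext <;> simp only <;> omega
  have hmap : (gapsLaw p).map (fun g (q : ℕ) (j : Fin 11) => g (11 * q + j)) =
      Measure.infinitePi fun _ : ℕ => Q := by
    have h1 := Measure.map_infinitePi_infinitePi_of_inj (P := fun _ : ℕ => gapLaw p) hinj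
    have h2 := Measure.infinitePi_map_curry (fun (_ : ℕ) (_ : Fin 11) => gapLaw p)
    rw [hQ, ← h2, ← h1, Measure.map_map (by fun_prop) (by fun_prop)]
    rfl
  refine ⟨max (Q Bᶜ).toReal (1 / 2), by positivity, max_lt ?_ (by norm_num), fun I => ?_⟩
  · rw [← ENNReal.toReal_one]
    exact ENNReal.toReal_strict_mono ENNReal.one_ne_top hQBc
  have hmeas : Measurable fun (g : ℕ → ℝ × Mark) (q : ℕ) (j : Fin 11) => g (11 * q + j) := by
    fun_prop
  have hI : {g | ∀ q ∈ I, ¬GoodWindow q g} =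
      (fun (g : ℕ → ℝ × Mark) (q : ℕ) (j : Fin 11) => g (11 * q + j)) ⁻¹'
        Set.pi (I : Set ℕ) fun _ => Bᶜ := rfl
  rw [hI, ← Measure.map_apply hmeas (.pi I.countable_toSet fun _ _ => hBm.compl), hmap,
    Measure.infinitePi_pi _ fun _ _ => hBm.compl, Finset.prod_const]
  gcongr
  exact (ENNReal.ofReal_toReal (ne_top_of_lt hQBc)).ge.trans
    (ENNReal.ofReal_le_ofReal (le_max_left _ _))

/-- The absence of good windows is exponentially unlikely, even if two windows are disregarded. -/
theorem exists_noGoodWindow_le (p : ProbVector) : ∃ D σ : ℝ, 0 ≤ D ∧ 0 < σ ∧ σ < 1 ∧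
    ∀ N a b, gapsLaw p (noGoodWindow N a b) ≤ ENNReal.ofReal (D * σ ^ N) := by
  obtain ⟨ρ, hρ0, hρ1, hρ⟩ := exists_forall_not_goodWindow_le p
  set σ : ℝ := ρ ^ ((1 : ℝ) / 11) with hσ
  have hσ0 : 0 < σ := Real.rpow_pos_of_pos hρ0 _
  have hσ1 : σ < 1 := Real.rpow_lt_one hρ0.le hρ1 (by norm_num)
  have hσρ : ρ = σ ^ 11 := by
    rw [hσ, ← Real.rpow_natCast, ← Real.rpow_mul hρ0.le]
    norm_num
  -- at least `N / 11 - 2` windows are left, hence at least `N - 32` indices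
  refine ⟨(σ ^ 32)⁻¹, σ, by positivity, hσ0, hσ1, fun N a b => ?_⟩
  set I : Finset ℕ := ((Finset.range (N / 11)).erase (a / 11)).erase (b / 11) with hI
  have hsub : noGoodWindow N a b ⊆ {g | ∀ q ∈ I, ¬GoodWindow q g} := fun g hg q hq => by
    simp only [hI, Finset.mem_erase, Finset.mem_range] at hq
    exact hg q (by omega) (fun h => hq.2.1 h.symm) (fun h => hq.1 h.symm)
  have hcard : N / 11 ≤ I.card + 2 := by
    have h1 := Finset.pred_card_le_card_erase (s := (Finset.range (N / 11)).erase (a / 11))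
      (a := b / 11)
    have h2 := Finset.pred_card_le_card_erase (s := Finset.range (N / 11)) (a := a / 11)
    rw [Finset.card_range] at h2
    rw [hI]
    omega
  refine (measure_mono hsub).trans ((hρ I).trans ?_)
  rw [← ENNReal.ofReal_pow hρ0.le]
  refine ENNReal.ofReal_le_ofReal ?_
  rw [le_inv_mul_iff₀ (by positivity), hσρ, ← pow_mul, ← pow_add]
  exact pow_le_pow_of_le_one hσ0.le hσ1.le (by omega)

/-! ### Returns of a chain of velocities -/

/-- The vector `v` arises from `u` by changing the sign of one coordinate. -/
def OneFlip (u v : Fin 3 → ℝ) : Prop := ∃ i₀, ∀ i, v i = if i = i₀ then -u i else u i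

theorem OneFlip.symm {u v : Fin 3 → ℝ} (h : OneFlip u v) : OneFlip v u := by
  obtain ⟨i₀, h⟩ := h
  refine ⟨i₀, fun i => ?_⟩
  rw [h i]
  split_ifs <;> simp

theorem OneFlip.not_const {u v : Fin 3 → ℝ} (h : OneFlip u v) (hu : ∀ i, u i ≠ 0)
    (hu' : ∀ i i', u i = u i') (hv' : ∀ i i', v i = v i') : False := by
  obtain ⟨i₀, h⟩ := h
  obtain ⟨i, hi, -⟩ := exists_ne_and_ne i₀ i₀
  have h1 := h i₀
  have h2 := h i
  rw [if_pos rfl] at h1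
  rw [if_neg hi, hv' i i₀, h1, hu' i i₀] at h2
  have := hu i₀
  apply this
  linarith

/-- In a chain of vectors of signs which starts or ends at `(1, 1, 1)`, and in which one sign
changes at a time, there are two differences of coordinates which are independent in a triangular
way, unless some coordinate is constant. -/
theorem exists_two_differences {h : ℕ → Fin 3 → ℝ} {j N ℓ : ℕ} (hjN : j + 2 ≤ N)
    (hℓ : ℓ = j ∨ ℓ = N) (h1 : ∀ i, h ℓ i = 1)
    (hflip : ∀ n, j ≤ n → n < N → OneFlip (h n) (h (n + 1))) (h0 : ∀ n i, h n i ≠ 0) :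
    (∃ a ∈ (Finset.Icc j N).erase ℓ, ∃ b ∈ (Finset.Icc j N).erase ℓ, ∃ i i' l l',
      h b i ≠ h b i' ∧ h b l = h b l' ∧ h a l ≠ h a l') ∨
    ∃ i, ∀ n ∈ (Finset.Icc j N).erase ℓ, h n i = 1 := by
  -- the neighbour `b` of `ℓ` differs from `(1, 1, 1)` in one coordinate `i₀`
  obtain ⟨b, hb, hbℓ⟩ : ∃ b ∈ (Finset.Icc j N).erase ℓ, OneFlip (h ℓ) (h b) := by
    simp only [Finset.mem_erase, Finset.mem_Icc]
    rcases hℓ with rfl | rfl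
    · exact ⟨ℓ + 1, by omega, hflip ℓ le_rfl (by omega)⟩
    · refine ⟨ℓ - 1, by omega, ?_⟩
      have := hflip (ℓ - 1) (by omega) (by omega)
      rw [Nat.sub_add_cancel (by omega)] at this
      exact this.symm
  obtain ⟨i₀, hi₀⟩ := hbℓ
  obtain ⟨i, i', hi, hi', hii'⟩ : ∃ i i' : Fin 3, i ≠ i₀ ∧ i' ≠ i₀ ∧ i ≠ i' := by
    clear hi₀; revert i₀; decide
  have hbi : h b i = 1 := by rw [hi₀, if_neg hi, h1]
  have hbi' : h b i' = 1 := by rw [hi₀, if_neg hi', h1]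
  have hbi₀ : h b i₀ = -1 := by rw [hi₀, if_pos rfl, h1]
  by_cases hex : ∃ a ∈ (Finset.Icc j N).erase ℓ, h a i ≠ h a i'
  · obtain ⟨a, ha, hai⟩ := hex
    refine Or.inl ⟨a, ha, b, hb, i₀, i, i, i', ?_, hbi.trans hbi'.symm, hai⟩
    rw [hbi, hbi₀]
    norm_num
  · -- a change of one of the coordinates `i`, `i'` would make them different
    push Not at hex
    have heq : ∀ n, j ≤ n → n ≤ N → h n i = h n i' := fun n hn hnN => by
      by_cases hnℓ : n = ℓ
      · rw [hnℓ, h1, h1]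
      · exact hex n (by simp [hnℓ, hn, hnN])
    have hstep : ∀ n, j ≤ n → n < N → h (n + 1) i = h n i := fun n hn hnN => by
      obtain ⟨c, hc⟩ := hflip n hn hnN
      have e1 := heq n hn hnN.le
      have e2 := heq (n + 1) (by omega) hnN
      rw [hc i, hc i'] at e2
      rw [hc i]
      have := h0 n i
      split_ifs with hic
      · subst hic
        rw [if_pos rfl, if_neg (Ne.symm hii'), ← e1] at e2
        exact absurd (by linarith) this
      · rfl
    have hconst : ∀ n, j ≤ n → n ≤ N → h n i = h j i := fun n hn => by
      induction n, hn using Nat.le_induction with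
      | base => exact fun _ => rfl
      | succ n hn ih => exact fun hnN => (hstep n hn hnN).trans (ih (by omega))
    refine Or.inr ⟨i, fun n hn => ?_⟩
    simp only [Finset.mem_erase, Finset.mem_Icc] at hn
    rw [hconst n hn.2.1 hn.2.2, ← h1 i]
    rcases hℓ with rfl | rfl
    · rfl
    · exact (hconst ℓ (by omega) le_rfl).symm

/-- A chain of vectors of signs as in `exists_two_differences`, but the step which leaves the
index `k` may be missing: there is a difference of coordinates outside of `k`, unless some
coordinate is constant. -/
theorem exists_difference {h : ℕ → Fin 3 → ℝ} {j N ℓ k : ℕ} (hjN : j + 2 ≤ N)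
    (hℓ : ℓ = j ∨ ℓ = N) (h1 : ∀ i, h ℓ i = 1)
    (hflip : ∀ n, j ≤ n → n < N → n ≠ k → OneFlip (h n) (h (n + 1)))
    (hk : OneFlip (h k) (h (k + 1)) ∨ h (k + 1) = h k) (h0 : ∀ n i, h n i ≠ 0) :
    (∃ a ∈ (Finset.Icc j N).erase ℓ, a ≠ k ∧ ∃ i i', h a i ≠ h a i') ∨
    ∃ i, ∃ a ∈ (Finset.Icc j N).erase ℓ, a ≠ k ∧ ∀ n ∈ (Finset.Icc j N).erase ℓ, h n i = 1 := by
  by_cases hex : ∃ a ∈ (Finset.Icc j N).erase ℓ, a ≠ k ∧ ∃ i i', h a i ≠ h a i'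
  · exact Or.inl hex
  right
  push Not at hex
  have hc : ∀ n, j ≤ n → n ≤ N → n ≠ k → ∀ i i', h n i = h n i' := fun n hn hnN hnk i i' => by
    by_cases hnℓ : n = ℓ
    · rw [hnℓ, h1, h1]
    · exact hex n (by simp [hnℓ, hn, hnN]) hnk i i'
  have hpair : ∀ n, j ≤ n → n < N → n = k ∨ n + 1 = k := fun n hn hnN => by
    by_contra! hcon
    exact (hflip n hn hnN hcon.1).not_const (h0 n) (hc n hn hnN.le hcon.1)
      (hc (n + 1) (by omega) hnN hcon.2)
  have p1 := hpair j le_rfl (by omega)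
  have p2 := hpair (N - 1) (by omega) (by omega)
  -- any two successive indices contain `k`, which leaves chains of length `3` only
  obtain ⟨rfl, rfl⟩ : k = j + 1 ∧ N = j + 2 := by omega
  obtain ⟨i₀, hi₀⟩ := hflip j le_rfl (by omega) (by omega)
  have c0 := hc j le_rfl (by omega) (by omega)
  have c2 := hc (j + 2) (by omega) le_rfl (by omega)
  rcases hk with ⟨i₁, hi₁⟩ | hk
  · have hi₁' : ∀ i, h (j + 2) i = if i = i₁ then -h (j + 1) i else h (j + 1) i := hi₁
    obtain rfl : i₁ = i₀ := by
      by_contra hne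
      obtain ⟨i, hi, hi'⟩ := exists_ne_and_ne i₀ i₁
      have e1 := hi₁' i
      rw [if_neg hi', hi₀, if_neg hi] at e1
      have e2 := hi₁' i₀
      rw [if_neg (Ne.symm hne), hi₀, if_pos rfl] at e2
      rw [c2 i i₀, e2, c0 i i₀] at e1
      exact h0 j i₀ (by linarith)
    obtain ⟨i, hi, -⟩ := exists_ne_and_ne i₁ i₁
    have e1 : h (j + 1) i = h j i := by rw [hi₀, if_neg hi]
    have e2 : h (j + 2) i = h j i := by rw [hi₁', if_neg hi, e1]
    have e0 : h j i = 1 := by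
      rcases hℓ with rfl | rfl
      · exact h1 i
      · rw [← e2, h1]
    have hall : ∀ n ∈ (Finset.Icc j (j + 2)).erase ℓ, h n i = 1 := fun n hn => by
      simp only [Finset.mem_erase, Finset.mem_Icc] at hn
      obtain rfl | rfl | rfl : n = j ∨ n = j + 1 ∨ n = j + 2 := by omega
      · exact e0
      · rw [e1, e0]
      · rw [e2, e0]
    refine ⟨i, if ℓ = j then j + 2 else j, ?_, ?_, hall⟩
    · simp only [Finset.mem_erase, Finset.mem_Icc]
      split_ifs with h <;> omega
    · split_ifs <;> omega
  · have hk' : h (j + 2) = h (j + 1) := hk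
    rw [hk'] at c2
    exact ((OneFlip.not_const ⟨i₀, hi₀⟩) (h0 j) c0 c2).elim

/-! ### Relative signs of velocities -/

/-- The sign of the `i`-th coordinate of the velocity number `n` relative to the velocity number
`ℓ`. -/
noncomputable def relSign (k : ℕ) (b : Bool) (w : Space) (ℓ : ℕ) (g : ℕ → ℝ × Mark) (n : ℕ)
    (i : Fin 3) : ℝ := velBefore k b w g n i / velBefore k b w g ℓ i

theorem velBefore_setGap (k : ℕ) (b : Bool) (w : Space) (g : ℕ → ℝ × Mark) (a : ℕ) (t : ℝ)
    (n : ℕ) : velBefore k b w (setGap g a t) n = velBefore k b w g n := by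
  induction n with
  | zero => rfl
  | succ n ih => rw [velBefore, velBefore, ih, setGap_snd]

theorem relSign_setGap (k : ℕ) (b : Bool) (w : Space) (ℓ : ℕ) (g : ℕ → ℝ × Mark) (a : ℕ) (t : ℝ) :
    relSign k b w ℓ (setGap g a t) = relSign k b w ℓ g := by
  funext n i
  simp only [relSign, velBefore_setGap]

theorem measurable_velBefore (k : ℕ) (b : Bool) (w : Space) (n : ℕ) (i : Fin 3) :
    Measurable fun g : ℕ → ℝ × Mark => velBefore k b w g n i := by
  induction n generalizing i with
  | zero => exact (measurable_const : Measurable fun _ : ℕ → ℝ × Mark => w i)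
  | succ n ih =>
    simp only [velBefore]
    by_cases h : n = k ∧ b = false
    · simpa [h] using ih i
    · simp only [h, if_false]
      refine measurable_of_finite_parameter
        (f := fun (c : Fin 3) (g : ℕ → ℝ × Mark) => signFlip c (velBefore k b w g n) i)
        (fun c => ?_) (by fun_prop : Measurable fun g : ℕ → ℝ × Mark => (g n).2.1)
      simp only [signFlip_apply]
      split_ifs
      · exact (ih i).neg
      · exact ih i

theorem measurable_relSign (k : ℕ) (b : Bool) (w : Space) (ℓ n : ℕ) (i : Fin 3) :
    Measurable fun g : ℕ → ℝ × Mark => relSign k b w ℓ g n i :=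
  (measurable_velBefore k b w n i).div (measurable_velBefore k b w ℓ i)

theorem relSign_eq_or {k : ℕ} {b : Bool} {w : Space} (hw : ∀ i, w i ≠ 0) (ℓ : ℕ)
    (g : ℕ → ℝ × Mark) (n : ℕ) (i : Fin 3) :
    relSign k b w ℓ g n i = 1 ∨ relSign k b w ℓ g n i = -1 := by
  have h : |relSign k b w ℓ g n i| = 1 := by
    rw [relSign, abs_div, abs_velBefore, abs_velBefore, div_self (abs_ne_zero.2 (hw i))]
  exact eq_or_eq_neg_of_abs_eq h

theorem velBefore_ne_zero {k : ℕ} {b : Bool} {w : Space} (hw : ∀ i, w i ≠ 0)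
    (g : ℕ → ℝ × Mark) (n : ℕ) (i : Fin 3) : velBefore k b w g n i ≠ 0 := by
  rw [← abs_ne_zero, abs_velBefore, abs_ne_zero]
  exact hw i

theorem relSign_self {k : ℕ} {b : Bool} {w : Space} (hw : ∀ i, w i ≠ 0) (ℓ : ℕ)
    (g : ℕ → ℝ × Mark) (i : Fin 3) : relSign k b w ℓ g ℓ i = 1 :=
  div_self (velBefore_ne_zero hw g ℓ i)

theorem oneFlip_relSign {k : ℕ} {b : Bool} {w : Space} {g : ℕ → ℝ × Mark} {ℓ n : ℕ}
    (h : n ≠ k ∨ b = true) :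
    OneFlip (relSign k b w ℓ g n) (relSign k b w ℓ g (n + 1)) := by
  refine ⟨(g n).2.1, fun i => ?_⟩
  have : ¬(n = k ∧ b = false) := by
    rcases h with h | h <;> simp [h]
  simp only [relSign]
  rw [velBefore, if_neg this, signFlip_apply]
  split_ifs
  · rw [neg_div]
  · rfl

/-- The difference of the displacements in the coordinates `i` and `i'` during the flights with
numbers in `R`, each coordinate being measured in units of the velocity number `ℓ`. -/
noncomputable def discrepancy (k : ℕ) (b : Bool) (w : Space) (ℓ : ℕ) (R : Finset ℕ) (i i' : Fin 3)
    (g : ℕ → ℝ × Mark) : ℝ :=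
  ∑ n ∈ R, (relSign k b w ℓ g n i - relSign k b w ℓ g n i') * (g n).1

theorem measurable_discrepancy (k : ℕ) (b : Bool) (w : Space) (ℓ : ℕ) (R : Finset ℕ)
    (i i' : Fin 3) : Measurable (discrepancy k b w ℓ R i i') := by
  refine Finset.measurable_sum _ fun n _ => ?_
  have h : Measurable fun g : ℕ → ℝ × Mark => (g n).1 := by fun_prop
  exact ((measurable_relSign k b w ℓ n i).sub (measurable_relSign k b w ℓ n i')).mul h

theorem discrepancy_setGap {k : ℕ} {b : Bool} {w : Space} {ℓ : ℕ} {R : Finset ℕ} {i i' : Fin 3}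
    {g : ℕ → ℝ × Mark} {a : ℕ} (ha : a ∈ R) (t : ℝ) :
    discrepancy k b w ℓ R i i' (setGap g a t) =
      (relSign k b w ℓ g a i - relSign k b w ℓ g a i') * t +
        ∑ n ∈ R.erase a, (relSign k b w ℓ g n i - relSign k b w ℓ g n i') * (g n).1 := by
  rw [discrepancy, ← Finset.add_sum_erase R _ ha, setGap_self, relSign_setGap]
  congr 1
  refine Finset.sum_congr rfl fun n hn => ?_
  rw [setGap_of_ne t (Finset.ne_of_mem_erase hn)]

theorem expLaw_discrepancy_le {k : ℕ} {b : Bool} {w : Space} (hw : ∀ i, w i ≠ 0) {ℓ : ℕ}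
    {R : Finset ℕ} {i i' : Fin 3} {g : ℕ → ℝ × Mark} {a : ℕ} (ha : a ∈ R)
    (hne : relSign k b w ℓ g a i ≠ relSign k b w ℓ g a i') (κ : ℝ) :
    expLaw {t | |discrepancy k b w ℓ R i i' (setGap g a t)| ≤ κ} ≤ ENNReal.ofReal (2 * κ) := by
  simp only [discrepancy_setGap ha]
  refine expLaw_abs_le ?_
  rcases relSign_eq_or (k := k) (b := b) hw ℓ g a i with h | h <;>
    rcases relSign_eq_or (k := k) (b := b) hw ℓ g a i' with h' | h' <;>
    rw [h, h'] at hne ⊢ <;> norm_num at hne <;> norm_num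

theorem discrepancy_setGap_of_eq {k : ℕ} {b : Bool} {w : Space} {ℓ : ℕ} {R : Finset ℕ}
    {i i' : Fin 3} {g : ℕ → ℝ × Mark} {a : ℕ}
    (heq : relSign k b w ℓ g a i = relSign k b w ℓ g a i') (t : ℝ) :
    discrepancy k b w ℓ R i i' (setGap g a t) = discrepancy k b w ℓ R i i' g := by
  refine Finset.sum_congr rfl fun n _ => ?_
  rw [relSign_setGap]
  by_cases h : n = a
  · rw [h, heq, sub_self, zero_mul, zero_mul]
  · rw [setGap_of_ne t h]

/-! ### Improbable events -/

/-- Two discrepancies are small, and the gaps `a` and `b'` both matter: the gap `b'` occurs in the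
first one and not in the second one, where the gap `a` occurs. -/
def twoReturns (k : ℕ) (b : Bool) (w : Space) (κ : ℝ) (N ℓ : ℕ) (R : Finset ℕ) (a b' : ℕ)
    (i i' l l' : Fin 3) : Set (ℕ → ℝ × Mark) :=
  {g | (|discrepancy k b w ℓ R i i' g| ≤ κ ∧ relSign k b w ℓ g b' i ≠ relSign k b w ℓ g b' i') ∧
    (relSign k b w ℓ g b' l = relSign k b w ℓ g b' l' ∧
      |discrepancy k b w ℓ R l l' g| ≤ κ ∧ relSign k b w ℓ g a l ≠ relSign k b w ℓ g a l') ∧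
    g ∈ noGoodWindow N a b'}

/-- A discrepancy in which the gap `a` occurs is small, and another gap is short. -/
def returnAndShort (k : ℕ) (b : Bool) (w : Space) (κ : ℝ) (N ℓ : ℕ) (R : Finset ℕ) (a : ℕ)
    (i i' : Fin 3) : Set (ℕ → ℝ × Mark) :=
  {g | (|discrepancy k b w ℓ R i i' g| ≤ κ ∧ relSign k b w ℓ g a i ≠ relSign k b w ℓ g a i') ∧
    (g k).1 ≤ κ ∧ g ∈ noGoodWindow N a k}

/-- Two gaps are short. -/
def twoShort (κ : ℝ) (N k : ℕ) : Set (ℕ → ℝ × Mark) :=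
  {g | (g N).1 ≤ κ ∧ (g k).1 ≤ κ ∧ g ∈ noGoodWindow N k k}

/-- The gap `b'` is resampled first; the constraint that remains does not depend on it, and is
treated by resampling the gap `a`. -/
theorem gapsLaw_twoReturns_le (p : ProbVector) (k : ℕ) (b : Bool) {w : Space}
    (hw : ∀ i, w i ≠ 0) (κ : ℝ) (N ℓ : ℕ) {R : Finset ℕ} {a b' : ℕ} (ha : a ∈ R) (hb' : b' ∈ R)
    (i i' l l' : Fin 3) : gapsLaw p (twoReturns k b w κ N ℓ R a b' i i' l l') ≤
      ENNReal.ofReal (2 * κ) * (ENNReal.ofReal (2 * κ) * gapsLaw p (noGoodWindow N a b')) := by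
  have hD : ∀ i i', MeasurableSet {g | |discrepancy k b w ℓ R i i' g| ≤ κ} := fun i i' =>
    measurableSet_le ((measurable_discrepancy k b w ℓ R i i').norm) measurable_const
  have hE : ∀ n i i', MeasurableSet {g | relSign k b w ℓ g n i = relSign k b w ℓ g n i'} :=
    fun n i i' => measurableSet_eq_fun (measurable_relSign _ _ _ _ _ _)
      (measurable_relSign _ _ _ _ _ _)
  have hN := measurableSet_noGoodWindow N a b'
  have hS'' : MeasurableSet {g | (|discrepancy k b w ℓ R l l' g| ≤ κ ∧
      relSign k b w ℓ g a l ≠ relSign k b w ℓ g a l') ∧ g ∈ noGoodWindow N a b'} :=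
    ((hD l l').inter (hE a l l').compl).inter hN
  have hS' : MeasurableSet {g | (relSign k b w ℓ g b' l = relSign k b w ℓ g b' l' ∧
      |discrepancy k b w ℓ R l l' g| ≤ κ ∧ relSign k b w ℓ g a l ≠ relSign k b w ℓ g a l') ∧
      g ∈ noGoodWindow N a b'} :=
    ((hE b' l l').inter ((hD l l').inter (hE a l l').compl)).inter hN
  refine (gapsLaw_le_mul p (((hD i i').inter (hE b' i i').compl).inter hS') hS'
    (fun g hg => hg.2) (a := b') (fun g t => ?_) (fun g hg => ?_)).trans
    (mul_le_mul_right ?_ _)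
  · simp only [Set.mem_ofPred_eq, relSign_setGap, setGap_mem_noGoodWindow (Or.inr rfl)]
    refine and_congr_left fun _ => and_congr_right fun h => ?_
    rw [discrepancy_setGap_of_eq h]
  · by_cases hne : relSign k b w ℓ g b' i ≠ relSign k b w ℓ g b' i'
    · exact (measure_mono fun t ht => ht.1.1).trans (expLaw_discrepancy_le hw hb' hne κ)
    · refine (measure_mono (t := ∅) fun t ht => hne ?_).trans (by simp)
      have := ht.1.2
      simpa only [relSign_setGap, Set.mem_compl_iff, Set.mem_ofPred_eq] using this
  · have hsub : {g | (relSign k b w ℓ g b' l = relSign k b w ℓ g b' l' ∧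
      |discrepancy k b w ℓ R l l' g| ≤ κ ∧ relSign k b w ℓ g a l ≠ relSign k b w ℓ g a l') ∧
      g ∈ noGoodWindow N a b'} ⊆ {g | (|discrepancy k b w ℓ R l l' g| ≤ κ ∧
      relSign k b w ℓ g a l ≠ relSign k b w ℓ g a l') ∧ g ∈ noGoodWindow N a b'} :=
      fun g hg => ⟨hg.1.2, hg.2⟩
    refine (measure_mono hsub).trans (gapsLaw_le_mul p hS'' hN
      (fun g hg => hg.2) (a := a) (fun g t => setGap_mem_noGoodWindow (Or.inl rfl) g t)
      (fun g hg => ?_))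
    by_cases hne : relSign k b w ℓ g a l ≠ relSign k b w ℓ g a l'
    · exact (measure_mono fun t ht => ht.1.1).trans (expLaw_discrepancy_le hw ha hne κ)
    · refine (measure_mono (t := ∅) fun t ht => hne ?_).trans (by simp)
      have := ht.1.2
      simpa only [relSign_setGap] using this

theorem expLaw_setGap_le (g : ℕ → ℝ × Mark) (k : ℕ) {κ : ℝ} :
    expLaw {t | (setGap g k t k).1 ≤ κ} ≤ ENNReal.ofReal (2 * κ) := by
  simp only [setGap_self]
  rcases le_or_gt κ 0 with h | h
  · exact (measure_mono (Set.Iic_subset_Iic.2 h)).trans (expLaw_Iic_zero.le.trans bot_le)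
  · exact (expLaw_Iic_le κ).trans (ENNReal.ofReal_le_ofReal (by linarith))

theorem measurableSet_gap_le (k : ℕ) (κ : ℝ) :
    MeasurableSet {g : ℕ → ℝ × Mark | (g k).1 ≤ κ} :=
  measurableSet_le (by fun_prop) measurable_const

theorem gapsLaw_short_le (p : ProbVector) (κ : ℝ) (N a k : ℕ) :
    gapsLaw p {g | (g k).1 ≤ κ ∧ g ∈ noGoodWindow N a k} ≤
      ENNReal.ofReal (2 * κ) * gapsLaw p (noGoodWindow N a k) := by
  refine gapsLaw_le_mul p ((measurableSet_gap_le k κ).inter (measurableSet_noGoodWindow N a k))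
    (measurableSet_noGoodWindow N a k) (fun g hg => hg.2) (a := k)
    (fun g t => setGap_mem_noGoodWindow (Or.inr rfl) g t) (fun g hg => ?_)
  exact (measure_mono fun t ht => ht.1).trans (expLaw_setGap_le g k)

theorem gapsLaw_returnAndShort_le (p : ProbVector) (k : ℕ) (b : Bool) {w : Space}
    (hw : ∀ i, w i ≠ 0) (κ : ℝ) (N ℓ : ℕ) {R : Finset ℕ} {a : ℕ} (ha : a ∈ R) (hak : a ≠ k)
    (i i' : Fin 3) : gapsLaw p (returnAndShort k b w κ N ℓ R a i i') ≤
      ENNReal.ofReal (2 * κ) * (ENNReal.ofReal (2 * κ) * gapsLaw p (noGoodWindow N a k)) := by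
  have hD : MeasurableSet {g | |discrepancy k b w ℓ R i i' g| ≤ κ} :=
    measurableSet_le ((measurable_discrepancy k b w ℓ R i i').norm) measurable_const
  have hE : MeasurableSet {g | relSign k b w ℓ g a i = relSign k b w ℓ g a i'} :=
    measurableSet_eq_fun (measurable_relSign _ _ _ _ _ _) (measurable_relSign _ _ _ _ _ _)
  have hS' : MeasurableSet {g | (g k).1 ≤ κ ∧ g ∈ noGoodWindow N a k} :=
    (measurableSet_gap_le k κ).inter (measurableSet_noGoodWindow N a k)
  refine (gapsLaw_le_mul p ((hD.inter hE.compl).inter hS') hS'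
    (fun g hg => hg.2) (a := a) (fun g t => ?_) (fun g hg => ?_)).trans
    (mul_le_mul_right (gapsLaw_short_le p κ N a k) _)
  · simp only [Set.mem_ofPred_eq, setGap_mem_noGoodWindow (Or.inl rfl), setGap_of_ne t hak.symm]
  · by_cases hne : relSign k b w ℓ g a i ≠ relSign k b w ℓ g a i'
    · exact (measure_mono fun t ht => ht.1.1).trans (expLaw_discrepancy_le hw ha hne κ)
    · refine (measure_mono (t := ∅) fun t ht => hne ?_).trans (by simp)
      have := ht.1.2
      simpa only [relSign_setGap, Set.mem_compl_iff, Set.mem_ofPred_eq] using this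

theorem gapsLaw_twoShort_le (p : ProbVector) (κ : ℝ) {N k : ℕ} (hk : k < N) :
    gapsLaw p (twoShort κ N k) ≤
      ENNReal.ofReal (2 * κ) * (ENNReal.ofReal (2 * κ) * gapsLaw p (noGoodWindow N k k)) := by
  have hS' : MeasurableSet {g | (g k).1 ≤ κ ∧ g ∈ noGoodWindow N k k} :=
    (measurableSet_gap_le k κ).inter (measurableSet_noGoodWindow N k k)
  refine (gapsLaw_le_mul p ((measurableSet_gap_le N κ).inter hS') hS'
    (fun g hg => hg.2) (a := N) (fun g t => ?_) (fun g hg => ?_)).trans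
    (mul_le_mul_right (gapsLaw_short_le p κ N k k) _)
  · simp only [Set.mem_ofPred_eq, setGap_of_ne t hk.ne]
    refine and_congr_right fun _ => forall_congr' fun q => forall_congr' fun hq =>
      forall_congr' fun _ => forall_congr' fun _ => not_congr (forall_congr' fun j => ?_)
    rw [setGap_of_ne t (by omega)]
  · exact (measure_mono fun t ht => ht.1).trans (expLaw_setGap_le g N)

/-! ### A mismatch requires a return -/

section Return

variable {r m : ℝ} {z : ZState} {w : Space} {g : ℕ → ℝ × Mark} {k N : ℕ} {b : Bool}

/-- When a mismatch occurs, the particle returns to the vicinity of an earlier position: the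
displacements during the flights from number `j` to number `N` almost cancel, if the first or the
last one of them is taken into account in part only. -/
theorem exists_return_of_mismatch (hr : 0 < r) (hm : 0 < m) (hm1 : m ≤ 1)
    (hnear : ∀ n ≤ N + 1, ∀ c, (zRun r z g n).last = some c →
      ∀ l, |(zRun r z g n).phase.1 l - c l| ≤ r / 2)
    (hmotion : ∀ n ≤ N, ∀ s ∈ Set.Icc 0 (g n).1, ∀ l,
      |(flight r (zRun r z g n).obstacles (zRun r z g n).phase s).1 l -
        (zRun r z g n).phase.1 l - s * velBefore k b w g n l|
          ≤ if n = k + 1 then 2 * r / m else 0)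
    (hT : ∀ n ≤ N, 0 < (g n).1) (hmk : ∀ j, |(g N).2.2 j| ≤ 1 / 2)
    (hmis : ¬NoMismatch r z g N) :
    ∃ j ℓ, j + 2 ≤ N ∧ (ℓ = j ∨ ℓ = N) ∧ ∃ s, 0 ≤ s ∧ ∀ l,
      |∑ n ∈ (Finset.Icc j N).erase ℓ, (g n).1 * velBefore k b w g n l +
        s * velBefore k b w g ℓ l| ≤ 5 * r / m := by
  classical
  set e : ℕ → ℝ := fun n => if n = k + 1 then 2 * r / m else 0 with he
  set x : ℕ → Space := fun n => (zRun r z g n).phase.1 with hx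
  set W := velBefore k b w g with hW
  have hrm : 0 ≤ 2 * r / m := by positivity
  have he0 : ∀ n, 0 ≤ e n := fun n => by simp only [he]; split_ifs <;> simp [hrm]
  have hele : ∀ n, e n ≤ 2 * r / m := fun n => by simp only [he]; split_ifs <;> simp [hrm]
  have hrr : r ≤ r / m := by rw [le_div_iff₀ hm]; nlinarith
  have hsum : ∀ R : Finset ℕ, ∑ n ∈ R, e n ≤ 2 * r / m := fun R => by
    simp only [he, Finset.sum_ite_eq']
    split_ifs <;> simp [hrm]
  have hpath : ∀ j n, j ≤ n → n ≤ N + 1 → ∀ l,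
      |x n l - x j l - ∑ i ∈ Finset.Ico j n, (g i).1 * W i l| ≤ ∑ i ∈ Finset.Ico j n, e i := by
    intro j n hjn
    induction n, hjn using Nat.le_induction with
    | base => simp
    | succ n hjn ih =>
      intro hn l
      have h1 := ih (by omega) l
      have h2 := hmotion n (by omega) (g n).1 ⟨(hT n (by omega)).le, le_rfl⟩ l
      have h3 : (flight r (zRun r z g n).obstacles (zRun r z g n).phase (g n).1).1 = x (n + 1) :=
        rfl
      rw [h3] at h2
      rw [Finset.sum_Ico_succ_top hjn, Finset.sum_Ico_succ_top hjn]
      rw [abs_le] at h1 h2 ⊢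
      constructor <;> simp only [he, hx] at * <;> linarith
  by_cases havoid : ∀ j, j + 2 ≤ N → ∀ c, (zRun r z g j).last = some c → ∀ s ∈ Set.Ioc 0 (g N).1,
    (flight r (zRun r z g N).obstacles (zRun r z g N).phase s).1 - c ∉ cube r
  · -- the new obstacle would contain a point of the stretch `j`, of which the part after that point
    -- counts
    have hun : ¬∀ j, j + 2 ≤ N →
        ∀ y ∈ trace r (zRun r z g j).obstacles (zRun r z g j).phase (g j).1,
          y - (((zRun r z g N).before r (g N).1).1 +
            impact r (g N).2 ((zRun r z g N).before r (g N).1).2) ∉ cube r :=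
      fun h => hmis ⟨havoid, h⟩
    push Not at hun
    obtain ⟨j, hj, y, ⟨s, hs, rfl⟩, hy⟩ := hun
    refine ⟨j, j, hj, Or.inl rfl, (g j).1 - s, by linarith [hs.2], fun l => ?_⟩
    have h1 := hmotion j (by omega) s ⟨hs.1.le, hs.2⟩ l
    have h2 := hpath j (N + 1) (by omega) le_rfl l
    have h3 := hsum (Finset.Ico j (N + 1))
    have h4 : |((flight r (zRun r z g j).obstacles (zRun r z g j).phase s).1 -
        (x (N + 1) + impact r (g N).2 ((zRun r z g N).before r (g N).1).2)) l| ≤ r / 2 := hy l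
    have h5 := abs_impact_le hr hmk ((zRun r z g N).before r (g N).1).2 l
    have h6 := hele j
    have hIco : Finset.Ico j (N + 1) = Finset.Icc j N := rfl
    rw [hIco, ← Finset.add_sum_erase _ (fun n => (g n).1 * W n l)
      (Finset.mem_Icc.2 ⟨le_rfl, by omega⟩ : j ∈ Finset.Icc j N)] at h2
    rw [hIco] at h3
    simp only [PiLp.sub_apply, PiLp.add_apply] at h4
    have h7 : 5 * r / m = r / m + 2 * (2 * r / m) := by ring
    rw [h7]
    have h8 := (abs_le.1 h1)
    have h9 := (abs_le.1 h2)
    have h10 := abs_le.1 h4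
    have h11 := abs_le.1 h5
    have h12 : (if j = k + 1 then 2 * r / m else 0) = e j := rfl
    rw [h12] at h8
    simp only [hx] at *
    rw [abs_le]
    constructor <;> nlinarith
  · -- during the stretch `N` the particle runs into the obstacle placed before the stretch `j`
    push Not at havoid
    obtain ⟨j, hj, c, hc, s, hs, hy⟩ := havoid
    refine ⟨j, N, hj, Or.inr rfl, s, hs.1.le, fun l => ?_⟩
    have h1 := hmotion N le_rfl s ⟨hs.1.le, hs.2⟩ l
    have h2 := hpath j N (by omega) (by omega) l
    have h3 := hsum (Finset.Ico j (N + 1))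
    rw [Finset.sum_Ico_succ_top (by omega)] at h3
    have h4 : |((flight r (zRun r z g N).obstacles (zRun r z g N).phase s).1 - c) l| ≤ r / 2 :=
      hy l
    have h5 := hnear j (by omega) c hc l
    have hIco : (Finset.Icc j N).erase N = Finset.Ico j N := by
      ext n
      simp only [Finset.mem_erase, Finset.mem_Icc, Finset.mem_Ico]
      omega
    rw [hIco]
    simp only [PiLp.sub_apply] at h4
    have h7 : 5 * r / m = r / m + 2 * (2 * r / m) := by ring
    rw [h7]
    have h8 := (abs_le.1 h1)
    have h9 := (abs_le.1 h2)
    have h10 := abs_le.1 h4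
    have h11 := abs_le.1 h5
    have h12 : (if N = k + 1 then 2 * r / m else 0) = e N := rfl
    rw [h12] at h8
    simp only [hx] at *
    rw [abs_le]
    constructor <;> nlinarith

variable {j ℓ : ℕ} {s κ : ℝ}

theorem abs_sum_relSign_le {q : Fin 3 → ℝ} (hm : 0 < m) (hmq : ∀ i, m ≤ q i)
    (hwq : ∀ i, |w i| = q i) {R : Finset ℕ} {K : ℝ}
    {i : Fin 3} (h : |∑ n ∈ R, (g n).1 * velBefore k b w g n i + s * velBefore k b w g ℓ i| ≤ K) :
    |∑ n ∈ R, relSign k b w ℓ g n i * (g n).1 + s| ≤ K / m := by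
  have hv : |velBefore k b w g ℓ i| = q i := by rw [abs_velBefore, hwq]
  have hq : 0 < q i := hm.trans_le (hmq i)
  have hv0 : velBefore k b w g ℓ i ≠ 0 := by
    rw [← abs_pos, hv]; exact hq
  have e : ∑ n ∈ R, relSign k b w ℓ g n i * (g n).1 + s =
      (∑ n ∈ R, (g n).1 * velBefore k b w g n i + s * velBefore k b w g ℓ i) /
        velBefore k b w g ℓ i := by
    rw [add_div, mul_div_cancel_right₀ _ hv0, Finset.sum_div]
    congr 1
    refine Finset.sum_congr rfl fun n _ => ?_
    rw [relSign]
    ring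
  rw [e, abs_div, hv]
  have hK : 0 ≤ K := (abs_nonneg _).trans h
  exact div_le_div₀ hK h hm (hmq i)

theorem abs_discrepancy_le {R : Finset ℕ}
    (h : ∀ i, |∑ n ∈ R, relSign k b w ℓ g n i * (g n).1 + s| ≤ κ) (i i' : Fin 3) :
    |discrepancy k b w ℓ R i i' g| ≤ 2 * κ := by
  have e : discrepancy k b w ℓ R i i' g =
      (∑ n ∈ R, relSign k b w ℓ g n i * (g n).1 + s) -
        (∑ n ∈ R, relSign k b w ℓ g n i' * (g n).1 + s) := by
    rw [add_sub_add_right_eq_sub, ← Finset.sum_sub_distrib]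
    exact Finset.sum_congr rfl fun n _ => sub_mul _ _ _
  rw [e]
  have h1 := abs_le.1 (h i)
  have h2 := abs_le.1 (h i')
  rw [abs_le]
  constructor <;> linarith

/-- In a coordinate of constant sign displacements do not cancel. -/
theorem not_constant_of_long {R : Finset ℕ} (hs : 0 ≤ s) (hT : ∀ n ∈ R, 0 < (g n).1)
    (h : ∀ i, |∑ n ∈ R, relSign k b w ℓ g n i * (g n).1 + s| ≤ κ) {a : ℕ} (ha : a ∈ R)
    (hlong : κ < (g a).1) {i : Fin 3} (hi : ∀ n ∈ R, relSign k b w ℓ g n i = 1) : False := by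
  have h1 := (abs_le.1 (h i)).2
  rw [Finset.sum_congr rfl fun n hn => by rw [hi n hn, one_mul]] at h1
  have h2 := Finset.single_le_sum (f := fun n => (g n).1) (fun n hn => (hT n hn).le) ha
  linarith

/-- A return without a short flight satisfies two independent constraints. -/
theorem exists_mem_twoReturns (hw : ∀ i, w i ≠ 0) (hjN : j + 2 ≤ N) (hℓ : ℓ = j ∨ ℓ = N)
    (hs : 0 ≤ s) (hκ : 0 ≤ κ) (hk : N < k)
    (h : ∀ i, |∑ n ∈ (Finset.Icc j N).erase ℓ, relSign k b w ℓ g n i * (g n).1 + s| ≤ κ)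
    (hlong : ∀ n ≤ N, κ < (g n).1) (hgood : ∀ q, 11 * q + 11 ≤ N → ¬GoodWindow q g) :
    ∃ a ∈ (Finset.Icc j N).erase ℓ, ∃ b' ∈ (Finset.Icc j N).erase ℓ, ∃ i i' l l',
      g ∈ twoReturns k b w (2 * κ) N ℓ ((Finset.Icc j N).erase ℓ) a b' i i' l l' := by
  have hR : ∀ n ∈ (Finset.Icc j N).erase ℓ, n ≤ N := fun n hn => by
    simp only [Finset.mem_erase, Finset.mem_Icc] at hn
    omega
  rcases exists_two_differences (h := relSign k b w ℓ g) hjN hℓ (relSign_self hw ℓ g)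
    (fun n _ hn => oneFlip_relSign (Or.inl (by omega)))
    (fun n i => div_ne_zero (velBefore_ne_zero hw g n i) (velBefore_ne_zero hw g ℓ i)) with
    ⟨a, ha, b', hb', i, i', l, l', h1, h2, h3⟩ | ⟨i, hi⟩
  · exact ⟨a, ha, b', hb', i, i', l, l', ⟨abs_discrepancy_le h i i', h1⟩,
      ⟨h2, abs_discrepancy_le h l l', h3⟩, fun _ hq _ _ => hgood _ hq⟩
  · obtain ⟨a, ha⟩ : ((Finset.Icc j N).erase ℓ).Nonempty := by
      rcases hℓ with rfl | rfl
      · exact ⟨N, by simp; omega⟩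
      · exact ⟨j, by simp; omega⟩
    exact (not_constant_of_long hs (fun n hn => hκ.trans_lt (hlong n (hR n hn))) h ha
      (hlong a (hR a ha)) hi).elim

/-- A return with a short flight satisfies one more constraint. -/
theorem exists_mem_returnAndShort (hw : ∀ i, w i ≠ 0) (hjN : j + 2 ≤ N) (hℓ : ℓ = j ∨ ℓ = N)
    (hs : 0 ≤ s) (hκ : 0 ≤ κ) (hk : (g k).1 ≤ κ) (hT : ∀ n ≤ N, 0 < (g n).1)
    (h : ∀ i, |∑ n ∈ (Finset.Icc j N).erase ℓ, relSign k b w ℓ g n i * (g n).1 + s| ≤ κ)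
    (hlong : ∀ n ≤ N, n ≠ k → κ < (g n).1) (hgood : ∀ q, 11 * q + 11 ≤ N → ¬GoodWindow q g) :
    ∃ a ∈ (Finset.Icc j N).erase ℓ, a ≠ k ∧ ∃ i i',
      g ∈ returnAndShort k b w (2 * κ) N ℓ ((Finset.Icc j N).erase ℓ) a i i' := by
  have hR : ∀ n ∈ (Finset.Icc j N).erase ℓ, n ≤ N := fun n hn => by
    simp only [Finset.mem_erase, Finset.mem_Icc] at hn
    omega
  have hkk : OneFlip (relSign k b w ℓ g k) (relSign k b w ℓ g (k + 1)) ∨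
      relSign k b w ℓ g (k + 1) = relSign k b w ℓ g k := by
    cases b with
    | true => exact Or.inl (oneFlip_relSign (Or.inr rfl))
    | false =>
      right
      funext i
      simp [relSign, velBefore]
  rcases exists_difference (h := relSign k b w ℓ g) (k := k) hjN hℓ (relSign_self hw ℓ g)
    (fun n _ hn hnk => oneFlip_relSign (Or.inl hnk)) hkk
    (fun n i => div_ne_zero (velBefore_ne_zero hw g n i) (velBefore_ne_zero hw g ℓ i)) with
    ⟨a, ha, hak, i, i', h1⟩ | ⟨i, a, ha, hak, hi⟩
  · exact ⟨a, ha, hak, i, i', ⟨abs_discrepancy_le h i i', h1⟩, by linarith,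
      fun _ hq _ _ => hgood _ hq⟩
  · exact (not_constant_of_long hs (fun n hn => hT n (hR n hn)) h ha
      (hlong a (hR a ha) hak) hi).elim

end Return

/-! ### Dependence on finitely many gaps and marks -/

section Congr

variable {k N : ℕ} {b : Bool} {w : Space} {g g' : ℕ → ℝ × Mark}

theorem velBefore_congr {n : ℕ} (h : ∀ i < n, g i = g' i) :
    velBefore k b w g n = velBefore k b w g' n := by
  induction n with
  | zero => rfl
  | succ n ih =>
    rw [velBefore, velBefore, ih fun i hi => h i (by omega), h n (by omega)]

theorem relSign_congr {ℓ n : ℕ} (hℓ : ℓ ≤ N) (hn : n ≤ N) (h : ∀ i ≤ N, g i = g' i) :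
    relSign k b w ℓ g n = relSign k b w ℓ g' n := by
  funext i
  rw [relSign, relSign, velBefore_congr fun i hi => h i (by omega),
    velBefore_congr (n := ℓ) fun i hi => h i (by omega)]

theorem discrepancy_congr {ℓ : ℕ} {R : Finset ℕ} (hℓ : ℓ ≤ N) (hR : ∀ n ∈ R, n ≤ N)
    (h : ∀ i ≤ N, g i = g' i) (i i' : Fin 3) :
    discrepancy k b w ℓ R i i' g = discrepancy k b w ℓ R i i' g' := by
  refine Finset.sum_congr rfl fun n hn => ?_
  rw [relSign_congr hℓ (hR n hn) h, h n (hR n hn)]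

theorem goodWindow_congr {q : ℕ} (hq : 11 * q + 11 ≤ N) (h : ∀ i < N, g i = g' i) :
    GoodWindow q g ↔ GoodWindow q g' :=
  forall_congr' fun j => by rw [h _ (by omega)]

theorem mem_noGoodWindow_congr {a c : ℕ} (h : ∀ i < N, g i = g' i) :
    g ∈ noGoodWindow N a c ↔ g' ∈ noGoodWindow N a c :=
  forall_congr' fun _ => forall_congr' fun hq => forall_congr' fun _ => forall_congr' fun _ =>
    not_congr (goodWindow_congr hq h)

theorem mem_twoReturns_congr {κ : ℝ} {ℓ : ℕ} {R : Finset ℕ} {a b' : ℕ} {i i' l l' : Fin 3}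
    (hℓ : ℓ ≤ N) (hR : ∀ n ∈ R, n ≤ N) (ha : a ∈ R) (hb' : b' ∈ R) (h : ∀ i ≤ N, g i = g' i) :
    g ∈ twoReturns k b w κ N ℓ R a b' i i' l l' ↔ g' ∈ twoReturns k b w κ N ℓ R a b' i i' l l' := by
  simp only [twoReturns, Set.mem_ofPred_eq, discrepancy_congr hℓ hR h,
    relSign_congr hℓ (hR a ha) h, relSign_congr hℓ (hR b' hb') h,
    mem_noGoodWindow_congr fun i hi => h i hi.le]

theorem mem_returnAndShort_congr {κ : ℝ} {ℓ : ℕ} {R : Finset ℕ} {a : ℕ} {i i' : Fin 3}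
    (hℓ : ℓ ≤ N) (hR : ∀ n ∈ R, n ≤ N) (ha : a ∈ R) (hk : k ≤ N) (h : ∀ i ≤ N, g i = g' i) :
    g ∈ returnAndShort k b w κ N ℓ R a i i' ↔ g' ∈ returnAndShort k b w κ N ℓ R a i i' := by
  simp only [returnAndShort, Set.mem_ofPred_eq, discrepancy_congr hℓ hR h,
    relSign_congr hℓ (hR a ha) h, h k hk, mem_noGoodWindow_congr fun i hi => h i hi.le]

end Congr

/-! ### Regular noise -/

/-- The clocks of a block are positive, two of them do not ring at the same time, and the relative
points of impact are on the faces. These properties hold almost surely. -/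
structure Noise.Regular (η : Noise) : Prop where
  clock_pos : ∀ i, 0 < η.clock i
  clock_ne : η.clock 0 ≠ η.clock 1
  markY_le : ∀ i j, |(η.markY i).2 j| ≤ 1 / 2
  markZ_le : ∀ i j, |(η.markZ i).2 j| ≤ 1 / 2

theorem Machine.regular_of_mem_feed {σ : Type*} {M : Machine σ} {u : Space} {η : Noise}
    (hη : η.Regular) {l : List (Fin 3 × ℝ)} (hl : ∀ a ∈ l, 0 < a.2) {s : σ} {d : ℝ × Mark}
    (hd : d ∈ M.feed u η l s) : 0 < d.1 ∧ ∀ j, |d.2.2 j| ≤ 1 / 2 := by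
  induction l generalizing s with
  | nil => simp [feed] at hd
  | cons a l ih =>
    rw [feed, List.mem_cons] at hd
    rcases hd with rfl | hd
    · refine ⟨hl a (by simp), ?_⟩
      simp only [mark]
      split_ifs
      · exact hη.markY_le _
      · exact hη.markZ_le _
    · exact ih (fun a ha => hl a (by simp [ha])) hd

theorem Noise.Regular.schedule_pos {η : Noise} (hη : η.Regular) (P : Prop) :
    ∀ a ∈ schedule P η, 0 < a.2 := by
  have h0 := hη.clock_pos 0
  have h1 := hη.clock_pos 1
  have h2 := hη.clock_pos 2
  unfold schedule
  split_ifs with hP h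
  · simp [h1, h2]
  · simp [h0, h2, lt_of_le_of_ne h hη.clock_ne]
  · simp [add_pos h1 h2]

theorem Machine.stream_regular {σ : Type*} (M : Machine σ) {ω : ℕ → Noise}
    (hω : ∀ b, (ω b).Regular) (s : σ × Space) (n : ℕ) :
    0 < (M.stream s ω n).1 ∧ ∀ j, |(M.stream s ω n).2.2 j| ≤ 1 / 2 := by
  have hist : ∀ b, ∀ d ∈ M.hist s ω b, 0 < d.1 ∧ ∀ j, |d.2.2 j| ≤ 1 / 2 := by
    intro b
    induction b with
    | zero => simp [Machine.hist]
    | succ b ih =>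
      intro d hd
      rw [Machine.hist, List.mem_append] at hd
      rcases hd with hd | hd
      · exact ih d hd
      · exact regular_of_mem_feed (hω b) ((hω b).schedule_pos _) hd
  have h := M.hist_getElem? s ω (M.le_length_hist s ω (n + 1))
  exact hist (n + 1) _ (List.mem_of_getElem? h)

theorem ae_regular_block (p : ProbVector) : ∀ᵐ η ∂blockLaw p, η.Regular := by
  have hclock : ∀ᵐ c ∂(Measure.pi fun _ : Fin 3 => expLaw), (∀ i, 0 < c i) ∧ c 0 ≠ c 1 := by
    refine Filter.Eventually.and ?_ ?_
    · rw [ae_all_iff]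
      intro i
      exact (measurePreserving_eval (fun _ : Fin 3 => expLaw) i).quasiMeasurePreserving.ae
        ae_expLaw_pos
    · rw [ae_iff]
      have hset : MeasurableSet {c : Fin 3 → ℝ | ¬c 0 ≠ c 1} := by
        simp only [ne_eq, not_not]
        exact measurableSet_eq_fun (measurable_pi_apply 0) (measurable_pi_apply 1)
      rw [← lintegral_indicator_one hset, lintegral_pi_update expLaw
        (measurable_one.indicator hset) 0]
      have : ∀ c : Fin 3 → ℝ, ∫⁻ y, {c : Fin 3 → ℝ | ¬c 0 ≠ c 1}.indicator 1
          (Function.update c 0 y) ∂expLaw = 0 := fun c => by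
        have e : (fun y => {c : Fin 3 → ℝ | ¬c 0 ≠ c 1}.indicator (1 : (Fin 3 → ℝ) → ENNReal)
            (Function.update c 0 y)) = Set.indicator {c 1} 1 := by
          funext y
          by_cases h : y = c 1 <;> simp [Set.indicator, h]
        rw [e, lintegral_indicator_one (measurableSet_singleton _), expLaw_singleton]
      simp only [this, lintegral_zero]
  have hmark : ∀ᵐ y ∂(Measure.pi fun _ : Fin 3 => markLaw p), ∀ i j, |(y i).2 j| ≤ 1 / 2 := by
    rw [ae_all_iff]
    intro i
    have h1 : ∀ᵐ x ∂cubeLaw, ∀ j, |x j| ≤ 1 / 2 := by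
      filter_upwards [ae_restrict_mem (μ := volume) (measurableSet_Icc :
        MeasurableSet (Set.Icc (fun _ : Fin 3 => -(1 / 2 : ℝ)) fun _ => 1 / 2))] with x hx j
      exact abs_le.2 ⟨hx.1 j, hx.2 j⟩
    have h2 : ∀ᵐ m ∂markLaw p, ∀ j, |m.2 j| ≤ 1 / 2 :=
      (measurePreserving_snd (μ := flipLaw p) (ν := cubeLaw)).quasiMeasurePreserving.ae h1
    exact (measurePreserving_eval (fun _ : Fin 3 => markLaw p) i).quasiMeasurePreserving.ae h2
  have e1 : ∀ᵐ η ∂blockLaw p, (∀ i, 0 < η.clock i) ∧ η.clock 0 ≠ η.clock 1 :=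
    measurePreserving_fst.quasiMeasurePreserving.ae hclock
  have e2 : ∀ᵐ η ∂blockLaw p, ∀ i j, |(η.markY i).2 j| ≤ 1 / 2 :=
    (measurePreserving_fst.comp measurePreserving_snd).quasiMeasurePreserving.ae hmark
  have e3 : ∀ᵐ η ∂blockLaw p, ∀ i j, |(η.markZ i).2 j| ≤ 1 / 2 :=
    (measurePreserving_fst.comp (measurePreserving_snd.comp
      measurePreserving_snd)).quasiMeasurePreserving.ae hmark
  filter_upwards [e1, e2, e3] with η h1 h2 h3
  exact ⟨h1.1, h1.2, h2, h3⟩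

theorem ae_regular (p : ProbVector) : ∀ᵐ ω ∂noiseLaw p, ∀ b, (ω b).Regular := by
  rw [ae_all_iff]
  intro b
  exact (measurePreserving_eval_infinitePi (fun _ : ℕ => blockLaw p)
    b).quasiMeasurePreserving.ae (ae_regular_block p)

/-! ### A good window ends the leg -/

/-- The Hamiltonian cycle passes through every velocity `w`, wherever it begins. -/
theorem exists_eq_of_grayCode {u : ℕ → Space} {w : Space}
    (hu : ∀ j : Fin 11, u (j + 1) = signFlip (grayCode j) (u j))
    (h : ∀ i, u 1 i = w i ∨ u 1 i = -w i) : ∃ j : ℕ, 1 ≤ j ∧ j ≤ 8 ∧ u (j + 1) = w := by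
  have h1 : u 2 = signFlip 0 (u 1) := hu 1
  have h2 : u 3 = signFlip 1 (u 2) := hu 2
  have h3 : u 4 = signFlip 0 (u 3) := hu 3
  have h4 : u 5 = signFlip 2 (u 4) := hu 4
  have h5 : u 6 = signFlip 0 (u 5) := hu 5
  have h6 : u 7 = signFlip 1 (u 6) := hu 6
  have h7 : u 8 = signFlip 0 (u 7) := hu 7
  have h8 : u 9 = signFlip 2 (u 8) := hu 8
  have key : ∀ v : Space, v 0 = w 0 → v 1 = w 1 → v 2 = w 2 → v = w := fun v e0 e1 e2 => by
    ext i
    fin_cases i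
    · exact e0
    · exact e1
    · exact e2
  rcases h 0 with e0 | e0 <;> rcases h 1 with e1 | e1 <;> rcases h 2 with e2 | e2
  · refine ⟨8, by norm_num, le_rfl, key _ ?_ ?_ ?_⟩ <;>
      simp [h1, h2, h3, h4, h5, h6, h7, h8, signFlip_apply, e0, e1, e2]
  · refine ⟨7, by norm_num, by norm_num, key _ ?_ ?_ ?_⟩ <;>
      simp [h1, h2, h3, h4, h5, h6, h7, signFlip_apply, e0, e1, e2]
  · refine ⟨3, by norm_num, by norm_num, key _ ?_ ?_ ?_⟩ <;>
      simp [h1, h2, h3, signFlip_apply, e0, e1, e2]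
  · refine ⟨4, by norm_num, by norm_num, key _ ?_ ?_ ?_⟩ <;>
      simp [h1, h2, h3, h4, signFlip_apply, e0, e1, e2]
  · refine ⟨1, by norm_num, by norm_num, key _ ?_ ?_ ?_⟩ <;>
      simp [h1, signFlip_apply, e0, e1, e2]
  · refine ⟨6, by norm_num, by norm_num, key _ ?_ ?_ ?_⟩ <;>
      simp [h1, h2, h3, h4, h5, h6, signFlip_apply, e0, e1, e2]
  · refine ⟨2, by norm_num, by norm_num, key _ ?_ ?_ ?_⟩ <;>
      simp [h1, h2, signFlip_apply, e0, e1, e2]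
  · refine ⟨5, by norm_num, by norm_num, key _ ?_ ?_ ?_⟩ <;>
      simp [h1, h2, h3, h4, h5, signFlip_apply, e0, e1, e2]

section Leg

variable {r : ℝ} {w β₀ : Space} {ω : ℕ → Noise} {N k : ℕ} {b : Bool}

/-- The leg ends at the latest within the first good window, so that the processes agree during the
leg if a good window precedes the first mismatch. The short gap `k` is not part of a good window. -/
theorem mem_agreement_of_goodWindow (hω : ∀ b, (ω b).Regular)
    (ht : ∀ n < N, Tame r (zRun r (initialZ w β₀) (zStream r w β₀ ω) n).obstacles
      (zRun r (initialZ w β₀) (zStream r w β₀ ω) n).phase)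
    (hm : ∀ n < N, NoMismatch r (initialZ w β₀) (zStream r w β₀ ω) n)
    (hv : ∀ n < N, ((zRun r (initialZ w β₀) (zStream r w β₀ ω) n).before r
      (zStream r w β₀ ω n).1).2 = velBefore k b w (zStream r w β₀ ω) n)
    (hk : k < N → (zStream r w β₀ ω k).1 ≤ 1) {q : ℕ} (hq : 11 * q + 11 ≤ N)
    (hgood : GoodWindow q (zStream r w β₀ ω)) : ω ∈ agreement r w β₀ := by
  set g := zStream r w β₀ ω with hg
  have hne : ∀ j : Fin 11, 11 * q + j ≠ k := fun j h => by
    have h1 := (hgood j).1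
    rw [h] at h1
    exact absurd (hk (by omega)) (not_le.2 h1)
  obtain ⟨j, hj1, hj8, hj⟩ := exists_eq_of_grayCode
    (u := fun j => velBefore k b w g (11 * q + j)) (w := w) (fun j => by
      rw [← add_assoc, velBefore_succ_of_ne (hne j), (hgood j).2]) (fun i => by
      have := abs_velBefore (k := k) (b := b) (w := w) (g := g) (11 * q + 1) i
      exact abs_eq_abs.1 this)
  have hlong : ∀ i, i < 11 → 1 < (g (11 * q + i)).1 := fun i hi => (hgood ⟨i, hi⟩).1
  obtain ⟨j, rfl⟩ : ∃ i, j = i + 1 := ⟨j - 1, by omega⟩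
  refine mem_agreement (N := N) (n := 11 * q + j) (fun b i => ((hω b).clock_pos i).le) ht hm
    (by omega) (fun i hi => ?_) ?_
  · rw [add_assoc]
    exact hlong _ (by omega)
  · rw [hv _ (by omega), newVelocity]
    exact (velBefore_succ_of_ne (hne ⟨j + 1, by omega⟩)).symm.trans hj

/-- The gaps and marks of the process of velocities which imitates the forgetful process when the
attempt `k` has the outcome described by `a` and `b`. -/
noncomputable def velStream (k : ℕ) (a b : Bool) (w : Space) (ω : ℕ → Noise) : ℕ → ℝ × Mark :=
  (velMachine k a b).stream ((0, w, w), w) ω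

/-- The state at time `0` is clear of the first obstacle. -/
theorem initialZ_clear {q : Fin 3 → ℝ} {u : Space} (hr : 0 < r) (hwq : ∀ i, |w i| = q i)
    (hq : ∀ i, 0 < q i) (hβ : β₀ ∈ -hitFace r u w) : (initialZ w β₀).Clear r q := by
  obtain ⟨hfr, i, hi, hβi⟩ := hβ
  have hcube : -β₀ ∈ cube r := isClosed_cube.frontier_subset hfr
  refine ⟨hwq, fun c hc => ?_, fun c hc l => ?_, fun c hc => ?_, ⟨0, fun y hy => ?_⟩⟩
  · obtain rfl : β₀ = c := Option.some.inj hc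
    refine ⟨i, ?_⟩
    have hwi : w i = -u i := by rw [hi, signFlip_apply, if_pos rfl]
    have hu : 0 < |u i| := by
      have := hq i
      rwa [← hwq i, hwi, abs_neg] at this
    have hβi' : -(β₀ i) = -(u i / |u i|) * (r / 2) := hβi
    have h0 : ((initialZ w β₀).phase.1 i - β₀ i) * (initialZ w β₀).phase.2 i = -β₀ i * w i := by
      simp [initialZ, initialState]
    have h1 : (initialZ w β₀).phase.2 i = w i := rfl
    rw [h0, h1, hβi', hwi, abs_neg]
    field_simp
    rw [sq_abs]
  · obtain rfl : β₀ = c := Option.some.inj hc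
    have : |(-β₀) l| ≤ r / 2 := hcube l
    simpa [initialZ, initialState] using this
  · exact absurd hc (by simp [initialZ, initialState])
  · exact absurd hy (by simp [initialZ, initialState])

variable {q : Fin 3 → ℝ} {m κ : ℝ}

/-- Before the second short gap the forgetful process is imitated by a process of velocities. -/
theorem exists_velStream (hω : ∀ b, (ω b).Regular) (hr : 0 < r) (hm : 0 < m)
    (hmq : ∀ i, m ≤ q i) (hq1 : ∀ i, q i ≤ 1)
    (hz : (initialZ w β₀).Clear r q) (hκ : r / m ≤ κ)
    (hlong : ∀ n < N, n ≠ k → κ < (zStream r w β₀ ω n).1) : ∃ a b,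
    (∀ n ≤ N, ∀ c, (zRun r (initialZ w β₀) (zStream r w β₀ ω) n).last = some c →
      ∀ l, |(zRun r (initialZ w β₀) (zStream r w β₀ ω) n).phase.1 l - c l| ≤ r / 2) ∧
    (∀ n < N, Tame r (zRun r (initialZ w β₀) (zStream r w β₀ ω) n).obstacles
      (zRun r (initialZ w β₀) (zStream r w β₀ ω) n).phase) ∧
    (∀ n < N, ((zRun r (initialZ w β₀) (zStream r w β₀ ω) n).before r
      (zStream r w β₀ ω n).1).2 = velBefore k b w (zStream r w β₀ ω) n) ∧
    (∀ n < N, ∀ s ∈ Set.Icc 0 (zStream r w β₀ ω n).1, ∀ l,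
      |(flight r (zRun r (initialZ w β₀) (zStream r w β₀ ω) n).obstacles
          (zRun r (initialZ w β₀) (zStream r w β₀ ω) n).phase s).1 l -
        (zRun r (initialZ w β₀) (zStream r w β₀ ω) n).phase.1 l -
          s * velBefore k b w (zStream r w β₀ ω) n l| ≤ if n = k + 1 then 2 * r / m else 0) ∧
    (∀ n < N, velStream k a b w ω n = zStream r w β₀ ω n) ∧
    (velStream k a b w ω N).1 = (zStream r w β₀ ω N).1 := by
  have hreg := (zMachine r).stream_regular hω (initialZ w β₀, w)
  obtain ⟨a, b, h1, h2⟩ := exists_velocities (z := initialZ w β₀) (w := w)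
    (g := zStream r w β₀ ω) (k := k) (N := N) hr hm hmq hq1 hz rfl (fun n _ => (hreg n).1)
    (fun n _ => (hreg n).2) (fun n hn hnk => hκ.trans_lt (hlong n hn hnk))
  obtain ⟨h3, h4⟩ := Machine.stream_congr (zMachine r) (velMachine k a b) N (initialZ w β₀)
    (0, w, w) w ω (fun n hn => by
      rw [zMachine_run, velMachine_run]
      exact (h1 n hn).1) (fun n hn => by
      rw [zMachine_run, velMachine_run]
      exact (h2 n hn).2.1)
  exact ⟨a, b, fun n hn => (h1 n hn).2, fun n hn => (h2 n hn).1, fun n hn => (h2 n hn).2.1,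
    fun n hn => (h2 n hn).2.2, h3, h4⟩

/-- The event that a sequence of gaps and marks satisfies, besides the absence of good windows up
to the index `N`, two approximate equations. -/
def unlikely (κ : ℝ) (w : Space) (N k : ℕ) (b : Bool) : Set (ℕ → ℝ × Mark) :=
  {g | (k < N ∧ g ∈ twoShort κ N k) ∨
    (∃ j ≤ N, ∃ ℓ ≤ N, ∃ a ≤ N, ∃ b' ≤ N, a ∈ (Finset.Icc j N).erase ℓ ∧
      b' ∈ (Finset.Icc j N).erase ℓ ∧ ∃ i i' l l',
      g ∈ twoReturns k b w κ N ℓ ((Finset.Icc j N).erase ℓ) a b' i i' l l') ∨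
    ∃ j ≤ N, ∃ ℓ ≤ N, ∃ a ≤ N, a ∈ (Finset.Icc j N).erase ℓ ∧ a ≠ k ∧ ∃ i i',
      g ∈ returnAndShort k b w κ N ℓ ((Finset.Icc j N).erase ℓ) a i i'}

/-- If at most one of the values with indices below `M` is short, its index, or `M` in the absence
of such a value, is the only exception to all values being long. -/
theorem exists_short_index {T : ℕ → ℝ} {κ : ℝ} (M : ℕ)
    (h : ∀ n < M, T n ≤ κ → ∀ k < n, κ < T k) :
    ∃ k ≤ M, (k < M → T k ≤ κ) ∧ ∀ n < M, n ≠ k → κ < T n := by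
  by_cases hex : ∃ k < M, T k ≤ κ
  · obtain ⟨k, hk, hkT⟩ := hex
    refine ⟨k, hk.le, fun _ => hkT, fun n hn hnk => ?_⟩
    by_contra! hle
    rcases lt_or_gt_of_ne hnk with hlt | hlt
    · exact absurd hle (not_le.2 (h k hk hkT n hlt))
    · exact absurd hkT (not_le.2 (h n hn hle k hlt))
  · push Not at hex
    exact ⟨M, le_rfl, fun h => absurd h (lt_irrefl _), fun n hn _ => hex n hn⟩

/-- If the processes do not agree during the leg, then some imitating process of velocities is in
an unlikely configuration, or has no good windows. -/
theorem exists_unlikely_of_not_agreement (hω : ∀ b, (ω b).Regular) (hr : 0 < r) (hm : 0 < m)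
    (hmq : ∀ i, m ≤ q i) (hq1 : ∀ i, q i ≤ 1) (hwq : ∀ i, |w i| = q i)
    (hz : (initialZ w β₀).Clear r q) (hκ : κ = 5 * r / m / m) (hκ1 : κ ≤ 1)
    (hna : ω ∉ agreement r w β₀) :
    (∃ N, ∃ k ≤ N + 1, ∃ a b, velStream k a b w ω ∈ unlikely (2 * κ) w N k b) ∨
      ∀ N, ∃ k ≤ N, ∃ a b, velStream k a b w ω ∈ noGoodWindow N k k := by
  classical
  set g := zStream r w β₀ ω with hg
  have hm1 : m ≤ 1 := (hmq 0).trans (hq1 0)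
  have hκ0 : 0 ≤ κ := by rw [hκ]; positivity
  have hκr : r / m ≤ κ := by
    rw [hκ]
    have h1 : 0 ≤ r / m := by positivity
    have h2 : 5 * r / m = 5 * (r / m) := by ring
    rw [h2, le_div_iff₀ hm]
    nlinarith
  have hw0 : ∀ i, w i ≠ 0 := fun i => by
    rw [← abs_pos, hwq]
    exact hm.trans_le (hmq i)
  have hreg := (zMachine r).stream_regular hω (initialZ w β₀, w)
  have hwin : ∀ N k b, (∀ n < N, Tame r (zRun r (initialZ w β₀) g n).obstacles
      (zRun r (initialZ w β₀) g n).phase) →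
      (∀ n < N, ((zRun r (initialZ w β₀) g n).before r (g n).1).2 = velBefore k b w g n) →
      (k < N → (g k).1 ≤ κ) → (∀ n < N, NoMismatch r (initialZ w β₀) g n) →
      ∀ q, 11 * q + 11 ≤ N → ¬GoodWindow q g := fun N k b ht hv hk hmm q hq hgood =>
    hna (mem_agreement_of_goodWindow hω ht hmm hv (fun h => (hk h).trans hκ1) hq hgood)
  -- the imitation ends with a mismatch or with a second short gap
  set Bad : ℕ → Prop := fun n => ¬NoMismatch r (initialZ w β₀) g n ∨
    ((g n).1 ≤ κ ∧ ∃ k < n, (g k).1 ≤ κ) with hBad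
  have hnotBad : ∀ n, ¬Bad n → NoMismatch r (initialZ w β₀) g n ∧
      ((g n).1 ≤ κ → ∀ k < n, κ < (g k).1) := fun n hn => by
    simp only [hBad] at hn
    push Not at hn
    exact hn
  by_cases hall : ∀ n, ¬Bad n
  · right
    intro N
    obtain ⟨k, hkN, hks, hkl⟩ := exists_short_index (T := fun n => (g n).1) N
      (fun n _ => (hnotBad n (hall n)).2)
    obtain ⟨a, b, -, ht, hv, -, hst, -⟩ :=
      exists_velStream hω hr hm hmq hq1 hz hκr hkl
    refine ⟨k, hkN, a, b, (mem_noGoodWindow_congr hst).2 fun q hq _ _ => ?_⟩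
    exact hwin N k b ht hv hks (fun n _ => (hnotBad n (hall n)).1) q hq
  · left
    push Not at hall
    have hmin : ∀ n < Nat.find hall, ¬Bad n := fun n hn => Nat.find_min hall hn
    have hN := Nat.find_spec hall
    set N := Nat.find hall with hNdef
    by_cases hsecond : (g N).1 ≤ κ ∧ ∃ k < N, (g k).1 ≤ κ
    · -- there are two short gaps
      obtain ⟨hNs, k₀, hk₀, hk₀s⟩ := hsecond
      obtain ⟨k, hkN, hks, hkl⟩ := exists_short_index (T := fun n => (g n).1) N
        (fun n hn => (hnotBad n (hmin n hn)).2)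
      obtain rfl : k₀ = k := by
        by_contra hne
        exact absurd hk₀s (not_le.2 (hkl k₀ hk₀ hne))
      obtain ⟨a, b, -, ht, hv, -, hst, hstN⟩ :=
        exists_velStream hω hr hm hmq hq1 hz hκr hkl
      refine ⟨N, k₀, by omega, a, b, Or.inl ⟨hk₀, ?_, ?_, ?_⟩⟩
      · rw [hstN]; linarith
      · rw [hst k₀ hk₀]; linarith
      · refine (mem_noGoodWindow_congr hst).2 fun q hq _ _ => ?_
        exact hwin N k₀ b ht hv hks (fun n hn => (hnotBad n (hmin n hn)).1) q hq
    · -- there is a mismatch, and one short gap at most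
      have hmis : ¬NoMismatch r (initialZ w β₀) g N := hN.resolve_right hsecond
      push Not at hsecond
      obtain ⟨k, hkN, hks, hkl⟩ := exists_short_index (T := fun n => (g n).1) (N + 1)
        (fun n hn => by
          rcases Nat.lt_succ_iff_lt_or_eq.1 hn with h | rfl
          · exact (hnotBad n (hmin n h)).2
          · exact hsecond)
      obtain ⟨a, b, hnear, ht, hv, hmo, hst, -⟩ :=
        exists_velStream hω hr hm hmq hq1 hz hκr hkl
      have hgood := hwin N k b (fun n hn => ht n (by omega)) (fun n hn => hv n (by omega))
        (fun h => hks (by omega)) (fun n hn => (hnotBad n (hmin n hn)).1)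
      obtain ⟨j, ℓ, hj, hℓ, s, hs, hret⟩ := exists_return_of_mismatch hr hm hm1 hnear
        (fun n hn => hmo n (by omega)) (fun n _ => (hreg n).1) (hreg N).2 hmis
      have hret' : ∀ i, |∑ n ∈ (Finset.Icc j N).erase ℓ, relSign k b w ℓ g n i * (g n).1 + s| ≤ κ :=
        fun i => by
          rw [hκ]
          exact abs_sum_relSign_le hm hmq hwq (hret i)
      have hℓN : ℓ ≤ N := by omega
      have hR : ∀ n ∈ (Finset.Icc j N).erase ℓ, n ≤ N := fun n hn => by
        simp only [Finset.mem_erase, Finset.mem_Icc] at hn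
        omega
      have hst' : ∀ i ≤ N, velStream k a b w ω i = g i := fun i hi => hst i (by omega)
      refine ⟨N, k, hkN, a, b, Or.inr ?_⟩
      -- `k = N + 1` means that no gap is short
      rcases lt_or_ge N k with hk | hk
      · obtain ⟨c, hc, d, hd, i, i', l, l', hmem⟩ := exists_mem_twoReturns hw0 hj hℓ hs hκ0 hk hret'
          (fun n hn => hkl n (by omega) (by omega)) hgood
        exact Or.inl ⟨j, by omega, ℓ, hℓN, c, hR c hc, d, hR d hd, hc, hd, i, i', l, l',
          (mem_twoReturns_congr hℓN hR hc hd hst').2 hmem⟩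
      · obtain ⟨c, hc, hck, i, i', hmem⟩ := exists_mem_returnAndShort hw0 hj hℓ hs hκ0
          (hks (by omega)) (fun n _ => (hreg n).1) hret' (fun n hn => hkl n (by omega)) hgood
        exact Or.inr ⟨j, by omega, ℓ, hℓN, c, hR c hc, hc, hck, i, i',
          (mem_returnAndShort_congr hℓN hR hc hk hst').2 hmem⟩

end Leg

/-! ### Summation -/

theorem measure_iUnion_fintype_le_card {α ι : Type*} [Fintype ι] [MeasurableSpace α]
    (μ : Measure α) {s : ι → Set α} {B : ℝ≥0∞} (h : ∀ i, μ (s i) ≤ B) :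
    μ (⋃ i, s i) ≤ (Fintype.card ι : ℝ≥0∞) * B := by
  refine (measure_iUnion_fintype_le μ s).trans ?_
  rw [← nsmul_eq_mul]
  exact Finset.sum_le_card_nsmul _ _ _ fun i _ => h i

/-- A union bound over the configurations: `1` of the first kind, `81 (N + 1) ^ 4` of the second,
and `9 (N + 1) ^ 3` of the third. -/
theorem gapsLaw_unlikely_le (p : ProbVector) {w : Space} (hw : ∀ i, w i ≠ 0) (κ : ℝ) (N k : ℕ)
    (b : Bool) {P : ℝ≥0∞} (hP : ∀ a c, gapsLaw p (noGoodWindow N a c) ≤ P) :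
    gapsLaw p (unlikely κ w N k b) ≤
      ((91 * (N + 1) ^ 4 : ℕ) : ℝ≥0∞) *
        (ENNReal.ofReal (2 * κ) * (ENNReal.ofReal (2 * κ) * P)) := by
  set B := ENNReal.ofReal (2 * κ) * (ENNReal.ofReal (2 * κ) * P) with hB
  have hle : ∀ a c, ENNReal.ofReal (2 * κ) * (ENNReal.ofReal (2 * κ) *
      gapsLaw p (noGoodWindow N a c)) ≤ B := fun a c => by
    rw [hB]
    gcongr
    exact hP a c
  set E : (Fin (N + 1) × Fin (N + 1) × Fin (N + 1) × Fin (N + 1)) ×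
      (Fin 3 × Fin 3 × Fin 3 × Fin 3) → Set (ℕ → ℝ × Mark) := fun t =>
    {g | (t.1.2.2.1 : ℕ) ∈ (Finset.Icc (t.1.1 : ℕ) N).erase t.1.2.1 ∧
      (t.1.2.2.2 : ℕ) ∈ (Finset.Icc (t.1.1 : ℕ) N).erase t.1.2.1 ∧
      g ∈ twoReturns k b w κ N t.1.2.1 ((Finset.Icc (t.1.1 : ℕ) N).erase t.1.2.1) t.1.2.2.1
        t.1.2.2.2 t.2.1 t.2.2.1 t.2.2.2.1 t.2.2.2.2} with hE
  set F : (Fin (N + 1) × Fin (N + 1) × Fin (N + 1)) × (Fin 3 × Fin 3) →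
      Set (ℕ → ℝ × Mark) := fun t =>
    {g | (t.1.2.2 : ℕ) ∈ (Finset.Icc (t.1.1 : ℕ) N).erase t.1.2.1 ∧ (t.1.2.2 : ℕ) ≠ k ∧
      g ∈ returnAndShort k b w κ N t.1.2.1 ((Finset.Icc (t.1.1 : ℕ) N).erase t.1.2.1) t.1.2.2
        t.2.1 t.2.2} with hF
  have hsub : unlikely κ w N k b ⊆
      {g | k < N ∧ g ∈ twoShort κ N k} ∪ ((⋃ t, E t) ∪ ⋃ t, F t) := by
    rintro g (h | ⟨j, hj, ℓ, hℓ, a, ha, c, hc, haR, hcR, i, i', l, l', h⟩ |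
      ⟨j, hj, ℓ, hℓ, a, ha, haR, hak, i, i', h⟩)
    · exact Or.inl h
    · refine Or.inr (Or.inl (Set.mem_iUnion.2 ⟨((⟨j, by omega⟩, ⟨ℓ, by omega⟩, ⟨a, by omega⟩,
        ⟨c, by omega⟩), i, i', l, l'), haR, hcR, h⟩))
    · refine Or.inr (Or.inr (Set.mem_iUnion.2 ⟨((⟨j, by omega⟩, ⟨ℓ, by omega⟩, ⟨a, by omega⟩),
        i, i'), haR, hak, h⟩))
  have h1 : gapsLaw p {g | k < N ∧ g ∈ twoShort κ N k} ≤ B := by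
    by_cases hk : k < N
    · simpa [hk] using (gapsLaw_twoShort_le p κ hk).trans (hle k k)
    · simp [hk]
  have h2 : ∀ t, gapsLaw p (E t) ≤ B := fun t => by
    by_cases h : (t.1.2.2.1 : ℕ) ∈ (Finset.Icc (t.1.1 : ℕ) N).erase t.1.2.1 ∧
      (t.1.2.2.2 : ℕ) ∈ (Finset.Icc (t.1.1 : ℕ) N).erase t.1.2.1
    · exact (measure_mono fun g hg => hg.2.2).trans
        ((gapsLaw_twoReturns_le p k b hw κ N _ h.1 h.2 _ _ _ _).trans (hle _ _))
    · exact (measure_mono (t := ∅) fun g hg => h ⟨hg.1, hg.2.1⟩).trans (by simp)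
  have h3 : ∀ t, gapsLaw p (F t) ≤ B := fun t => by
    by_cases h : (t.1.2.2 : ℕ) ∈ (Finset.Icc (t.1.1 : ℕ) N).erase t.1.2.1 ∧ (t.1.2.2 : ℕ) ≠ k
    · exact (measure_mono fun g hg => hg.2.2).trans
        ((gapsLaw_returnAndShort_le p k b hw κ N _ h.1 h.2 _ _).trans (hle _ _))
    · exact (measure_mono (t := ∅) fun g hg => h ⟨hg.1, hg.2.1⟩).trans (by simp)
  calc gapsLaw p (unlikely κ w N k b)
      ≤ gapsLaw p {g | k < N ∧ g ∈ twoShort κ N k} +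
          (gapsLaw p (⋃ t, E t) + gapsLaw p (⋃ t, F t)) :=
        (measure_mono hsub).trans ((measure_union_le _ _).trans
          (add_le_add le_rfl (measure_union_le _ _)))
    _ ≤ B + (((81 * (N + 1) ^ 4 : ℕ) : ℝ≥0∞) * B + ((9 * (N + 1) ^ 3 : ℕ) : ℝ≥0∞) * B) := by
        refine add_le_add h1 (add_le_add ?_ ?_)
        · refine (measure_iUnion_fintype_le_card _ h2).trans (le_of_eq ?_)
          congr 2
          simp only [Fintype.card_prod, Fintype.card_fin]
          ring
        · refine (measure_iUnion_fintype_le_card _ h3).trans (le_of_eq ?_)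
          congr 2
          simp only [Fintype.card_prod, Fintype.card_fin]
          ring
    _ = ((1 + (81 * (N + 1) ^ 4 + 9 * (N + 1) ^ 3) : ℕ) : ℝ≥0∞) * B := by
        push_cast
        ring
    _ ≤ ((91 * (N + 1) ^ 4 : ℕ) : ℝ≥0∞) * B := by
        gcongr
        have h4 : 1 ≤ (N + 1) ^ 4 := Nat.one_le_pow _ _ (by omega)
        have h5 : (N + 1) ^ 3 ≤ (N + 1) ^ 4 := Nat.pow_le_pow_right (by omega) (by omega)
        omega

theorem measurePreserving_velStream (p : ProbVector) (k : ℕ) (a b : Bool) (w : Space) :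
    MeasurePreserving (velStream k a b w) (noiseLaw p) (gapsLaw p) :=
  (autonomous_velMachine k a b).measurePreserving_stream p _

theorem summable_succ_pow_mul_geometric {σ : ℝ} (hσ0 : 0 < σ) (hσ1 : σ < 1) :
    Summable fun N : ℕ => ((N : ℝ) + 1) ^ 5 * σ ^ N := by
  have h := summable_pow_mul_geometric_of_norm_lt_one (R := ℝ) 5
    (r := σ) (by rwa [Real.norm_of_nonneg hσ0.le])
  have h1 := ((summable_nat_add_iff 1).2 h).mul_left σ⁻¹
  refine h1.congr fun N => ?_
  rw [pow_succ σ N]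
  push_cast
  field_simp

/-- The probability that the processes do not agree during the leg is of second order in the size
of the obstacles. -/
theorem exists_measure_compl_agreement_le (p : ProbVector) {q : Fin 3 → ℝ} {m : ℝ} (hm : 0 < m)
    (hmq : ∀ i, m ≤ q i) (hq1 : ∀ i, q i ≤ 1) :
    ∃ C : ℝ, 0 ≤ C ∧ ∀ r, 0 < r → ∀ w β₀, (∀ i, |w i| = q i) → (initialZ w β₀).Clear r q →
      noiseLaw p (agreement r w β₀)ᶜ ≤ ENNReal.ofReal (C * r ^ 2) := by
  obtain ⟨D, σ, hD, hσ0, hσ1, hwin⟩ := exists_noGoodWindow_le p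
  have hsum := summable_succ_pow_mul_geometric hσ0 hσ1
  set S : ℝ := ∑' N : ℕ, ((N : ℝ) + 1) ^ 5 * σ ^ N with hS
  have hS0 : 0 ≤ S := tsum_nonneg fun N => by positivity
  -- there are `91 (N + 1) ^ 4` configurations, and `4 (N + 2) ≤ 8 (N + 1)` imitating processes
  set A : ℝ := 728 * D * (20 / m / m) ^ 2 with hA
  have hA0 : 0 ≤ A := by positivity
  refine ⟨A * S + 25 / m ^ 4, by positivity, fun r hr w β₀ hwq hz => ?_⟩
  set κ : ℝ := 5 * r / m / m with hκ
  have hκ0 : 0 ≤ κ := by positivity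
  rcases lt_or_ge 1 κ with hκ1 | hκ1
  · -- for large obstacles the bound is trivial
    refine prob_le_one.trans ?_
    rw [← ENNReal.ofReal_one]
    refine ENNReal.ofReal_le_ofReal ?_
    have h1 : 25 / m ^ 4 * r ^ 2 = κ ^ 2 := by
      rw [hκ]
      field_simp
      ring
    have h2 : 0 ≤ A * S * r ^ 2 := by positivity
    nlinarith
  have hw0 : ∀ i, w i ≠ 0 := fun i => by
    rw [← abs_pos, hwq]
    exact hm.trans_le (hmq i)
  set U : Set (ℕ → Noise) := ⋃ N : ℕ, ⋃ t : Fin (N + 2) × Bool × Bool,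
    velStream t.1 t.2.1 t.2.2 w ⁻¹' unlikely (2 * κ) w N t.1 t.2.2 with hU
  set V : Set (ℕ → Noise) := {ω | ∀ N, ∃ k ≤ N, ∃ a b,
    velStream k a b w ω ∈ noGoodWindow N k k} with hV
  have hV0 : noiseLaw p V = 0 := by
    have hle : ∀ N : ℕ, noiseLaw p V ≤
        ENNReal.ofReal (4 * D * (((N : ℝ) + 1) ^ 5 * σ ^ N)) := by
      intro N
      have hsub : V ⊆ ⋃ t : Fin (N + 1) × Bool × Bool,
          velStream t.1 t.2.1 t.2.2 w ⁻¹' noGoodWindow N t.1 t.1 := fun ω hω => by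
        obtain ⟨k, hk, a, b, h⟩ := hω N
        exact Set.mem_iUnion.2 ⟨(⟨k, by omega⟩, a, b), h⟩
      refine (measure_mono hsub).trans ((measure_iUnion_fintype_le_card _ fun t =>
        ((measurePreserving_velStream p _ _ _ w).measure_preimage_le _).trans
          (hwin N _ _)).trans ?_)
      rw [← ENNReal.ofReal_natCast, ← ENNReal.ofReal_mul (by positivity)]
      refine ENNReal.ofReal_le_ofReal ?_
      simp only [Fintype.card_prod, Fintype.card_fin, Fintype.card_bool]
      push_cast
      have h1 : (N : ℝ) + 1 ≤ ((N : ℝ) + 1) ^ 5 :=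
        le_self_pow₀ (by linarith [Nat.cast_nonneg (α := ℝ) N]) (by norm_num)
      have h2 : 0 ≤ D * σ ^ N := by positivity
      nlinarith
    have hlim : Filter.Tendsto (fun N : ℕ =>
        ENNReal.ofReal (4 * D * (((N : ℝ) + 1) ^ 5 * σ ^ N))) Filter.atTop (nhds 0) := by
      have := ENNReal.tendsto_ofReal (hsum.tendsto_atTop_zero.const_mul (4 * D))
      simpa using this
    exact le_antisymm (ge_of_tendsto' hlim hle) bot_le
  have hU1 : noiseLaw p U ≤ ENNReal.ofReal (A * S * r ^ 2) := by
    have hN : ∀ N : ℕ, noiseLaw p (⋃ t : Fin (N + 2) × Bool × Bool,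
        velStream t.1 t.2.1 t.2.2 w ⁻¹' unlikely (2 * κ) w N t.1 t.2.2) ≤
          ENNReal.ofReal (A * r ^ 2 * (((N : ℝ) + 1) ^ 5 * σ ^ N)) := by
      intro N
      refine (measure_iUnion_fintype_le_card _ fun t =>
        ((measurePreserving_velStream p _ _ _ w).measure_preimage_le _).trans
          (gapsLaw_unlikely_le p hw0 (2 * κ) N _ _ (hwin N))).trans ?_
      rw [← ENNReal.ofReal_mul (by positivity), ← ENNReal.ofReal_mul (by positivity),
        ← ENNReal.ofReal_natCast (91 * (N + 1) ^ 4), ← ENNReal.ofReal_mul (by positivity),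
        ← ENNReal.ofReal_natCast (Fintype.card _), ← ENNReal.ofReal_mul (by positivity)]
      refine ENNReal.ofReal_le_ofReal ?_
      simp only [Fintype.card_prod, Fintype.card_fin, Fintype.card_bool]
      push_cast
      have h1 : (N : ℝ) + 2 ≤ 2 * ((N : ℝ) + 1) := by linarith [Nat.cast_nonneg (α := ℝ) N]
      have h2 : 2 * (2 * κ) = 20 / m / m * r := by
        rw [hκ]
        ring
      rw [h2]
      calc ((N : ℝ) + 2) * 4 * (91 * ((N : ℝ) + 1) ^ 4 *
            (20 / m / m * r * (20 / m / m * r * (D * σ ^ N))))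
          ≤ (2 * ((N : ℝ) + 1)) * 4 * (91 * ((N : ℝ) + 1) ^ 4 *
            (20 / m / m * r * (20 / m / m * r * (D * σ ^ N)))) := by gcongr
        _ = A * r ^ 2 * (((N : ℝ) + 1) ^ 5 * σ ^ N) := by
          rw [hA]
          ring
    refine (measure_iUnion_le _).trans ((ENNReal.tsum_le_tsum hN).trans (le_of_eq ?_))
    rw [← ENNReal.ofReal_tsum_of_nonneg (fun N => by positivity) (hsum.mul_left _), tsum_mul_left]
    congr 1
    ring
  have hle : ∀ᵐ ω ∂noiseLaw p, ω ∈ (agreement r w β₀)ᶜ → ω ∈ U ∪ V := by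
    filter_upwards [ae_regular p] with ω hω hna
    rcases exists_unlikely_of_not_agreement hω hr hm hmq hq1 hwq hz hκ hκ1 hna with
      ⟨N, k, hk, a, b, h⟩ | h
    · exact Or.inl (Set.mem_iUnion.2 ⟨N, Set.mem_iUnion.2 ⟨(⟨k, by omega⟩, a, b), h⟩⟩)
    · exact Or.inr h
  calc noiseLaw p (agreement r w β₀)ᶜ ≤ noiseLaw p (U ∪ V) := measure_mono_ae hle
    _ ≤ noiseLaw p U + noiseLaw p V := measure_union_le _ _
    _ ≤ ENNReal.ofReal (A * S * r ^ 2) := by rw [hV0, add_zero]; exact hU1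
    _ ≤ ENNReal.ofReal ((A * S + 25 / m ^ 4) * r ^ 2) := by
        refine ENNReal.ofReal_le_ofReal ?_
        have : 0 ≤ 25 / m ^ 4 := by positivity
        gcongr
        linarith

/-! ### The condition on the first two flights -/

/-- The event that the first two flights of the Markovian process are longer than `1`. -/
def longClocks : Set (ℕ → Noise) := {ω | 1 < (ω 0).clock 1 ∧ 1 < (ω 0).clock 2}

/-- At time `0` the velocities of all processes agree, so that the forgetful process attempts at the
first two jump times of the Markovian process. -/
theorem longClocks_subset_longStart (r : ℝ) (w β₀ : Space) : longClocks ⊆ longStart r w β₀ := by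
  intro ω hω
  have hsch : schedule (SameParity w w) (ω 0) = [(1, (ω 0).clock 1), (2, (ω 0).clock 2)] :=
    if_pos (Or.inl rfl)
  have hfst : ∀ i (hi : i < 2), (zStream r w β₀ ω i).1 =
      ([(1, (ω 0).clock 1), (2, (ω 0).clock 2)] : List (Fin 3 × ℝ))[i].2 := fun i hi => by
    have hblock : (zMachine r).block (initialZ w β₀, w) (ω 0) = (zMachine r).feed w (ω 0)
        [(1, (ω 0).clock 1), (2, (ω 0).clock 2)] (initialZ w β₀) := by
      rw [← hsch]
      rfl
    have h1 := (zMachine r).block_getElem? (initialZ w β₀, w) ω (i := i) (by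
      rw [hblock, Machine.length_feed]
      exact hi)
    have h2 := (zMachine r).feed_getElem?_fst w (ω 0) [(1, (ω 0).clock 1), (2, (ω 0).clock 2)]
      (initialZ w β₀) i
    rw [← hblock, h1, List.getElem?_eq_getElem hi] at h2
    exact Option.some.inj h2
  refine ⟨?_, ?_⟩
  · rw [gap_succ, stretchZ_eq]
    exact (hω.1).trans_eq (hfst 0 (by norm_num)).symm
  · rw [gap_succ, stretchZ_eq]
    exact (hω.2).trans_eq (hfst 1 (by norm_num)).symm

theorem noiseLaw_longClocks (p : ProbVector) : noiseLaw p longClocks ≠ 0 := by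
  set B : Set (Fin 3 → ℝ) := Set.univ.pi fun i => if i = 0 then Set.univ else Set.Ioi 1 with hB
  have hBm : MeasurableSet B := .univ_pi fun i => by
    split_ifs
    · exact .univ
    · exact measurableSet_Ioi
  have hset : longClocks = (fun ω : ℕ → Noise => (ω 0).1) ⁻¹' B := by
    ext ω
    simp only [longClocks, Set.mem_ofPred_eq, Set.mem_preimage, hB, Set.mem_univ_pi, Noise.clock]
    constructor
    · intro h i
      fin_cases i
      · simp
      · simpa using h.1
      · simpa using h.2
    · intro h
      exact ⟨by simpa using h 1, by simpa using h 2⟩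
  have hmp : MeasurePreserving (fun ω : ℕ → Noise => (ω 0).1) (noiseLaw p)
      (Measure.pi fun _ : Fin 3 => expLaw) :=
    measurePreserving_fst.comp (measurePreserving_eval_infinitePi (fun _ : ℕ => blockLaw p) 0)
  have hexp : expLaw (Set.Ioi 1) ≠ 0 := by
    have h1 : expLaw (Set.Ici 1) = expLaw (Set.Ioi 1) := by
      rw [← Set.Ioi_union_left, measure_union (by simp) (measurableSet_singleton _),
        expLaw_singleton, add_zero]
    rw [← h1, expLaw_Ici zero_le_one]
    simpa using Real.exp_pos _
  rw [hset, hmp.measure_preimage hBm.nullMeasurableSet, hB, Measure.pi_pi]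
  refine Finset.prod_ne_zero_iff.2 fun i _ => ?_
  split_ifs
  · simp
  · exact hexp

theorem cond_le_inv_mul {Ω : Type*} [MeasurableSpace Ω] (μ : Measure Ω) (s t : Set Ω) :
    μ[|s] t ≤ (μ s)⁻¹ * μ t := by
  rw [ProbabilityTheory.cond, Measure.smul_apply, smul_eq_mul]
  gcongr
  exact Measure.restrict_le_self

end WindTree

theorem proposition3 (p : WindTree.ProbVector) :
    ∃ C : ℝ, ∀ r : ℝ, 0 < r → ∀ w ∈ WindTree.velocities p, ∀ u ∈ WindTree.accessible p w,
      ∀ β₀ ∈ -WindTree.hitFace r u w,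
        (WindTree.noiseLaw p)[|WindTree.longStart r w β₀] (WindTree.agreement r w β₀)ᶜ
          ≤ ENNReal.ofReal (C * r ^ 2) := by
  have hsq : 0 < ∑ i, p.val i ^ 2 := Finset.sum_pos (fun i _ => pow_pos (p.pos i) 2) (by simp)
  have hlen : 0 < p.length := Real.sqrt_pos.2 hsq
  have hq : ∀ i, 0 < p.val i / p.length := fun i => div_pos (p.pos i) hlen
  have hq1 : ∀ i, p.val i / p.length ≤ 1 := fun i => by
    rw [div_le_one hlen]
    refine Real.le_sqrt_of_sq_le ?_
    exact Finset.single_le_sum (f := fun i => p.val i ^ 2) (fun i _ => sq_nonneg _)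
      (Finset.mem_univ i)
  obtain ⟨i₀, -, hi₀⟩ := Finset.exists_min_image Finset.univ (fun i => p.val i / p.length)
    ⟨0, Finset.mem_univ _⟩
  obtain ⟨C, hC, hle⟩ := WindTree.exists_measure_compl_agreement_le p (hq i₀)
    (fun i => hi₀ i (Finset.mem_univ i)) hq1
  refine ⟨((WindTree.noiseLaw p WindTree.longClocks)⁻¹).toReal * C,
    fun r hr w hw u _ β₀ hβ => ?_⟩
  have hinv : (WindTree.noiseLaw p (WindTree.longStart r w β₀))⁻¹ ≤
      ENNReal.ofReal ((WindTree.noiseLaw p WindTree.longClocks)⁻¹).toReal := by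
    rw [ENNReal.ofReal_toReal (ENNReal.inv_ne_top.2 (WindTree.noiseLaw_longClocks p))]
    exact ENNReal.inv_le_inv.2 (measure_mono (WindTree.longClocks_subset_longStart r w β₀))
  refine (WindTree.cond_le_inv_mul _ _ _).trans ?_
  rw [mul_assoc, ENNReal.ofReal_mul ENNReal.toReal_nonneg]
  exact mul_le_mul' hinv (hle r hr w β₀ hw.2 (WindTree.initialZ_clear hr hw.2 hq hβ))
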